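/- Let $\Bbbk$ be a commutative ring. All Lie algebras $\mathfrak g$ below are Lie algebras over $\Bbbk$ (the bracket is $\Bbbk$-bilinear, satisfies the Jacobi identity and $[x,x]=0$). $U\mathfrak g$ is the universal enveloping algebra, $\Bbbk$ is regarded as the trivial left $U\mathfrak g$-module via the augmentation $U\mathfrak g\to\Bbbk$, and $\otimes=\otimes_\Bbbk$. For a right $U\mathfrak g$-module $M$ let ${\sf CE}_\bullet(\mathfrak g,M)$ be the complex with ${\sf CE}_n(\mathfrak g,M)=M\otimes\Lambda^n\mathfrak g$ and $$\partial(m\otimes x_1\wedge\dots\wedge x_n)=\sum_{i=1}^n(-1)^{i+1}mx_i\otimes x_1\wedge\dots\wedge\hat x_i\wedge\dots\wedge x_n+\sum_{i<j}(-1)^{i+j}m\otimes[x_i,x_j]\wedge x_1\wedge\dots\wedge\hat x_i\wedge\dots\wedge\hat x_j\wedge\dots\wedge x_n,$$ and let $H^{\sf CE}_n(\mathfrak g,M)$ be its homology. For a $\Bbbk$-algebra $R$, an $R$-module is called $(R,\Bbbk)$-projective if it has the lifting property with respect to all surjections of $R$-modules that admit a $\Bbbk$-linear section. A resolution of an $R$-module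 is $\Bbbk$-split if the augmented complex has a $\Bbbk$-linear contracting homotopy, and $\Bbbk$-pure if the augmented complex remains exact after applying $-\otimes V$ for every $\Bbbk$-module $V$. For a right $R$-module $M$ and a left $R$-module $N$ put ${\sf Tor}^{(R,\Bbbk)}_n(M,N)=H_n(P_\bullet\otimes_R N)$, where $P_\bullet\to M$ is a $\Bbbk$-split $(R,\Bbbk)$-projective resolution; induced maps are computed by chain maps between such resolutions. **Theorem.** Consider the Lie algebras $\mathfrak g$ over $\Bbbk$ such that either $\Bbbk$ is a principal ideal domain, or $\mathfrak g$ is flat as a $\Bbbk$-module. For all such $\mathfrak g$, all right $U\mathfrak g$-modules $M$ and all $n\ge 0$ there are isomorphisms of $\Bbbk$-modules $$H^{\sf CE}_n(\mathfrak g,M)\;\cong\;{\sf Tor}^{(U\mathfrak g,\Bbbk)}_n(M,\Bbbk),$$ for every choice of the $\Bbbk$-split $(U\mathfrak g,\Bbbk)$-projective resolution of $M$ that computes the right-hand side. They are natural in $\mathfrak g$, in $M$ and in the resolution: they are compatible with the maps induced by a homomorphism of such Lie algebras $f:\mathfrak g\to\mathfrak h$, a map $\varphi:M\to N$ from a right $U\mathfrak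 g$-module to a right $U\mathfrak h$-module that is linear over $Uf$, and any chain map over $Uf$ that lifts $\varphi$ to the chosen resolutions. Moreover, for every such $\mathfrak g$, the complex of left $U\mathfrak g$-modules ${\sf CE}_\bullet(\mathfrak g,U\mathfrak g)$, augmented by $U\mathfrak g\to\Bbbk$, is a $\Bbbk$-pure $(U\mathfrak g,\Bbbk)$-projective resolution of $\Bbbk$. -/

import Mathlib

open scoped TensorProduct ExteriorAlgebra
open MulOpposite (op)

universe u

namespace CEHom

section ChevalleyEilenberg

variable (k g : Type u) [CommRing k] [LieRing g] [LieAlgebra k g]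

local notation "E" => ExteriorAlgebra k g
local notation "ιE" => ExteriorAlgebra.ι k

/-- Recursion step for `lieDer`. -/
noncomputable def lieDerStep : g →ₗ[k] E × (g →ₗ[k] E) →ₗ[k] (g →ₗ[k] E) :=
  LinearMap.mk₂ k
    (fun y p =>
      { toFun := fun x => ιE ⁅x, y⁆ * p.1 + ιE y * p.2 x
        map_add' := by intros; simp [add_mul, mul_add]; abel
        map_smul' := by intros; simp })
    (by intros; ext; simp [add_mul]; abel)
    (by intros; ext; simp)
    (by intros; ext; simp [mul_add]; abel)
    (by intros; ext; simp)

theorem lieDerStep_apply (y x : g) (p : E × (g →ₗ[k] E)) :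
    lieDerStep k g y p x = ιE ⁅x, y⁆ * p.1 + ιE y * p.2 x := rfl

theorem ι_anticomm (x y : g) (ω : E) : ιE x * (ιE y * ω) = - (ιE y * (ιE x * ω)) := by
  have h := ExteriorAlgebra.ι_add_mul_swap (R := k) x y
  rw [← mul_assoc, ← mul_assoc, ← neg_mul, eq_neg_of_add_eq_zero_left h]

theorem ι_sq (x : g) (ω : E) : ιE x * (ιE x * ω) = 0 := by
  rw [← mul_assoc, ExteriorAlgebra.ι_sq_zero, zero_mul]

theorem lieDerStep_step (y : g) (ω : E) (η : g →ₗ[k] E) :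
    lieDerStep k g y (ιE y * ω, lieDerStep k g y (ω, η)) = (0 : QuadraticForm k g) y • η := by
  ext x
  simp only [lieDerStep_apply, mul_add, ι_anticomm k g ⁅x, y⁆ y ω, ι_sq k g y (η x)]
  simp

/-- The derivation of the exterior algebra extending `y ↦ ⁅x, y⁆`, as a linear map in `x`. -/
noncomputable def lieDer : E →ₗ[k] (g →ₗ[k] E) :=
  CliffordAlgebra.foldr' (0 : QuadraticForm k g) (lieDerStep k g)
    (lieDerStep_step k g) 0

theorem lieDer_one (x : g) : lieDer k g 1 x = 0 := by
  have h := CliffordAlgebra.foldr'_algebraMap (0 : QuadraticForm k g) (lieDerStep k g)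
    (lieDerStep_step k g) 0 1
  rw [map_one, one_smul] at h
  exact congrArg (fun f : g →ₗ[k] E => f x) h

theorem lieDer_ι_mul (y x : g) (ω : E) :
    lieDer k g (ιE y * ω) x = ιE ⁅x, y⁆ * ω + ιE y * lieDer k g ω x := by
  unfold lieDer
  erw [CliffordAlgebra.foldr'_ι_mul]
  rfl

variable (M : Type u) [AddCommGroup M] [Module k M]

/-- Left exterior multiplication by `x` on `M ⊗ Λ g`. -/
noncomputable def extMul (x : g) : M ⊗[k] E →ₗ[k] M ⊗[k] E :=
  LinearMap.lTensor M (LinearMap.mulLeft k (ιE x))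

theorem extMul_tmul (x : g) (m : M) (ω : E) :
    extMul k g M x (m ⊗ₜ[k] ω) = m ⊗ₜ[k] (ιE x * ω) := rfl

theorem extMul_add (x y : g) (t : M ⊗[k] E) :
    extMul k g M (x + y) t = extMul k g M x t + extMul k g M y t := by
  induction t with
  | zero => simp
  | tmul m ω => simp [extMul_tmul, add_mul, TensorProduct.tmul_add]
  | add a b ha hb => simp only [map_add, ha, hb]; abel

theorem extMul_smul (c : k) (x : g) (t : M ⊗[k] E) :
    extMul k g M (c • x) t = c • extMul k g M x t := by
  induction t with
  | zero => simp
  | tmul m ω => simp [extMul_tmul]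
  | add a b ha hb => simp only [map_add, ha, hb, smul_add]

theorem extMul_extMul (x : g) (t : M ⊗[k] E) : extMul k g M x (extMul k g M x t) = 0 := by
  induction t with
  | zero => simp
  | tmul m ω => simp [extMul_tmul, ι_sq]
  | add a b ha hb => simp only [map_add, ha, hb, add_zero]

theorem tensor_ext_induction {p : M ⊗[k] E → Prop} (h0 : p 0)
    (hadd : ∀ a b, p a → p b → p (a + b)) (h1 : ∀ m, p (m ⊗ₜ[k] 1))
    (hmul : ∀ (x : g) t, p t → p (extMul k g M x t)) (t : M ⊗[k] E) : p t := by
  induction t with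
  | zero => exact h0
  | tmul m ω =>
    induction ω using CliffordAlgebra.left_induction generalizing m with
    | algebraMap r =>
      have := h1 (r • m)
      rwa [TensorProduct.smul_tmul, ← Algebra.algebraMap_eq_smul_one] at this
    | add a b ha hb => rw [TensorProduct.tmul_add]; exact hadd _ _ (ha m) (hb m)
    | ι_mul ω x h => exact hmul x _ (h m)
  | add a b ha hb => exact hadd _ _ ha hb

theorem tmul_ext {N : Type u} [AddCommGroup N] [Module k N] {n : ℕ}
    {f f' : M ⊗[k] (⋀[k]^n g) →ₗ[k] N}
    (h : ∀ m x, f (m ⊗ₜ[k] exteriorPower.ιMulti k n x) = f' (m ⊗ₜ[k] exteriorPower.ιMulti k n x)) :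
    f = f' := by
  refine TensorProduct.ext (LinearMap.ext fun m => ?_)
  refine exteriorPower.linearMap_ext ?_
  ext x
  exact h m x

variable [Module (UniversalEnvelopingAlgebra k g)ᵐᵒᵖ M]
  [IsScalarTower k (UniversalEnvelopingAlgebra k g)ᵐᵒᵖ M]

/-- The right action of `g` on a right `U g`-module, `m ↦ m x`. -/
noncomputable def rAct : g →ₗ[k] M →ₗ[k] M :=
  LinearMap.mk₂ k (fun x m => op (UniversalEnvelopingAlgebra.ι k x) • m)
    (by intros; simp [add_smul]) (by intros; simp) (by intros; simp)
    (by intro c x m; exact smul_comm _ _ _)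

theorem rAct_apply (x : g) (m : M) :
    rAct k g M x m = op (UniversalEnvelopingAlgebra.ι k x) • m := rfl

/-- Recursion step for `totalD`. -/
noncomputable def totalDStep :
    g →ₗ[k] E × (M →ₗ[k] M ⊗[k] E) →ₗ[k] (M →ₗ[k] M ⊗[k] E) :=
  LinearMap.mk₂ k
    (fun x p =>
      { toFun := fun m => rAct k g M x m ⊗ₜ[k] p.1 - m ⊗ₜ[k] lieDer k g p.1 x
          - extMul k g M x (p.2 m)
        map_add' := by
          intros; simp only [map_add, TensorProduct.add_tmul]; abel
        map_smul' := by
          intros; simp [TensorProduct.smul_tmul', smul_sub] })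
    (by intros; ext; simp [TensorProduct.add_tmul, TensorProduct.tmul_add, extMul_add]; abel)
    (by intros; ext; simp [TensorProduct.smul_tmul', smul_sub, extMul_smul])
    (by intros; ext; simp [TensorProduct.tmul_add]; abel)
    (by intros; ext; simp [smul_sub])

theorem totalDStep_apply (x : g) (p : E × (M →ₗ[k] M ⊗[k] E)) (m : M) :
    totalDStep k g M x p m = rAct k g M x m ⊗ₜ[k] p.1 - m ⊗ₜ[k] lieDer k g p.1 x
          - extMul k g M x (p.2 m) := rfl

theorem totalDStep_step (x : g) (ω : E) (η : M →ₗ[k] M ⊗[k] E) :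
    totalDStep k g M x (ιE x * ω, totalDStep k g M x (ω, η)) = (0 : QuadraticForm k g) x • η := by
  ext m
  simp only [totalDStep_apply, map_sub, extMul_extMul, lieDer_ι_mul, extMul_tmul, lie_self,
    map_zero, zero_mul, zero_add, LinearMap.zero_apply, sub_zero, sub_self,
    _root_.zero_apply, zero_smul]

/-- The Chevalley-Eilenberg differential on `M ⊗ Λ g`, by recursion on the exterior degree. -/
noncomputable def totalD : M ⊗[k] E →ₗ[k] M ⊗[k] E :=
  TensorProduct.lift (LinearMap.flip
    (CliffordAlgebra.foldr' (0 : QuadraticForm k g) (totalDStep k g M)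
      (totalDStep_step k g M) 0))

theorem totalD_one (m : M) : totalD k g M (m ⊗ₜ[k] 1) = 0 := by
  have h := CliffordAlgebra.foldr'_algebraMap (0 : QuadraticForm k g) (totalDStep k g M)
    (totalDStep_step k g M) 0 1
  rw [map_one, one_smul] at h
  exact congrArg (fun f : M →ₗ[k] M ⊗[k] E => f m) h

theorem totalD_ι_mul (m : M) (x : g) (ω : E) :
    totalD k g M (m ⊗ₜ[k] (ιE x * ω)) =
      rAct k g M x m ⊗ₜ[k] ω - m ⊗ₜ[k] lieDer k g ω x
        - extMul k g M x (totalD k g M (m ⊗ₜ[k] ω)) := by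
  unfold totalD
  simp only [TensorProduct.lift.tmul, LinearMap.flip_apply]
  erw [CliffordAlgebra.foldr'_ι_mul]
  rfl


/-- The right action of `x` on `M ⊗ Λ g`. -/
noncomputable def actR (x : g) : M ⊗[k] E →ₗ[k] M ⊗[k] E :=
  LinearMap.rTensor E (rAct k g M x) - LinearMap.lTensor M ((lieDer k g).flip x)

theorem actR_tmul (x : g) (m : M) (ω : E) :
    actR k g M x (m ⊗ₜ[k] ω) = rAct k g M x m ⊗ₜ[k] ω - m ⊗ₜ[k] lieDer k g ω x := rfl

theorem totalD_extMul (x : g) (t : M ⊗[k] E) :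
    totalD k g M (extMul k g M x t) = actR k g M x t - extMul k g M x (totalD k g M t) := by
  induction t with
  | zero => simp
  | tmul m ω => rw [extMul_tmul, totalD_ι_mul, actR_tmul]
  | add a b ha hb => simp only [map_add, ha, hb]; abel

theorem actR_extMul (x y : g) (t : M ⊗[k] E) :
    actR k g M x (extMul k g M y t) =
      extMul k g M y (actR k g M x t) - extMul k g M ⁅x, y⁆ t := by
  induction t with
  | zero => simp
  | tmul m ω =>
    simp only [extMul_tmul, actR_tmul, lieDer_ι_mul, map_sub, TensorProduct.tmul_add]; abel
  | add a b ha hb => simp only [map_add, ha, hb]; abel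

attribute [local instance 100] LieRing.ofAssociativeRing in
theorem rAct_rAct (x y : g) (m : M) :
    rAct k g M x (rAct k g M y m) = rAct k g M y (rAct k g M x m) - rAct k g M ⁅x, y⁆ m := by
  simp only [rAct_apply, smul_smul, ← MulOpposite.op_mul, ← sub_smul, ← MulOpposite.op_sub]
  congr 2
  have h := LieHom.map_lie (UniversalEnvelopingAlgebra.ι k) x y
  rw [LieRing.of_associative_ring_bracket] at h
  rw [h]
  abel

theorem actR_actR (x y : g) (t : M ⊗[k] E) :
    actR k g M x (actR k g M y t) = actR k g M y (actR k g M x t) - actR k g M ⁅x, y⁆ t := by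
  induction t using tensor_ext_induction with
  | h0 => simp
  | hadd a b ha hb => simp only [map_add, ha, hb]; abel
  | h1 m => 
    simp only [actR_tmul, lieDer_one, TensorProduct.tmul_zero, sub_zero, rAct_rAct k g M x y,
      TensorProduct.sub_tmul]
  | hmul z t h => 
    simp only [actR_extMul, map_sub, h]
    have hj : extMul k g M ⁅x, ⁅y, z⁆⁆ t =
        extMul k g M ⁅⁅x, y⁆, z⁆ t + extMul k g M ⁅y, ⁅x, z⁆⁆ t := by
      rw [← extMul_add, leibniz_lie]
    rw [hj]; abel

theorem totalD_actR (x : g) (t : M ⊗[k] E) :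
    totalD k g M (actR k g M x t) = actR k g M x (totalD k g M t) := by
  induction t using tensor_ext_induction with
  | h0 => simp
  | hadd a b ha hb => simp only [map_add, ha, hb]
  | h1 m => simp only [actR_tmul, lieDer_one, TensorProduct.tmul_zero, sub_zero, totalD_one, map_zero]
  | hmul z t h => 
    simp only [actR_extMul, totalD_extMul, map_sub, h, actR_actR k g M x z]
    abel

theorem totalD_totalD (t : M ⊗[k] E) : totalD k g M (totalD k g M t) = 0 := by
  induction t using tensor_ext_induction with
  | h0 => simp
  | hadd a b ha hb => simp only [map_add, ha, hb, add_zero]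
  | h1 m => simp only [totalD_one, map_zero]
  | hmul z t h => simp only [totalD_extMul, map_sub, totalD_actR, h, map_zero, sub_zero, sub_self]


theorem lieDer_ι (y x : g) : lieDer k g (ιE y) x = ιE ⁅x, y⁆ := by
  rw [← mul_one (ιE y), lieDer_ι_mul, lieDer_one, mul_zero, add_zero, mul_one]

theorem lieDer_ιMulti (n : ℕ) (x : g) (y : Fin (n + 1) → g) :
    lieDer k g (ExteriorAlgebra.ιMulti k (n + 1) y) x =
      ∑ j : Fin (n + 1), (-1 : k) ^ (j : ℕ) •
        ExteriorAlgebra.ιMulti k (n + 1) (Fin.cons ⁅x, y j⁆ (j.removeNth y) : Fin (n + 1) → g) := by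
  induction n with
  | zero =>
    simp [ExteriorAlgebra.ιMulti_succ_apply, lieDer_ι]
  | succ n ih =>
    rw [ExteriorAlgebra.ιMulti_succ_apply, lieDer_ι_mul, Fin.sum_univ_succ, ih, Finset.mul_sum]
    congr 1
    · simp [ExteriorAlgebra.ιMulti_succ_apply]
      rfl
    · refine Finset.sum_congr rfl fun j _ => ?_
      simp only [ExteriorAlgebra.ιMulti_succ_apply, Fin.cons_zero, Matrix.vecTail, Function.comp_def,
        Fin.cons_succ, Fin.val_succ, pow_succ, mul_smul_comm, ι_anticomm k g (y 0), Fin.removeNth,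
        Fin.succ_succAbove_zero, Fin.succ_succAbove_succ]
      simp

theorem totalD_ιMulti_one (m : M) (x : Fin 1 → g) :
    totalD k g M (m ⊗ₜ[k] ExteriorAlgebra.ιMulti k 1 x) = rAct k g M (x 0) m ⊗ₜ[k] 1 := by
  rw [ExteriorAlgebra.ιMulti_succ_apply, ExteriorAlgebra.ιMulti_zero_apply, totalD_ι_mul,
    totalD_one, lieDer_one, map_zero, TensorProduct.tmul_zero, sub_zero, sub_zero]

theorem ιMulti_removeNth_succ (n : ℕ) (x : Fin (n + 2) → g) (i : Fin (n + 1)) :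
    ExteriorAlgebra.ιMulti k (n + 1) (i.succ.removeNth x) =
      ιE (x 0) * ExteriorAlgebra.ιMulti k n (i.removeNth (Matrix.vecTail x)) := by
  simp only [ExteriorAlgebra.ιMulti_succ_apply, Matrix.vecTail, Function.comp_def, Fin.removeNth,
        Fin.succ_succAbove_zero, Fin.succ_succAbove_succ]
  rfl

theorem ιMulti_cons_succ (n : ℕ) (x : Fin (n + 3) → g) (z : g) (i : Fin (n + 2)) (j : Fin (n + 1)) :
    ExteriorAlgebra.ιMulti k (n + 2)
        (Fin.cons z (j.succ.removeNth (i.succ.removeNth x)) : Fin (n + 2) → g) =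
      - (ιE (x 0) * ExteriorAlgebra.ιMulti k (n + 1)
        (Fin.cons z (j.removeNth (i.removeNth (Matrix.vecTail x))) : Fin (n + 1) → g)) := by
  simp only [ExteriorAlgebra.ιMulti_succ_apply, Matrix.vecTail, Function.comp_def, Fin.removeNth,
        Fin.succ_succAbove_zero, Fin.succ_succAbove_succ, Fin.cons_zero, Fin.cons_succ,
        ι_anticomm k g (x 0), neg_neg]

theorem totalD_ιMulti (n : ℕ) (m : M) (x : Fin (n + 2) → g) :
    totalD k g M (m ⊗ₜ[k] ExteriorAlgebra.ιMulti k (n + 2) x) =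
      ∑ i : Fin (n + 2), (-1 : k) ^ (i : ℕ) •
          rAct k g M (x i) m ⊗ₜ[k] ExteriorAlgebra.ιMulti k (n + 1) (i.removeNth x) +
      ∑ i : Fin (n + 2), ∑ j : Fin (n + 1), if (i : ℕ) ≤ (j : ℕ) then
          (-1 : k) ^ ((i : ℕ) + ((j : ℕ) + 1)) •
            m ⊗ₜ[k] ExteriorAlgebra.ιMulti k (n + 1)
              (Fin.cons ⁅x i, x j.succ⁆ (j.removeNth (i.removeNth x)) : Fin (n + 1) → g)
        else 0 := by
  have h0 : ExteriorAlgebra.ιMulti k (n + 2) x =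
      ιE (x 0) * ExteriorAlgebra.ιMulti k (n + 1) (Matrix.vecTail x) :=
    ExteriorAlgebra.ιMulti_succ_apply _
  rw [h0, totalD_ι_mul, Fin.sum_univ_succ, Fin.sum_univ_succ (n := n + 1)]
  have e1 : ∑ j : Fin (n + 1), (if ((0 : Fin (n + 2)) : ℕ) ≤ (j : ℕ) then
          (-1 : k) ^ (((0 : Fin (n + 2)) : ℕ) + ((j : ℕ) + 1)) •
            m ⊗ₜ[k] ExteriorAlgebra.ιMulti k (n + 1)
              (Fin.cons ⁅x 0, x j.succ⁆ (j.removeNth (Fin.removeNth 0 x)) : Fin (n + 1) → g)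
        else 0) = - (m ⊗ₜ[k] lieDer k g (ExteriorAlgebra.ιMulti k (n + 1) (Matrix.vecTail x)) (x 0)) := by
    rw [lieDer_ιMulti, TensorProduct.tmul_sum, ← Finset.sum_neg_distrib]
    refine Finset.sum_congr rfl fun j _ => ?_
    rw [if_pos (by simp)]
    simp only [Fin.val_zero, zero_add, pow_succ, mul_neg_one, neg_smul, TensorProduct.tmul_smul]
    rfl
  have e2 : ∑ i : Fin (n + 1), (-1 : k) ^ (i.succ : ℕ) •
          rAct k g M (x i.succ) m ⊗ₜ[k] ExteriorAlgebra.ιMulti k (n + 1) (i.succ.removeNth x) =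
      - extMul k g M (x 0) (∑ i : Fin (n + 1), (-1 : k) ^ (i : ℕ) •
          rAct k g M (Matrix.vecTail x i) m ⊗ₜ[k]
            ExteriorAlgebra.ιMulti k n (i.removeNth (Matrix.vecTail x))) := by
    rw [map_sum, ← Finset.sum_neg_distrib]
    refine Finset.sum_congr rfl fun i _ => ?_
    rw [map_smul, extMul_tmul, ιMulti_removeNth_succ]
    simp only [Fin.val_succ, pow_succ, mul_neg_one, neg_smul]
    rfl
  rw [e1, e2]
  cases n with
  | zero =>
    rw [totalD_ιMulti_one]
    simp [Fin.tail, Matrix.vecTail, Function.comp_def, sub_eq_add_neg]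
    abel
  | succ n =>
    have e3 : ∑ i : Fin (n + 2), ∑ j : Fin (n + 2), (if (i.succ : ℕ) ≤ (j : ℕ) then
          (-1 : k) ^ ((i.succ : ℕ) + ((j : ℕ) + 1)) •
            m ⊗ₜ[k] ExteriorAlgebra.ιMulti k (n + 2)
              (Fin.cons ⁅x i.succ, x j.succ⁆ (j.removeNth (i.succ.removeNth x)) :
                Fin (n + 2) → g)
        else 0) =
        - extMul k g M (x 0) (∑ i : Fin (n + 2), ∑ j : Fin (n + 1), if (i : ℕ) ≤ (j : ℕ) then
          (-1 : k) ^ ((i : ℕ) + ((j : ℕ) + 1)) •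
            m ⊗ₜ[k] ExteriorAlgebra.ιMulti k (n + 1)
              (Fin.cons ⁅Matrix.vecTail x i, Matrix.vecTail x j.succ⁆
                (j.removeNth (i.removeNth (Matrix.vecTail x))) : Fin (n + 1) → g)
        else 0) := by
      rw [map_sum, ← Finset.sum_neg_distrib]
      refine Finset.sum_congr rfl fun i _ => ?_
      rw [Fin.sum_univ_succ, map_sum, ← Finset.sum_neg_distrib, if_neg (by simp), zero_add]
      refine Finset.sum_congr rfl fun j _ => ?_
      by_cases h : (i : ℕ) ≤ (j : ℕ)
      · rw [if_pos h, if_pos (by simpa using h), map_smul, extMul_tmul, ιMulti_cons_succ,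
          TensorProduct.tmul_neg, smul_neg]
        have hs : (-1 : k) ^ ((i.succ : ℕ) + ((j.succ : ℕ) + 1)) =
            (-1) ^ ((i : ℕ) + ((j : ℕ) + 1)) := by
          simp only [Fin.val_succ, pow_add, pow_one]; ring
        rw [hs]
        rfl
      · rw [if_neg h, if_neg (by simpa using h), map_zero, neg_zero]
    rw [e3, totalD_ιMulti n m (Matrix.vecTail x), map_add]
    simp only [Fin.val_zero, pow_zero, one_smul, sub_eq_add_neg, neg_add]
    have e4 : Fin.removeNth 0 x = Matrix.vecTail x := rfl
    rw [e4]
    abel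


/-- The projection of the exterior algebra to its component of degree `n`. -/
noncomputable def extProj (n : ℕ) : E →ₗ[k] ⋀[k]^n g :=
  (DirectSum.component k ℕ (fun i => ⋀[k]^i g) n).comp
    (DirectSum.decomposeLinearEquiv (fun i : ℕ => ⋀[k]^i g)).toLinearMap

theorem extProj_coe (n : ℕ) (ω : ⋀[k]^n g) : extProj k g n (ω : E) = ω := by
  simp [extProj]

theorem extProj_ιMulti (n : ℕ) (x : Fin n → g) :
    extProj k g n (ExteriorAlgebra.ιMulti k n x) = exteriorPower.ιMulti k n x :=
  extProj_coe k g n (exteriorPower.ιMulti k n x)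

/-- The Chevalley-Eilenberg differential `M ⊗ Λ^(n+1) g → M ⊗ Λ^n g`; it is the linear map with
the values computed in `ceD_tmul_one` and `ceD_tmul` below. -/
noncomputable def ceD (n : ℕ) : M ⊗[k] (⋀[k]^(n + 1) g) →ₗ[k] M ⊗[k] (⋀[k]^n g) :=
  (LinearMap.lTensor M (extProj k g n)).comp
    ((totalD k g M).comp (LinearMap.lTensor M (⋀[k]^(n + 1) g).subtype))

/-- `∂(m ⊗ x) = m x` -/
theorem ceD_tmul_one (m : M) (x : Fin 1 → g) :
    ceD k g M 0 (m ⊗ₜ[k] exteriorPower.ιMulti k 1 x) =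
      (op (UniversalEnvelopingAlgebra.ι k (x 0)) • m) ⊗ₜ[k]
        exteriorPower.ιMulti k 0 (fun i => i.elim0) := by
  have h := totalD_ιMulti_one k g M m x
  simp only [ceD, LinearMap.comp_apply, LinearMap.lTensor_tmul, Submodule.subtype_apply,
    exteriorPower.ιMulti_apply_coe, h, ← rAct_apply]
  rw [← extProj_ιMulti, ExteriorAlgebra.ιMulti_zero_apply]

/-- `∂(m ⊗ x₁ ∧ ⋯ ∧ xₙ) = ∑ᵢ (-1)^(i+1) m xᵢ ⊗ x₁ ∧ ⋯ x̂ᵢ ⋯ ∧ xₙ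
+ ∑_{i<j} (-1)^(i+j) m ⊗ [xᵢ, xⱼ] ∧ x₁ ∧ ⋯ x̂ᵢ ⋯ x̂ⱼ ⋯ ∧ xₙ` for `n ≥ 2`. Here the indices start at
`0`, and the pairs `i < j` are written as `(i, j + 1)` with `i ≤ j`. -/
theorem ceD_tmul (n : ℕ) (m : M) (x : Fin (n + 2) → g) :
    ceD k g M (n + 1) (m ⊗ₜ[k] exteriorPower.ιMulti k (n + 2) x) =
      ∑ i : Fin (n + 2), (-1 : k) ^ (i : ℕ) •
          (op (UniversalEnvelopingAlgebra.ι k (x i)) • m) ⊗ₜ[k]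
            exteriorPower.ιMulti k (n + 1) (i.removeNth x) +
      ∑ i : Fin (n + 2), ∑ j : Fin (n + 1), if (i : ℕ) ≤ (j : ℕ) then
          (-1 : k) ^ ((i : ℕ) + ((j : ℕ) + 1)) •
            m ⊗ₜ[k] exteriorPower.ιMulti k (n + 1)
              (Fin.cons ⁅x i, x j.succ⁆ (j.removeNth (i.removeNth x)) : Fin (n + 1) → g)
        else 0 := by
  have h := totalD_ιMulti k g M n m x
  simp only [ceD, LinearMap.comp_apply, LinearMap.lTensor_tmul, Submodule.subtype_apply,
    exteriorPower.ιMulti_apply_coe, h, ← rAct_apply, map_add, map_sum, map_smul, apply_ite,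
    map_zero, extProj_ιMulti]

theorem incl_ceD (n : ℕ) :
    (LinearMap.lTensor M (⋀[k]^n g).subtype).comp (ceD k g M n) =
      (totalD k g M).comp (LinearMap.lTensor M (⋀[k]^(n + 1) g).subtype) := by
  refine tmul_ext k g M fun m x => ?_
  cases n with
  | zero =>
    have h1 := congrArg (LinearMap.lTensor M (⋀[k]^0 g).subtype) (ceD_tmul_one k g M m x)
    have h2 := totalD_ιMulti_one k g M m x
    rw [LinearMap.lTensor_tmul, Submodule.subtype_apply, exteriorPower.ιMulti_apply_coe,
      ExteriorAlgebra.ιMulti_zero_apply] at h1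
    exact h1.trans h2.symm
  | succ n =>
    simp only [LinearMap.comp_apply, ceD_tmul, LinearMap.lTensor_tmul, Submodule.subtype_apply,
      exteriorPower.ιMulti_apply_coe, totalD_ιMulti, map_add, map_sum, map_smul, apply_ite,
      map_zero, rAct_apply]

theorem ceD_comp_ceD (n : ℕ) : (ceD k g M n).comp (ceD k g M (n + 1)) = 0 := by
  refine LinearMap.ext fun t => ?_
  have h := LinearMap.congr_fun (incl_ceD k g M (n + 1)) t
  simp only [LinearMap.comp_apply] at h
  conv_lhs => rw [ceD]
  simp only [LinearMap.comp_apply, h, totalD_totalD, map_zero, LinearMap.zero_apply]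

/-- The Chevalley-Eilenberg complex of `g` with coefficients in the right `U g`-module `M`. -/
noncomputable def ceComplex : ChainComplex (ModuleCat.{u} k) ℕ :=
  ChainComplex.of (fun n => ModuleCat.of k (M ⊗[k] (⋀[k]^n g)))
    (fun n => ModuleCat.ofHom (ceD k g M n))
    (fun n => by rw [← ModuleCat.ofHom_comp, ceD_comp_ceD]; rfl)

theorem ceComplex_d (n : ℕ) :
    (ceComplex k g M).d (n + 1) n = ModuleCat.ofHom (ceD k g M n) :=
  ChainComplex.of_d (fun n => ModuleCat.of k (M ⊗[k] (⋀[k]^n g)))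
    (fun n => ModuleCat.ofHom (ceD k g M n)) n

/-- Chevalley-Eilenberg homology `H^CE_n(g, M)`. -/
noncomputable abbrev ceHomology (n : ℕ) : ModuleCat.{u} k := (ceComplex k g M).homology n

end ChevalleyEilenberg

section Semilinear

variable {k A B M N : Type u} [CommRing k] [Ring A] [Algebra k A] [Ring B] [Algebra k B]
  [AddCommGroup M] [Module k M] [Module A M] [IsScalarTower k A M]
  [AddCommGroup N] [Module k N] [Module B N] [IsScalarTower k B N]

/-- A map of modules that is semilinear over a homomorphism of `k`-algebras is `k`-linear. -/
def kLinear (α : A →ₐ[k] B) (φ : M →ₛₗ[(α : A →+* B)] N) : M →ₗ[k] N where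
  toFun := φ
  map_add' := map_add φ
  map_smul' c m := by
    rw [← algebraMap_smul A c m, map_smulₛₗ]
    simp

theorem kLinear_apply (α : A →ₐ[k] B) (φ : M →ₛₗ[(α : A →+* B)] N) (m : M) :
    kLinear α φ m = φ m := rfl

end Semilinear

section Enveloping

variable (k : Type u) {g h : Type u} [CommRing k] [LieRing g] [LieAlgebra k g]
  [LieRing h] [LieAlgebra k h]

attribute [local instance 100] LieRing.ofAssociativeRing

/-- The algebra homomorphism `U g → U h` induced by a homomorphism of Lie algebras `g → h`. -/
noncomputable def envMap (f : g →ₗ⁅k⁆ h) :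
    UniversalEnvelopingAlgebra k g →ₐ[k] UniversalEnvelopingAlgebra k h :=
  UniversalEnvelopingAlgebra.lift k ((UniversalEnvelopingAlgebra.ι k).comp f)

theorem envMap_ι (f : g →ₗ⁅k⁆ h) (x : g) :
    envMap k f (UniversalEnvelopingAlgebra.ι k x) = UniversalEnvelopingAlgebra.ι k (f x) :=
  UniversalEnvelopingAlgebra.lift_ι_apply k _ x

/-- The homomorphism of opposite algebras induced by `g → h`. -/
noncomputable abbrev envMapOp (f : g →ₗ⁅k⁆ h) :
    (UniversalEnvelopingAlgebra k g)ᵐᵒᵖ →ₐ[k] (UniversalEnvelopingAlgebra k h)ᵐᵒᵖ :=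
  AlgHom.op (envMap k f)

variable (g)

/-- The augmentation `U g → k`, sending the elements of `g` to zero. -/
noncomputable def augmentation : UniversalEnvelopingAlgebra k g →ₐ[k] k :=
  UniversalEnvelopingAlgebra.lift k (0 : g →ₗ⁅k⁆ k)

theorem augmentation_ι (x : g) :
    augmentation k g (UniversalEnvelopingAlgebra.ι k x) = 0 :=
  UniversalEnvelopingAlgebra.lift_ι_apply k _ x

theorem augmentation_envMap (f : g →ₗ⁅k⁆ h) (u : UniversalEnvelopingAlgebra k g) :
    augmentation k h (envMap k f u) = augmentation k g u := by
  have : (augmentation k h).comp (envMap k f) = augmentation k g := by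
    apply UniversalEnvelopingAlgebra.hom_ext
    ext x
    simp [envMap_ι, augmentation_ι, -UniversalEnvelopingAlgebra.ι_apply]
  exact DFunLike.congr_fun this u

end Enveloping

/-- The trivial left `U g`-module `k`: a copy of `k` on which `U g` acts by the augmentation. -/
def TrivialModule (k _g : Type u) : Type u := k

section Trivial

variable (k g : Type u) [CommRing k] [LieRing g] [LieAlgebra k g]

noncomputable instance : AddCommGroup (TrivialModule k g) := inferInstanceAs (AddCommGroup k)
noncomputable instance : Module k (TrivialModule k g) := inferInstanceAs (Module k k)
noncomputable instance : Module (UniversalEnvelopingAlgebra k g) (TrivialModule k g) :=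
  Module.compHom k (augmentation k g : UniversalEnvelopingAlgebra k g →+* k)

/-- The generator `1` of the trivial module. -/
def trivialOne : TrivialModule k g := (1 : k)

theorem trivial_smul_def (u : UniversalEnvelopingAlgebra k g) (c : TrivialModule k g) :
    u • c = (augmentation k g u) • c := rfl

instance : IsScalarTower k (UniversalEnvelopingAlgebra k g) (TrivialModule k g) where
  smul_assoc a u c := by
    rw [trivial_smul_def, trivial_smul_def, map_smul, smul_assoc]

variable {g} {h : Type u} [LieRing h] [LieAlgebra k h]

/-- The identity of `k`, as a map from the trivial `U g`-module to the trivial `U h`-module. -/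
noncomputable def trivialMap (f : g →ₗ⁅k⁆ h) :
    TrivialModule k g →ₛₗ[(envMap k f : UniversalEnvelopingAlgebra k g →+*
      UniversalEnvelopingAlgebra k h)] TrivialModule k h where
  toFun c := (show k from c)
  map_add' _ _ := rfl
  map_smul' u c := by
    have e := augmentation_envMap k g f u
    change augmentation k g u * (show k from c) =
      augmentation k h (envMap k f u) * (show k from c)
    rw [e]

end Trivial

section CEMap

variable (k : Type u) {g h M N : Type u} [CommRing k] [LieRing g] [LieAlgebra k g]
  [LieRing h] [LieAlgebra k h]
  [AddCommGroup M] [Module k M] [Module (UniversalEnvelopingAlgebra k g)ᵐᵒᵖ M]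
  [IsScalarTower k (UniversalEnvelopingAlgebra k g)ᵐᵒᵖ M]
  [AddCommGroup N] [Module k N] [Module (UniversalEnvelopingAlgebra k h)ᵐᵒᵖ N]
  [IsScalarTower k (UniversalEnvelopingAlgebra k h)ᵐᵒᵖ N]

/-- The map `M ⊗ Λ^n g → N ⊗ Λ^n h` induced by `f : g → h` and a map `φ : M → N` over `U g → U h`. -/
noncomputable def ceMapX (f : g →ₗ⁅k⁆ h)
    (φ : M →ₛₗ[(envMapOp k f : (UniversalEnvelopingAlgebra k g)ᵐᵒᵖ →+*
      (UniversalEnvelopingAlgebra k h)ᵐᵒᵖ)] N) (n : ℕ) :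
    M ⊗[k] (⋀[k]^n g) →ₗ[k] N ⊗[k] (⋀[k]^n h) :=
  TensorProduct.map (kLinear (envMapOp k f) φ) (exteriorPower.map n (f : g →ₗ[k] h))

theorem ceMapX_comp_ceD (f : g →ₗ⁅k⁆ h)
    (φ : M →ₛₗ[(envMapOp k f : (UniversalEnvelopingAlgebra k g)ᵐᵒᵖ →+*
      (UniversalEnvelopingAlgebra k h)ᵐᵒᵖ)] N) (n : ℕ) :
    (ceD k h N n).comp (ceMapX k f φ (n + 1)) = (ceMapX k f φ n).comp (ceD k g M n) := by
  have hφ : ∀ (x : g) (m : M), φ (op (UniversalEnvelopingAlgebra.ι k x) • m) =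
      op (UniversalEnvelopingAlgebra.ι k (f x)) • φ m := by
    intro x m
    rw [map_smulₛₗ, ← envMap_ι]
    rfl
  refine tmul_ext k g M fun m x => ?_
  cases n with
  | zero =>
    have h1 := congrArg (ceMapX k f φ 0) (ceD_tmul_one k g M m x)
    have h2 := ceD_tmul_one k h N (φ m) (f ∘ x)
    have h3 : ceMapX k f φ 1 (m ⊗ₜ[k] exteriorPower.ιMulti k 1 x) =
        φ m ⊗ₜ[k] exteriorPower.ιMulti k 1 (f ∘ x) := by
      simp only [ceMapX, TensorProduct.map_tmul, kLinear_apply, exteriorPower.map_apply_ιMulti]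
      rfl
    refine (congrArg (ceD k h N 0) h3).trans (h2.trans (Eq.trans ?_ h1.symm))
    simp only [ceMapX, TensorProduct.map_tmul, kLinear_apply,
      exteriorPower.map_apply_ιMulti, hφ, Function.comp_apply]
    congr 2
    funext i
    exact i.elim0
  | succ n =>
    simp only [LinearMap.comp_apply, ceMapX, ceD_tmul, TensorProduct.map_tmul, kLinear_apply,
      exteriorPower.map_apply_ιMulti, hφ, map_add, map_sum, map_smul, apply_ite,
      map_zero]
    congr 1
    refine Finset.sum_congr rfl fun i _ => Finset.sum_congr rfl fun j _ => ?_
    congr 4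
    ext l
    refine Fin.cases ?_ (fun l => ?_) l
    · simp
    · simp [Fin.removeNth]

/-- The map of Chevalley-Eilenberg complexes induced by `f : g → h` and `φ : M → N`. -/
noncomputable def ceMap (f : g →ₗ⁅k⁆ h)
    (φ : M →ₛₗ[(envMapOp k f : (UniversalEnvelopingAlgebra k g)ᵐᵒᵖ →+*
      (UniversalEnvelopingAlgebra k h)ᵐᵒᵖ)] N) :
    ceComplex k g M ⟶ ceComplex k h N :=
  ChainComplex.ofHom (fun n => ModuleCat.ofHom (ceMapX k f φ n)) (fun n => by
    rw [ceComplex_d, ceComplex_d]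
    exact congrArg ModuleCat.ofHom (ceMapX_comp_ceD k f φ n))

/-- The map `H^CE_n(g, M) → H^CE_n(h, N)` induced by `f : g → h` and `φ : M → N`. -/
noncomputable abbrev ceHomologyMap (f : g →ₗ⁅k⁆ h)
    (φ : M →ₛₗ[(envMapOp k f : (UniversalEnvelopingAlgebra k g)ᵐᵒᵖ →+*
      (UniversalEnvelopingAlgebra k h)ᵐᵒᵖ)] N) (n : ℕ) :
    ceHomology k g M n ⟶ ceHomology k h N n :=
  HomologicalComplex.homologyMap (ceMap k f φ) n

end CEMap

section Relative

/-- An `A`-module `P` is `(A, k)`-projective if it has the lifting property with respect to the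
surjections of `A`-modules that admit a `k`-linear section. -/
def IsRelProjective (k A P : Type u) [CommRing k] [Ring A] [Algebra k A]
    [AddCommGroup P] [Module A P] : Prop :=
  ∀ (X Y : Type u) [AddCommGroup X] [Module k X] [Module A X] [IsScalarTower k A X]
    [AddCommGroup Y] [Module k Y] [Module A Y] [IsScalarTower k A Y]
    (π : X →ₗ[A] Y) (s : Y →ₗ[k] X), (∀ y, π (s y) = y) →
    ∀ f : P →ₗ[A] Y, ∃ f' : P →ₗ[A] X, π.comp f' = f

/-- An augmented complex `⋯ → X₂ → X₁ → X₀ → M` of modules over a `k`-algebra `A`. -/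
structure AugComplex (k A M : Type u) [CommRing k] [Ring A] [Algebra k A]
    [AddCommGroup M] [Module k M] [Module A M] [IsScalarTower k A M] where
  X : ℕ → Type u
  [addCommGroup : ∀ n, AddCommGroup (X n)]
  [moduleBase : ∀ n, Module k (X n)]
  [module : ∀ n, Module A (X n)]
  [isScalarTower : ∀ n, IsScalarTower k A (X n)]
  d : ∀ n, X (n + 1) →ₗ[A] X n
  ε : X 0 →ₗ[A] M
  d_comp_d : ∀ n, (d n).comp (d (n + 1)) = 0
  ε_comp_d : ε.comp (d 0) = 0

attribute [instance] AugComplex.addCommGroup AugComplex.moduleBase AugComplex.module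
  AugComplex.isScalarTower

namespace AugComplex

variable {k A B M N : Type u} [CommRing k] [Ring A] [Algebra k A] [Ring B] [Algebra k B]
  [AddCommGroup M] [Module k M] [Module A M] [IsScalarTower k A M]
  [AddCommGroup N] [Module k N] [Module B N] [IsScalarTower k B N]

/-- All the modules of the complex are `(A, k)`-projective. -/
def IsRelProjective (C : AugComplex k A M) : Prop := ∀ n, CEHom.IsRelProjective k A (C.X n)

/-- The augmented complex is `k`-split: it has a `k`-linear contracting homotopy. -/
def IsSplit (C : AugComplex k A M) : Prop :=
  ∃ (s : M →ₗ[k] C.X 0) (h : ∀ n, C.X n →ₗ[k] C.X (n + 1)),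
    (∀ m, C.ε (s m) = m) ∧
    (∀ x, s (C.ε x) + C.d 0 (h 0 x) = x) ∧
    (∀ n x, h n (C.d n x) + C.d (n + 1) (h (n + 1) x) = x)

/-- The augmented complex is `k`-pure acyclic: it remains exact after tensoring over `k` with
any `k`-module. -/
def IsPure (C : AugComplex k A M) : Prop :=
  ∀ (V : Type u) [AddCommGroup V] [Module k V],
    Function.Surjective ((C.ε.restrictScalars k).rTensor V) ∧
    Function.Exact (((C.d 0).restrictScalars k).rTensor V) ((C.ε.restrictScalars k).rTensor V) ∧
    ∀ n, Function.Exact (((C.d (n + 1)).restrictScalars k).rTensor V)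
      (((C.d n).restrictScalars k).rTensor V)

/-- A chain map over a homomorphism of `k`-algebras `α : A → B` and an `α`-semilinear map
`φ : M → N` of the augmentations. -/
structure Hom (α : A →ₐ[k] B) (φ : M →ₛₗ[(α : A →+* B)] N)
    (C : AugComplex k A M) (D : AugComplex k B N) where
  f : ∀ n, C.X n →ₛₗ[(α : A →+* B)] D.X n
  comm : ∀ n x, f n (C.d n x) = D.d n (f (n + 1) x)
  comm_ε : ∀ x, φ (C.ε x) = D.ε (f 0 x)

end AugComplex

end Relative

section RelTensor

variable (k R M N : Type u) [CommRing k] [Ring R]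
  [AddCommGroup M] [Module k M] [Module Rᵐᵒᵖ M] [AddCommGroup N] [Module k N] [Module R N]

/-- The relations `m r ⊗ n = m ⊗ r n`. -/
def balancedRel : Submodule k (M ⊗[k] N) :=
  Submodule.span k {t | ∃ (m : M) (r : R) (n : N), t = (op r • m) ⊗ₜ[k] n - m ⊗ₜ[k] (r • n)}

/-- The tensor product `M ⊗_R N` of a right module and a left module over a `k`-algebra `R`. -/
abbrev RTensor : Type u := (M ⊗[k] N) ⧸ balancedRel k R M N

variable {k R M N}

theorem rTensor_ext {V : Type u} [AddCommGroup V] [Module k V]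
    {f f' : RTensor k R M N →ₗ[k] V}
    (h : ∀ m n, f (Submodule.Quotient.mk (m ⊗ₜ[k] n)) = f' (Submodule.Quotient.mk (m ⊗ₜ[k] n))) :
    f = f' :=
  Submodule.linearMap_qext _ (TensorProduct.ext' h)

variable {R' M' N' : Type u} [Algebra k R] [Ring R'] [Algebra k R']
  [AddCommGroup M'] [Module k M'] [Module R'ᵐᵒᵖ M'] [AddCommGroup N'] [Module k N'] [Module R' N']

/-- The map `M ⊗_R N → M' ⊗_R' N'` induced by two maps over `α : R → R'`. -/
def rTensorMap (α : R →ₐ[k] R') (φ : M →ₗ[k] M') (ψ : N →ₗ[k] N')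
    (hφ : ∀ (r : R) m, φ (op r • m) = op (α r) • φ m) (hψ : ∀ (r : R) n, ψ (r • n) = α r • ψ n) :
    RTensor k R M N →ₗ[k] RTensor k R' M' N' :=
  Submodule.mapQ _ _ (TensorProduct.map φ ψ) (by
    rw [balancedRel, Submodule.span_le]
    rintro _ ⟨m, r, n, rfl⟩
    refine Submodule.subset_span ⟨φ m, α r, ψ n, ?_⟩
    rw [map_sub, TensorProduct.map_tmul, TensorProduct.map_tmul, hφ, hψ])

theorem rTensorMap_mk_tmul (α : R →ₐ[k] R') (φ : M →ₗ[k] M') (ψ : N →ₗ[k] N')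
    (hφ : ∀ (r : R) m, φ (op r • m) = op (α r) • φ m) (hψ : ∀ (r : R) n, ψ (r • n) = α r • ψ n)
    (m : M) (n : N) :
    rTensorMap α φ ψ hφ hψ (Submodule.Quotient.mk (m ⊗ₜ[k] n)) =
      Submodule.Quotient.mk (φ m ⊗ₜ[k] ψ n) := rfl

variable [IsScalarTower k Rᵐᵒᵖ M]

namespace AugComplex

variable (N) in
/-- The differential of `C ⊗_R N`. -/
def tensorD (C : AugComplex k Rᵐᵒᵖ M) (n : ℕ) :
    RTensor k R (C.X (n + 1)) N →ₗ[k] RTensor k R (C.X n) N :=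
  rTensorMap (AlgHom.id k R) ((C.d n).restrictScalars k) LinearMap.id
    (fun r m => map_smul (C.d n) (op r) m) (fun _ _ => rfl)

variable (N) in
/-- The complex `⋯ → X₁ ⊗_R N → X₀ ⊗_R N` of `k`-modules (without the augmentation term). -/
def tensorComplex (C : AugComplex k Rᵐᵒᵖ M) : ChainComplex (ModuleCat.{u} k) ℕ :=
  ChainComplex.of (fun n => ModuleCat.of k (RTensor k R (C.X n) N))
    (fun n => ModuleCat.ofHom (C.tensorD N n))
    (fun n => by
      have h : (C.tensorD N n).comp (C.tensorD N (n + 1)) = 0 := rTensor_ext fun m x => by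
        have := LinearMap.congr_fun (C.d_comp_d n) m
        simp only [LinearMap.comp_apply] at this
        change Submodule.Quotient.mk (C.d n (C.d (n + 1) m) ⊗ₜ[k] x) = 0
        rw [this, LinearMap.zero_apply, TensorProduct.zero_tmul, Submodule.Quotient.mk_zero]
      rw [← ModuleCat.ofHom_comp, h]; rfl)

theorem tensorComplex_d (C : AugComplex k Rᵐᵒᵖ M) (n : ℕ) :
    (C.tensorComplex N).d (n + 1) n = ModuleCat.ofHom (C.tensorD N n) :=
  ChainComplex.of_d (fun n => ModuleCat.of k (RTensor k R (C.X n) N))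
    (fun n => ModuleCat.ofHom (C.tensorD N n)) n

variable [IsScalarTower k R N] [IsScalarTower k R'ᵐᵒᵖ M'] [IsScalarTower k R' N']

/-- The chain map `C ⊗_R N → D ⊗_R' N'` induced by a chain map `F : C → D` and a map `N → N'`. -/
def tensorMap {α : R →ₐ[k] R'}
    {φ : M →ₛₗ[((AlgHom.op α : Rᵐᵒᵖ →ₐ[k] R'ᵐᵒᵖ) : Rᵐᵒᵖ →+* R'ᵐᵒᵖ)] M'}
    {C : AugComplex k Rᵐᵒᵖ M} {D : AugComplex k R'ᵐᵒᵖ M'} (F : Hom (AlgHom.op α) φ C D)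
    (ψ : N →ₛₗ[(α : R →+* R')] N') : C.tensorComplex N ⟶ D.tensorComplex N' :=
  ChainComplex.ofHom
    (fun n => ModuleCat.ofHom (rTensorMap α (kLinear (AlgHom.op α) (F.f n)) (kLinear α ψ)
      (fun r m => map_smulₛₗ (F.f n) (op r) m) (fun r x => map_smulₛₗ ψ r x)))
    (fun n => by
      rw [tensorComplex_d, tensorComplex_d]
      refine congrArg ModuleCat.ofHom (rTensor_ext fun m x => ?_)
      change Submodule.Quotient.mk (D.d n (F.f (n + 1) m) ⊗ₜ[k] ψ x) =
        Submodule.Quotient.mk (F.f n (C.d n m) ⊗ₜ[k] ψ x)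
      rw [F.comm])

variable (N) in
/-- The relative torsion product `Tor^{(R,k)}_n(M, N) = H_n(C ⊗_R N)`, computed by a `k`-split
`(R, k)`-projective resolution `C → M`. -/
noncomputable abbrev relTor (C : AugComplex k Rᵐᵒᵖ M) (n : ℕ) : ModuleCat.{u} k :=
  (C.tensorComplex N).homology n

/-- The map of relative torsion products induced by a map of resolutions and a map `N → N'`. -/
noncomputable abbrev relTorMap {α : R →ₐ[k] R'}
    {φ : M →ₛₗ[((AlgHom.op α : Rᵐᵒᵖ →ₐ[k] R'ᵐᵒᵖ) : Rᵐᵒᵖ →+* R'ᵐᵒᵖ)] M'}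
    {C : AugComplex k Rᵐᵒᵖ M} {D : AugComplex k R'ᵐᵒᵖ M'} (F : Hom (AlgHom.op α) φ C D)
    (ψ : N →ₛₗ[(α : R →+* R')] N') (n : ℕ) : C.relTor N n ⟶ D.relTor N' n :=
  HomologicalComplex.homologyMap (tensorMap F ψ) n

end AugComplex

end RelTensor

section Existence

variable {k A : Type u} [CommRing k] [Ring A] [Algebra k A]

theorem isRelProjective_tensor (V : Type u) [AddCommGroup V] [Module k V] :
    IsRelProjective k A (A ⊗[k] V) := by
  intro X Y _ _ _ _ _ _ _ _ π s hs f
  refine ⟨TensorProduct.AlgebraTensorModule.lift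
    ((LinearMap.toSpanSingleton A (V →ₗ[k] X)
      (s.comp ((f.restrictScalars k).comp (TensorProduct.mk k A V 1))))), ?_⟩
  ext v
  simp [hs]

/-- A module over `k` and `A`. -/
structure BiMod (k A : Type u) [CommRing k] [Ring A] [Algebra k A] where
  X : Type u
  [addCommGroup : AddCommGroup X]
  [moduleBase : Module k X]
  [module : Module A X]
  [isScalarTower : IsScalarTower k A X]

attribute [instance] BiMod.addCommGroup BiMod.moduleBase BiMod.module BiMod.isScalarTower

/-- The action `A ⊗ V → V`. -/
noncomputable def actMap (V : BiMod k A) : A ⊗[k] V.X →ₗ[A] V.X :=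
  TensorProduct.AlgebraTensorModule.lift
    (LinearMap.toSpanSingleton A (V.X →ₗ[k] V.X) LinearMap.id)

theorem actMap_one_tmul (V : BiMod k A) (v : V.X) : actMap V (1 ⊗ₜ[k] v) = v := by
  simp [actMap]

/-- The kernel of the action `A ⊗ V → V`. -/
noncomputable def kerAct (V : BiMod k A) : BiMod k A := { X := LinearMap.ker (actMap V) }

/-- The inclusion of the kernel of the action. -/
noncomputable def kerIncl (V : BiMod k A) : (kerAct V).X →ₗ[A] A ⊗[k] V.X :=
  (LinearMap.ker (actMap V)).subtype

theorem kerIncl_injective (V : BiMod k A) : Function.Injective (kerIncl V) :=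
  Subtype.val_injective

theorem actMap_kerIncl (V : BiMod k A) (x : (kerAct V).X) : actMap V (kerIncl V x) = 0 :=
  LinearMap.mem_ker.1 x.2

/-- The `k`-linear retraction `x ↦ x - 1 ⊗ act x` of `kerIncl`. -/
noncomputable def kerRetr (V : BiMod k A) : A ⊗[k] V.X →ₗ[k] (kerAct V).X :=
  LinearMap.codRestrict ((LinearMap.ker (actMap V)).restrictScalars k)
    (LinearMap.id - (TensorProduct.mk k A _ 1).comp ((actMap V).restrictScalars k))
    (fun x => by simp [actMap_one_tmul])

theorem kerIncl_kerRetr (V : BiMod k A) (x : A ⊗[k] V.X) :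
    kerIncl V (kerRetr V x) = x - 1 ⊗ₜ[k] actMap V x := rfl

theorem kerRetr_kerIncl (V : BiMod k A) (x : (kerAct V).X) : kerRetr V (kerIncl V x) = x := by
  apply kerIncl_injective
  rw [kerIncl_kerRetr, actMap_kerIncl, TensorProduct.tmul_zero, sub_zero]

/-- The iterated kernels of the actions `A ⊗ V → V`. -/
noncomputable abbrev syzygy (V : BiMod k A) (n : ℕ) : BiMod k A :=
  Nat.rec V (fun _ W => kerAct W) n

/-- The standard `k`-split `(A, k)`-projective resolution of a module. -/
noncomputable def standardResolution (V : BiMod k A) : AugComplex k A V.X where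
  X n := A ⊗[k] (syzygy V n).X
  d n := (kerIncl (syzygy V n)).comp (actMap (kerAct (syzygy V n)))
  ε := actMap V
  d_comp_d n := LinearMap.ext fun x => by
    change kerIncl (syzygy V n) (actMap (kerAct (syzygy V n)) (kerIncl (kerAct (syzygy V n))
      (actMap (kerAct (kerAct (syzygy V n))) x))) = 0
    rw [actMap_kerIncl, map_zero]
  ε_comp_d := LinearMap.ext fun x => actMap_kerIncl V _

/-- Every module has a `k`-split `(A, k)`-projective resolution. -/
theorem exists_split_relProjective_resolution (M : Type u) [AddCommGroup M] [Module k M]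
    [Module A M] [IsScalarTower k A M] :
    ∃ C : AugComplex k A M, C.IsRelProjective ∧ C.IsSplit := by
  let V : BiMod k A := { X := M }
  refine ⟨standardResolution V, fun n => isRelProjective_tensor _, TensorProduct.mk k A M 1,
    fun n => (TensorProduct.mk k A _ 1).comp (kerRetr (syzygy V n)), fun m => actMap_one_tmul V m,
    fun (x : A ⊗[k] V.X) => ?_, fun n (x : A ⊗[k] (kerAct (syzygy V n)).X) => ?_⟩
  · have h : (1 ⊗ₜ[k] actMap V x : A ⊗[k] V.X) +
        kerIncl V (actMap (kerAct V) (1 ⊗ₜ[k] kerRetr V x)) = x := by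
      rw [actMap_one_tmul, kerIncl_kerRetr, add_sub_cancel]
    exact h
  · have h (W : BiMod k A) (x : A ⊗[k] (kerAct W).X) :
        (1 ⊗ₜ[k] kerRetr W (kerIncl W (actMap (kerAct W) x)) : A ⊗[k] (kerAct W).X) +
        kerIncl (kerAct W) (actMap (kerAct (kerAct W)) (1 ⊗ₜ[k] kerRetr (kerAct W) x)) = x := by
      rw [kerRetr_kerIncl, actMap_one_tmul, kerIncl_kerRetr, add_sub_cancel]
    exact h (syzygy V n) x

end Existence

section Resolution

variable (k g : Type u) [CommRing k] [LieRing g] [LieAlgebra k g]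

theorem ceD_smul (n : ℕ) (u : UniversalEnvelopingAlgebra k g)
    (t : UniversalEnvelopingAlgebra k g ⊗[k] (⋀[k]^(n + 1) g)) :
    ceD k g (UniversalEnvelopingAlgebra k g) n (u • t) =
      u • ceD k g (UniversalEnvelopingAlgebra k g) n t := by
  have h : (ceD k g (UniversalEnvelopingAlgebra k g) n).comp
        (Algebra.lsmul k k (UniversalEnvelopingAlgebra k g ⊗[k] (⋀[k]^(n + 1) g)) u) =
      (Algebra.lsmul k k (UniversalEnvelopingAlgebra k g ⊗[k] (⋀[k]^n g)) u).comp
        (ceD k g (UniversalEnvelopingAlgebra k g) n) := by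
    refine tmul_ext k g _ fun m x => ?_
    cases n with
    | zero =>
      have h1 := ceD_tmul_one k g _ (u * m) x
      have h2 := congrArg (fun t => u • t) (ceD_tmul_one k g _ m x)
      refine Eq.trans ?_ (h1.trans (Eq.trans ?_ h2.symm))
      · rfl
      · simp only [TensorProduct.smul_tmul', MulOpposite.smul_eq_mul_unop, MulOpposite.unop_op,
          smul_eq_mul, mul_assoc]
    | succ n =>
      simp only [LinearMap.comp_apply, Algebra.lsmul_coe, TensorProduct.smul_tmul', ceD_tmul,
        smul_add, Finset.smul_sum, smul_ite, smul_zero, smul_comm u, smul_eq_mul,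
        MulOpposite.smul_eq_mul_unop, MulOpposite.unop_op, mul_assoc]
  exact LinearMap.congr_fun h t

/-- The augmentation `U g ⊗ Λ^0 g = U g → k`. -/
noncomputable def ceAugmentation :
    UniversalEnvelopingAlgebra k g ⊗[k] (⋀[k]^0 g) →ₗ[UniversalEnvelopingAlgebra k g]
      TrivialModule k g :=
  (LinearMap.toSpanSingleton (UniversalEnvelopingAlgebra k g) (TrivialModule k g)
      (trivialOne k g)).comp
    ((TensorProduct.AlgebraTensorModule.rid k (UniversalEnvelopingAlgebra k g)
      (UniversalEnvelopingAlgebra k g)).toLinearMap.comp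
    (TensorProduct.AlgebraTensorModule.map LinearMap.id
      (exteriorPower.zeroEquiv k g).toLinearMap))

theorem ceAugmentation_tmul (u : UniversalEnvelopingAlgebra k g) (ω : ⋀[k]^0 g) :
    ceAugmentation k g (u ⊗ₜ[k] ω) = exteriorPower.zeroEquiv k g ω • u • trivialOne k g := by
  simp only [ceAugmentation, LinearMap.comp_apply,
        TensorProduct.AlgebraTensorModule.map_tmul, LinearMap.id_apply, LinearEquiv.coe_coe,
        TensorProduct.AlgebraTensorModule.rid_tmul]
  rw [LinearMap.map_smul_of_tower, LinearMap.toSpanSingleton_apply]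

theorem ceAugmentation_ceD :
    ((ceAugmentation k g).restrictScalars k).comp
      (ceD k g (UniversalEnvelopingAlgebra k g) 0) = 0 := by
  refine tmul_ext k g _ fun m x => ?_
  refine (congrArg ((ceAugmentation k g).restrictScalars k) (ceD_tmul_one k g _ m x)).trans ?_
  rw [LinearMap.restrictScalars_apply, ceAugmentation_tmul, MulOpposite.smul_eq_mul_unop,
    MulOpposite.unop_op, mul_smul, trivial_smul_def k g (UniversalEnvelopingAlgebra.ι k (x 0)),
    augmentation_ι, zero_smul, smul_zero, smul_zero, LinearMap.zero_apply]

/-- The Chevalley-Eilenberg resolution of the trivial module: the complex of left `U g`-modules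
`U g ⊗ Λ^n g`, with the Chevalley-Eilenberg differential for the right `U g`-module `U g`, augmented
by `U g → k`. -/
noncomputable def ceResolution :
    AugComplex k (UniversalEnvelopingAlgebra k g) (TrivialModule k g) where
  X n := UniversalEnvelopingAlgebra k g ⊗[k] (⋀[k]^n g)
  d n :=
    { ceD k g (UniversalEnvelopingAlgebra k g) n with
      map_smul' := ceD_smul k g n }
  ε := ceAugmentation k g
  d_comp_d n := LinearMap.ext fun t =>
    LinearMap.congr_fun (ceD_comp_ceD k g (UniversalEnvelopingAlgebra k g) n) t
  ε_comp_d := LinearMap.ext fun t => LinearMap.congr_fun (ceAugmentation_ceD k g) t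

end Resolution
end CEHom

open CategoryTheory

/-!
The comparison of Chevalley-Eilenberg homology with relative torsion products rests on one fact:
for every `k`-module `V` the Chevalley-Eilenberg complex of the induced module `U g ⊗ V` is a
resolution of `V` (`exists_eq_twistedD`). As this complex is `CE(g, U g) ⊗ V`, the fact says that
`CE(g, U g)` is a pure resolution of `k`. Since a relatively projective module is a direct summand
of an induced one, its Chevalley-Eilenberg complex is exact in positive degrees
(`isCEAcyclic_of_isRelProjective`). For a split relatively projective resolution `P` of `M`,
consider the double complex `P_i ⊗ Λ^j g`. Its rows resolve `M ⊗ Λ^j g` because `P` is split, and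
its columns resolve `P_i ⊗_U k` because the `P_i` are acyclic. Both projections of the total
complex are thus quasi-isomorphisms (`RowAugmentation.exists_D_eq`), and they are natural in all
the data.

The Poincaré-Birkhoff-Witt theorem would reduce the fact about `U g ⊗ V` to the acyclicity of the
Koszul complex `Sym g ⊗ V ⊗ Λ g` by a filtration. It is replaced by a deformation argument. Let
`A` be the homogenized enveloping algebra, generated by `g` and a central variable `t`, with the
relations `x y - y x = t [x, y]`. Then `A / t` is the symmetric algebra and `A / (t - 1)` is the
enveloping algebra, and right modules over these three algebras are twisted modules, for which one
differential `twistedD` covers both the Chevalley-Eilenberg and the Koszul complex. The algebra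
`A` is graded, with `t` and `g` in weight one, which allows inductions on the weight.
Multiplication by `t` is injective on `A ⊗ V` (`trunc_eq_zero_of_mulT_eq_zero`): a `t`-torsion
element `u` lies in the augmentation ideal, whose presentation by generators and relations shows
that `u` is the boundary of an element of exterior degree one; by the acyclicity of the Koszul
complex in degree two, this element is, up to a boundary, itself annihilated by `t`, and has
smaller weight. Given this, a cycle of `A ⊗ V ⊗ Λ g` whose image in the Koszul complex is a
boundary is, up to a boundary, `t` times another cycle, so that the homology of `A ⊗ V ⊗ Λ g` is
`k[t] ⊗ V` (`exists_eq_diff`). As `t - 1` is injective on `A ⊗ V ⊗ Λ g` and on `k[t] ⊗ V`, passing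
to the quotient by `t - 1` gives the resolution of `V` by `U g ⊗ V ⊗ Λ g`.

The hypothesis on `k` and `g` enters through the Koszul complex (`isKoszul`). If `q` is an
endomorphism of a module `G` whose image is cyclic, then `q` and its effect on the symmetric
algebra provide a homotopy from the identity to the map induced by `1 - q` (`koszulD_homotopy`).
This does not require `G` to be projective. If the identity of `G` is a sum of orthogonal
endomorphisms with cyclic images, composing these homotopies makes the Koszul complex acyclic,
which covers finite free modules, and finitely generated modules over a principal ideal domain.
The general case follows, because a cycle involves only finitely many elements of `G` and
relations between them, and because maps from a finitely presented module to a flat one factor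
through a finite free module.
-/

namespace CEHom

/-! ### Koszul differentials -/

section Koszul

variable {k G M : Type u} [CommRing k] [AddCommGroup G] [Module k G] [AddCommGroup M] [Module k M]

variable (k M) in
/-- Left exterior multiplication by `x` on `M ⊗ Λ G`. -/
noncomputable def wedge (x : G) : M ⊗[k] ExteriorAlgebra k G →ₗ[k] M ⊗[k] ExteriorAlgebra k G :=
  LinearMap.lTensor M (LinearMap.mulLeft k (ExteriorAlgebra.ι k x))

theorem wedge_tmul (x : G) (m : M) (ω : ExteriorAlgebra k G) :
    wedge k M x (m ⊗ₜ[k] ω) = m ⊗ₜ[k] (ExteriorAlgebra.ι k x * ω) := rfl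

theorem wedge_add (x y : G) : wedge k M (x + y) = wedge k M x + wedge k M y := by
  refine TensorProduct.ext' fun m ω => ?_
  simp [wedge_tmul, add_mul, TensorProduct.tmul_add]

theorem wedge_smul (c : k) (x : G) : wedge k M (c • x) = c • wedge k M x := by
  refine TensorProduct.ext' fun m ω => ?_
  simp [wedge_tmul]

theorem wedge_zero : wedge k M (0 : G) = 0 := by
  simpa using wedge_smul (M := M) (0 : k) (0 : G)

theorem wedge_sub (x y : G) : wedge k M (x - y) = wedge k M x - wedge k M y := by
  refine TensorProduct.ext' fun m ω => ?_
  simp [wedge_tmul, sub_mul, TensorProduct.tmul_sub]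

theorem wedge_wedge_self (x : G) (t : M ⊗[k] ExteriorAlgebra k G) :
    wedge k M x (wedge k M x t) = 0 := by
  have : (wedge k M x).comp (wedge k M x) = 0 := by
    refine TensorProduct.ext' fun m ω => ?_
    simp only [LinearMap.comp_apply, wedge_tmul, ← mul_assoc, ExteriorAlgebra.ι_sq_zero, zero_mul,
      TensorProduct.tmul_zero, LinearMap.zero_apply]
  exact LinearMap.congr_fun this t

theorem wedge_wedge (x y : G) (t : M ⊗[k] ExteriorAlgebra k G) :
    wedge k M x (wedge k M y t) = - wedge k M y (wedge k M x t) := by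
  have h := wedge_wedge_self (x + y) t
  simp only [wedge_add, LinearMap.add_apply, map_add, wedge_wedge_self, zero_add, add_zero] at h
  rw [add_comm] at h
  exact eq_neg_of_add_eq_zero_left h

/-- Induction on the exterior degree for the elements of `M ⊗ Λ G`. -/
theorem tensorExterior_induction {p : M ⊗[k] ExteriorAlgebra k G → Prop} (zero : p 0)
    (add : ∀ a b, p a → p b → p (a + b)) (one : ∀ m, p (m ⊗ₜ[k] 1))
    (wedge : ∀ (x : G) t, p t → p (wedge k M x t)) (t : M ⊗[k] ExteriorAlgebra k G) : p t := by
  induction t with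
  | zero => exact zero
  | tmul m ω =>
    induction ω using CliffordAlgebra.left_induction generalizing m with
    | algebraMap r =>
      have := one (r • m)
      rwa [TensorProduct.smul_tmul, ← Algebra.algebraMap_eq_smul_one] at this
    | add a b ha hb => rw [TensorProduct.tmul_add]; exact add _ _ (ha m) (hb m)
    | ι_mul ω x h => exact wedge x _ (h m)
  | add a b ha hb => exact add _ _ ha hb

/-- Two linear maps on `M ⊗ Λ G` agree if they agree on `M` and if they agree on `x ∧ t` whenever
they agree on `t`. -/
theorem tensorExterior_hom_ext {N : Type u} [AddCommGroup N] [Module k N]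
    {f f' : M ⊗[k] ExteriorAlgebra k G →ₗ[k] N}
    (one : ∀ m, f (m ⊗ₜ[k] 1) = f' (m ⊗ₜ[k] 1))
    (wedge : ∀ (x : G) t, f t = f' t → f (wedge k M x t) = f' (wedge k M x t)) : f = f' :=
  LinearMap.ext fun t => tensorExterior_induction (p := fun t => f t = f' t) (by simp)
    (fun a b ha hb => by rw [map_add, map_add, ha, hb]) one wedge t

variable {G' M' : Type u} [AddCommGroup G'] [Module k G'] [AddCommGroup M'] [Module k M']

/-- The map `M ⊗ Λ G → M' ⊗ Λ G'` induced by `φ : M → M'` and `f : G → G'`. -/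
noncomputable def tensorExteriorMap (φ : M →ₗ[k] M') (f : G →ₗ[k] G') :
    M ⊗[k] ExteriorAlgebra k G →ₗ[k] M' ⊗[k] ExteriorAlgebra k G' :=
  TensorProduct.map φ (ExteriorAlgebra.map f).toLinearMap

theorem tensorExteriorMap_tmul (φ : M →ₗ[k] M') (f : G →ₗ[k] G') (m : M)
    (ω : ExteriorAlgebra k G) :
    tensorExteriorMap φ f (m ⊗ₜ[k] ω) = φ m ⊗ₜ[k] ExteriorAlgebra.map f ω := rfl

theorem tensorExteriorMap_wedge (φ : M →ₗ[k] M') (f : G →ₗ[k] G') (x : G)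
    (t : M ⊗[k] ExteriorAlgebra k G) :
    tensorExteriorMap φ f (wedge k M x t) = wedge k M' (f x) (tensorExteriorMap φ f t) := by
  have : (tensorExteriorMap φ f).comp (wedge k M x) =
      (wedge k M' (f x)).comp (tensorExteriorMap φ f) := by
    refine TensorProduct.ext' fun m ω => ?_
    simp [wedge_tmul, tensorExteriorMap_tmul]
  exact LinearMap.congr_fun this t

theorem tensorExteriorMap_tensorExteriorMap {G'' M'' : Type u} [AddCommGroup G''] [Module k G'']
    [AddCommGroup M''] [Module k M''] (φ : M →ₗ[k] M') (f : G →ₗ[k] G') (φ' : M' →ₗ[k] M'')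
    (f' : G' →ₗ[k] G'') (t : M ⊗[k] ExteriorAlgebra k G) :
    tensorExteriorMap φ' f' (tensorExteriorMap φ f t) =
      tensorExteriorMap (φ' ∘ₗ φ) (f' ∘ₗ f) t := by
  have : (tensorExteriorMap φ' f').comp (tensorExteriorMap φ f) =
      tensorExteriorMap (φ' ∘ₗ φ) (f' ∘ₗ f) := by
    refine TensorProduct.ext' fun m ω => ?_
    simp only [LinearMap.comp_apply, tensorExteriorMap_tmul]
    rw [← ExteriorAlgebra.map_comp_map]
    rfl
  exact LinearMap.congr_fun this t

theorem tensorExteriorMap_id :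
    tensorExteriorMap (LinearMap.id : M →ₗ[k] M) (LinearMap.id : G →ₗ[k] G) = LinearMap.id := by
  refine TensorProduct.ext' fun m ω => ?_
  simp [tensorExteriorMap_tmul]

/-- `M` is a direct summand of `M ⊗ Λ G`. -/
theorem tmul_one_injective {m m' : M}
    (h : m ⊗ₜ[k] (1 : ExteriorAlgebra k G) = m' ⊗ₜ[k] 1) : m = m' := by
  have := congrArg (fun t => TensorProduct.rid k M
    (LinearMap.lTensor M (ExteriorAlgebra.algebraMapInv (R := k) (M := G)).toLinearMap t)) h
  simpa using this

/-- Recursion step for `koszulD`. -/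
noncomputable def koszulStep (ρ : G →ₗ[k] M →ₗ[k] M) :
    G →ₗ[k] ExteriorAlgebra k G × (M →ₗ[k] M ⊗[k] ExteriorAlgebra k G) →ₗ[k]
      (M →ₗ[k] M ⊗[k] ExteriorAlgebra k G) :=
  LinearMap.mk₂ k
    (fun x p => (TensorProduct.mk k M _).flip p.1 ∘ₗ ρ x - wedge k M x ∘ₗ p.2)
    (by
      intros; ext
      simp only [wedge_add, map_add, LinearMap.sub_apply, LinearMap.comp_apply,
        LinearMap.add_apply]
      abel)
    (by
      intros; ext
      simp only [wedge_smul, map_smul, LinearMap.sub_apply, LinearMap.comp_apply,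
        LinearMap.smul_apply, smul_sub])
    (by
      intros; ext
      simp only [Prod.fst_add, Prod.snd_add, map_add, LinearMap.sub_apply, LinearMap.comp_apply,
        LinearMap.add_apply]
      abel)
    (by
      intros; ext
      simp only [Prod.smul_fst, Prod.smul_snd, map_smul, LinearMap.sub_apply,
        LinearMap.comp_apply, LinearMap.smul_apply, smul_sub])

theorem koszulStep_apply (ρ : G →ₗ[k] M →ₗ[k] M) (x : G)
    (p : ExteriorAlgebra k G × (M →ₗ[k] M ⊗[k] ExteriorAlgebra k G)) (m : M) :
    koszulStep ρ x p m = ρ x m ⊗ₜ[k] p.1 - wedge k M x (p.2 m) := rfl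

theorem koszulStep_step (ρ : G →ₗ[k] M →ₗ[k] M) (x : G) (ω : ExteriorAlgebra k G)
    (η : M →ₗ[k] M ⊗[k] ExteriorAlgebra k G) :
    koszulStep ρ x (ExteriorAlgebra.ι k x * ω, koszulStep ρ x (ω, η)) =
      (0 : QuadraticForm k G) x • η := by
  ext m
  simp only [koszulStep_apply, map_sub, wedge_wedge_self, wedge_tmul, sub_zero, sub_self,
    _root_.zero_apply, zero_smul, LinearMap.zero_apply]

/-- The Koszul differential `m ⊗ x₁ ∧ ⋯ ∧ xₙ ↦ ∑ᵢ (-1)^(i+1) (m xᵢ) ⊗ x₁ ∧ ⋯ x̂ᵢ ⋯ ∧ xₙ` on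
`M ⊗ Λ G`, for a linear family `ρ` of operators on `M`, where `m x = ρ x m`. -/
noncomputable def koszulD (ρ : G →ₗ[k] M →ₗ[k] M) :
    M ⊗[k] ExteriorAlgebra k G →ₗ[k] M ⊗[k] ExteriorAlgebra k G :=
  TensorProduct.lift (LinearMap.flip
    (CliffordAlgebra.foldr' (0 : QuadraticForm k G) (koszulStep ρ) (koszulStep_step ρ) 0))

theorem koszulD_one (ρ : G →ₗ[k] M →ₗ[k] M) (m : M) : koszulD ρ (m ⊗ₜ[k] 1) = 0 := by
  have h := CliffordAlgebra.foldr'_algebraMap (0 : QuadraticForm k G) (koszulStep ρ)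
    (koszulStep_step ρ) 0 1
  rw [map_one, one_smul] at h
  exact congrArg (fun f : M →ₗ[k] M ⊗[k] ExteriorAlgebra k G => f m) h

/-- The recursion that determines `koszulD`, together with its vanishing on `M ⊗ 1`. -/
theorem koszulD_wedge (ρ : G →ₗ[k] M →ₗ[k] M) (x : G) (t : M ⊗[k] ExteriorAlgebra k G) :
    koszulD ρ (wedge k M x t) =
      LinearMap.rTensor _ (ρ x) t - wedge k M x (koszulD ρ t) := by
  induction t with
  | zero => simp
  | tmul m ω =>
    unfold koszulD
    simp only [wedge_tmul, TensorProduct.lift.tmul, LinearMap.flip_apply, LinearMap.rTensor_tmul]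
    erw [CliffordAlgebra.foldr'_ι_mul]
    rfl
  | add a b ha hb => simp only [map_add, ha, hb]; abel

theorem rTensor_wedge (φ : M →ₗ[k] M') (x : G) (t : M ⊗[k] ExteriorAlgebra k G) :
    LinearMap.rTensor _ φ (wedge k M x t) = wedge k M' x (LinearMap.rTensor _ φ t) := by
  induction t with
  | zero => simp
  | tmul m ω => rfl
  | add a b ha hb => simp only [map_add, ha, hb]

theorem rTensor_eq_tensorExteriorMap (φ : M →ₗ[k] M') :
    LinearMap.rTensor (ExteriorAlgebra k G) φ = tensorExteriorMap φ LinearMap.id := by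
  refine TensorProduct.ext' fun m ω => ?_
  simp [tensorExteriorMap_tmul]

/-- The Koszul differential is natural. Two maps `φ, φ'` are allowed on `M`, one for each side of
the differential, since a truncation by weight shifts its bound along the differential. -/
theorem tensorExteriorMap_koszulD {ρ : G →ₗ[k] M →ₗ[k] M} {ρ' : G' →ₗ[k] M' →ₗ[k] M'}
    {φ φ' : M →ₗ[k] M'} {f : G →ₗ[k] G'} (h : ∀ x m, φ' (ρ x m) = ρ' (f x) (φ m))
    (t : M ⊗[k] ExteriorAlgebra k G) :
    tensorExteriorMap φ' f (koszulD ρ t) = koszulD ρ' (tensorExteriorMap φ f t) := by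
  have key (x : G) (s : M ⊗[k] ExteriorAlgebra k G) :
      tensorExteriorMap φ' f (LinearMap.rTensor _ (ρ x) s) =
        LinearMap.rTensor _ (ρ' (f x)) (tensorExteriorMap φ f s) := by
    induction s with
    | zero => simp
    | tmul m ω => simp [tensorExteriorMap_tmul, h]
    | add a b ha hb => simp only [map_add, ha, hb]
  have : (tensorExteriorMap φ' f).comp (koszulD ρ) =
      (koszulD ρ').comp (tensorExteriorMap φ f) := by
    refine tensorExterior_hom_ext (fun m => ?_) (fun x t ht => ?_)
    · simp [koszulD_one, tensorExteriorMap_tmul]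
    · simp only [LinearMap.comp_apply] at ht ⊢
      simp only [koszulD_wedge, tensorExteriorMap_wedge, map_sub, ht]
      rw [key]
  exact LinearMap.congr_fun this t

end Koszul

/-! ### Twisted modules and their Chevalley-Eilenberg differentials -/

section Twisted

variable {k g M : Type u} [CommRing k] [LieRing g] [LieAlgebra k g] [AddCommGroup M] [Module k M]

variable (k g) in
/-- Recursion step for `exteriorD`. -/
noncomputable def exteriorDStep : g →ₗ[k] ExteriorAlgebra k g × ExteriorAlgebra k g →ₗ[k]
    ExteriorAlgebra k g :=
  LinearMap.mk₂ k (fun x p => - lieDer k g p.1 x - ExteriorAlgebra.ι k x * p.2)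
    (by intros; simp only [map_add, add_mul]; abel)
    (by intros; simp [smul_sub])
    (by intros; simp only [Prod.fst_add, Prod.snd_add, map_add, mul_add, LinearMap.add_apply]; abel)
    (by intros; simp [smul_sub])

theorem exteriorDStep_apply (x : g) (p : ExteriorAlgebra k g × ExteriorAlgebra k g) :
    exteriorDStep k g x p = - lieDer k g p.1 x - ExteriorAlgebra.ι k x * p.2 := rfl

theorem exteriorDStep_step (x : g) (ω η : ExteriorAlgebra k g) :
    exteriorDStep k g x (ExteriorAlgebra.ι k x * ω, exteriorDStep k g x (ω, η)) =
      (0 : QuadraticForm k g) x • η := by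
  simp only [exteriorDStep_apply, lieDer_ι_mul, mul_sub, mul_neg, ι_sq, lie_self, map_zero,
    zero_mul, zero_add, sub_zero, sub_neg_eq_add, neg_add_cancel, _root_.zero_apply, zero_smul]

variable (k g) in
/-- The Chevalley-Eilenberg differential on `Λ g` for trivial coefficients. -/
noncomputable def exteriorD : ExteriorAlgebra k g →ₗ[k] ExteriorAlgebra k g :=
  CliffordAlgebra.foldr' (0 : QuadraticForm k g) (exteriorDStep k g) exteriorDStep_step 0

theorem exteriorD_one : exteriorD k g 1 = 0 := by
  have h := CliffordAlgebra.foldr'_algebraMap (0 : QuadraticForm k g) (exteriorDStep k g)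
    exteriorDStep_step 0 1
  rwa [map_one, one_smul] at h

theorem exteriorD_ι_mul (x : g) (ω : ExteriorAlgebra k g) :
    exteriorD k g (ExteriorAlgebra.ι k x * ω) =
      - lieDer k g ω x - ExteriorAlgebra.ι k x * exteriorD k g ω := by
  unfold exteriorD
  erw [CliffordAlgebra.foldr'_ι_mul]
  rfl

/-- `M` is a `τ`-twisted right module over `g`: the operators `ρ x` commute with `τ`, and
`m x y - m y x = τ (m [x, y])`, where `m x = ρ x m`. For `τ = id` this is a right `U g`-module, and
for `τ = 0` a right module over the symmetric algebra of `g`. -/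
structure IsTwistedModule (ρ : g →ₗ[k] M →ₗ[k] M) (τ : M →ₗ[k] M) : Prop where
  comm : ∀ x m, ρ x (τ m) = τ (ρ x m)
  lie : ∀ x y m, ρ x (ρ y m) = ρ y (ρ x m) - τ (ρ ⁅x, y⁆ m)

/-- The Chevalley-Eilenberg differential of a twisted module: the bracket of `g` is multiplied
by `τ`. -/
noncomputable def twistedD (ρ : g →ₗ[k] M →ₗ[k] M) (τ : M →ₗ[k] M) :
    M ⊗[k] ExteriorAlgebra k g →ₗ[k] M ⊗[k] ExteriorAlgebra k g :=
  koszulD ρ + TensorProduct.map τ (exteriorD k g)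

/-- The right action of `x` on `M ⊗ Λ g`, for a twisted module `M`. -/
noncomputable def twistedAct (ρ : g →ₗ[k] M →ₗ[k] M) (τ : M →ₗ[k] M) (x : g) :
    M ⊗[k] ExteriorAlgebra k g →ₗ[k] M ⊗[k] ExteriorAlgebra k g :=
  LinearMap.rTensor _ (ρ x) - TensorProduct.map τ ((lieDer k g).flip x)

theorem twistedAct_tmul (ρ : g →ₗ[k] M →ₗ[k] M) (τ : M →ₗ[k] M) (x : g) (m : M)
    (ω : ExteriorAlgebra k g) :
    twistedAct ρ τ x (m ⊗ₜ[k] ω) = ρ x m ⊗ₜ[k] ω - τ m ⊗ₜ[k] lieDer k g ω x := rfl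

theorem twistedD_zero (ρ : g →ₗ[k] M →ₗ[k] M) : twistedD ρ 0 = koszulD ρ := by
  simp [twistedD]

theorem twistedD_one (ρ : g →ₗ[k] M →ₗ[k] M) (τ : M →ₗ[k] M) (m : M) :
    twistedD ρ τ (m ⊗ₜ[k] 1) = 0 := by
  simp [twistedD, koszulD_one, exteriorD_one]

/-- Cartan's formula: left exterior multiplication by `x` is a homotopy from zero to the action
of `x`. -/
theorem twistedD_wedge (ρ : g →ₗ[k] M →ₗ[k] M) (τ : M →ₗ[k] M) (x : g)
    (t : M ⊗[k] ExteriorAlgebra k g) :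
    twistedD ρ τ (wedge k M x t) = twistedAct ρ τ x t - wedge k M x (twistedD ρ τ t) := by
  have : TensorProduct.map τ (exteriorD k g) (wedge k M x t) =
      - TensorProduct.map τ ((lieDer k g).flip x) t -
        wedge k M x (TensorProduct.map τ (exteriorD k g) t) := by
    induction t with
    | zero => simp
    | tmul m ω =>
      simp only [wedge_tmul, TensorProduct.map_tmul, exteriorD_ι_mul, TensorProduct.tmul_sub,
        TensorProduct.tmul_neg, LinearMap.flip_apply]
    | add a b ha hb => simp only [map_add, ha, hb]; abel
  simp only [twistedD, twistedAct, LinearMap.add_apply, LinearMap.sub_apply, koszulD_wedge, this,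
    map_add]
  abel

variable {ρ : g →ₗ[k] M →ₗ[k] M} {τ : M →ₗ[k] M}

theorem twistedAct_wedge (x y : g) (t : M ⊗[k] ExteriorAlgebra k g) :
    twistedAct ρ τ x (wedge k M y t) =
      wedge k M y (twistedAct ρ τ x t) - wedge k M ⁅x, y⁆ (LinearMap.rTensor _ τ t) := by
  induction t with
  | zero => simp
  | tmul m ω =>
    simp only [wedge_tmul, twistedAct_tmul, lieDer_ι_mul, map_sub, TensorProduct.tmul_add,
      LinearMap.rTensor_tmul]
    abel
  | add a b ha hb => simp only [map_add, ha, hb]; abel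

theorem IsTwistedModule.twistedAct_rTensor (h : IsTwistedModule ρ τ) (x : g)
    (t : M ⊗[k] ExteriorAlgebra k g) :
    twistedAct ρ τ x (LinearMap.rTensor _ τ t) = LinearMap.rTensor _ τ (twistedAct ρ τ x t) := by
  induction t with
  | zero => simp
  | tmul m ω => simp only [twistedAct_tmul, LinearMap.rTensor_tmul, map_sub, h.comm]
  | add a b ha hb => simp only [map_add, ha, hb]

/-- Maps `φ, φ'` between twisted modules that intertwine the operators `ρ x` and `τ` intertwine the
differentials. As in `tensorExteriorMap_koszulD`, two different maps are allowed. -/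
theorem rTensor_twistedD {M' : Type u} [AddCommGroup M'] [Module k M'] {ρ' : g →ₗ[k] M' →ₗ[k] M'}
    {τ' : M' →ₗ[k] M'} {φ φ' : M →ₗ[k] M'} (hρ : ∀ x m, φ' (ρ x m) = ρ' x (φ m))
    (hτ : ∀ m, φ' (τ m) = τ' (φ m)) (t : M ⊗[k] ExteriorAlgebra k g) :
    LinearMap.rTensor _ φ' (twistedD ρ τ t) = twistedD ρ' τ' (LinearMap.rTensor _ φ t) := by
  have h1 : LinearMap.rTensor _ φ' (TensorProduct.map τ (exteriorD k g) t) =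
      TensorProduct.map τ' (exteriorD k g) (LinearMap.rTensor _ φ t) := by
    induction t with
    | zero => simp
    | tmul m ω => simp only [TensorProduct.map_tmul, LinearMap.rTensor_tmul, hτ]
    | add a b ha hb => simp only [map_add, ha, hb]
  simp only [twistedD, LinearMap.add_apply, map_add, h1]
  rw [rTensor_eq_tensorExteriorMap, rTensor_eq_tensorExteriorMap]
  rw [tensorExteriorMap_koszulD (fun x m => hρ x m)]

theorem IsTwistedModule.twistedD_rTensor (h : IsTwistedModule ρ τ)
    (t : M ⊗[k] ExteriorAlgebra k g) :
    twistedD ρ τ (LinearMap.rTensor _ τ t) = LinearMap.rTensor _ τ (twistedD ρ τ t) :=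
  (rTensor_twistedD (fun x m => (h.comm x m).symm) (fun _ => rfl) t).symm

theorem IsTwistedModule.twistedAct_twistedAct (h : IsTwistedModule ρ τ) (x y : g)
    (t : M ⊗[k] ExteriorAlgebra k g) :
    twistedAct ρ τ x (twistedAct ρ τ y t) = twistedAct ρ τ y (twistedAct ρ τ x t) -
      LinearMap.rTensor _ τ (twistedAct ρ τ ⁅x, y⁆ t) := by
  induction t using tensorExterior_induction with
  | zero => simp
  | add a b ha hb => simp only [map_add, ha, hb]; abel
  | one m =>
    simp only [twistedAct_tmul, lieDer_one, TensorProduct.tmul_zero, sub_zero, h.lie x y,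
      TensorProduct.sub_tmul, LinearMap.rTensor_tmul]
  | wedge z t ih =>
    simp only [twistedAct_wedge, map_sub, ih, h.twistedAct_rTensor, rTensor_wedge]
    rw [leibniz_lie x y z, wedge_add, LinearMap.add_apply]
    abel

theorem IsTwistedModule.twistedD_twistedAct (h : IsTwistedModule ρ τ) (x : g)
    (t : M ⊗[k] ExteriorAlgebra k g) :
    twistedD ρ τ (twistedAct ρ τ x t) = twistedAct ρ τ x (twistedD ρ τ t) := by
  induction t using tensorExterior_induction with
  | zero => simp
  | add a b ha hb => simp only [map_add, ha, hb]
  | one m =>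
    simp only [twistedAct_tmul, lieDer_one, TensorProduct.tmul_zero, sub_zero, twistedD_one,
      map_zero]
  | wedge z t ih =>
    simp only [twistedAct_wedge, twistedD_wedge, map_sub, ih, h.twistedAct_twistedAct x z,
      h.twistedAct_rTensor, h.twistedD_rTensor]
    abel

theorem IsTwistedModule.twistedD_twistedD (h : IsTwistedModule ρ τ)
    (t : M ⊗[k] ExteriorAlgebra k g) : twistedD ρ τ (twistedD ρ τ t) = 0 := by
  induction t using tensorExterior_induction with
  | zero => simp
  | add a b ha hb => simp only [map_add, ha, hb, add_zero]
  | one m => simp only [twistedD_one, map_zero]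
  | wedge z t ih =>
    simp only [twistedD_wedge, map_sub, h.twistedD_twistedAct, ih, map_zero, sub_zero, sub_self]

/-- For a right `U g`-module, the differential with `τ = id` is the Chevalley-Eilenberg
differential. -/
theorem twistedD_rAct [Module (UniversalEnvelopingAlgebra k g)ᵐᵒᵖ M]
    [IsScalarTower k (UniversalEnvelopingAlgebra k g)ᵐᵒᵖ M] :
    twistedD (rAct k g M) LinearMap.id = totalD k g M := by
  refine tensorExterior_hom_ext (fun m => ?_) (fun x t ht => ?_)
  · rw [twistedD_one, totalD_one]
  · rw [twistedD_wedge, ht]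
    exact (totalD_extMul k g M x t).symm

end Twisted

/-! ### The Koszul complex of a symmetric algebra -/

section Symmetric

variable {k G : Type u} [CommRing k] [AddCommGroup G] [Module k G]

/-- Operators on a tensor product `A ⊗ V` obtained from operators on `A`. -/
noncomputable def tensorAct {A : Type u} [AddCommGroup A] [Module k A] (ρ : G →ₗ[k] A →ₗ[k] A)
    (V : Type u) [AddCommGroup V] [Module k V] : G →ₗ[k] A ⊗[k] V →ₗ[k] A ⊗[k] V :=
  LinearMap.rTensorHom V ∘ₗ ρ

theorem tensorAct_apply {A : Type u} [AddCommGroup A] [Module k A] (ρ : G →ₗ[k] A →ₗ[k] A)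
    (V : Type u) [AddCommGroup V] [Module k V] (x : G) :
    tensorAct ρ V x = LinearMap.rTensor V (ρ x) := rfl

variable (k G) in
/-- The action of `G` on its symmetric algebra by multiplication. -/
noncomputable def symmetricAct : G →ₗ[k] SymmetricAlgebra k G →ₗ[k] SymmetricAlgebra k G :=
  (LinearMap.mul k _).flip ∘ₗ SymmetricAlgebra.ι k G

theorem symmetricAct_apply (x : G) (f : SymmetricAlgebra k G) :
    symmetricAct k G x f = f * SymmetricAlgebra.ι k G x := rfl

theorem symmetricAct_sub (x y : G) (f : SymmetricAlgebra k G) :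
    symmetricAct k G (x - y) f = f * SymmetricAlgebra.ι k G x - f * SymmetricAlgebra.ι k G y := by
  rw [symmetricAct_apply, map_sub, mul_sub]

/-- Linear maps on `Sym G` agree if they agree on `1` and their agreement is preserved by
multiplication by the elements of `G`. -/
theorem symmetricAlgebra_hom_ext {X : Type u} [AddCommGroup X] [Module k X]
    {f f' : SymmetricAlgebra k G →ₗ[k] X} (one : f 1 = f' 1)
    (mul : ∀ a x, f a = f' a →
      f (a * SymmetricAlgebra.ι k G x) = f' (a * SymmetricAlgebra.ι k G x)) : f = f' := by
  have key (a : SymmetricAlgebra k G) : ∀ b, f b = f' b → f (b * a) = f' (b * a) := by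
    induction a using SymmetricAlgebra.induction with
    | algebraMap r =>
      intro b hb
      rw [← Algebra.commutes, ← Algebra.smul_def, map_smul, map_smul, hb]
    | ι x => exact fun b hb => mul b x hb
    | mul a a' ha ha' => exact fun b hb => by rw [← mul_assoc]; exact ha' _ (ha _ hb)
    | add a a' ha ha' => exact fun b hb => by rw [mul_add, map_add, map_add, ha _ hb, ha' _ hb]
  ext a
  simpa using key a 1 one

open scoped IsMulCommutative in
/-- The symmetric algebra is the free module on one generator over commuting operators indexed
by `G`. -/
theorem exists_map_of_commuting {X : Type u} [AddCommGroup X] [Module k X]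
    (ρ : G →ₗ[k] Module.End k X) (h : ∀ x y v, ρ x (ρ y v) = ρ y (ρ x v)) (v : X) :
    ∃ Φ : SymmetricAlgebra k G →ₗ[k] X, Φ 1 = v ∧
      ∀ f x, Φ (f * SymmetricAlgebra.ι k G x) = ρ x (Φ f) := by
  let B := Algebra.adjoin k (Set.range ρ)
  have : IsMulCommutative B := Algebra.isMulCommutative_adjoin k (by
    rintro _ ⟨x, rfl⟩ _ ⟨y, rfl⟩
    exact LinearMap.ext (h x y))
  let ρ' : G →ₗ[k] B := LinearMap.codRestrict (Subalgebra.toSubmodule B) ρ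
    (fun x => Algebra.subset_adjoin ⟨x, rfl⟩)
  let Ψ : SymmetricAlgebra k G →ₐ[k] B := SymmetricAlgebra.lift ρ'
  refine ⟨(LinearMap.applyₗ v) ∘ₗ (B.val.comp Ψ).toLinearMap, by simp, fun f x => ?_⟩
  rw [mul_comm]
  have h1 : Ψ (SymmetricAlgebra.ι k G x) = ρ' x := SymmetricAlgebra.lift_ι_apply _ _
  simp only [LinearMap.comp_apply, AlgHom.toLinearMap_apply, map_mul, AlgHom.comp_apply, h1]
  rfl

variable {G' G'' : Type u} [AddCommGroup G'] [Module k G'] [AddCommGroup G''] [Module k G'']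

/-- The functoriality of the symmetric algebra. -/
noncomputable def symmetricMap (f : G →ₗ[k] G') :
    SymmetricAlgebra k G →ₐ[k] SymmetricAlgebra k G' :=
  SymmetricAlgebra.lift (SymmetricAlgebra.ι k G' ∘ₗ f)

theorem symmetricMap_ι (f : G →ₗ[k] G') (x : G) :
    symmetricMap f (SymmetricAlgebra.ι k G x) = SymmetricAlgebra.ι k G' (f x) :=
  SymmetricAlgebra.lift_ι_apply _ _

theorem symmetricMap_comp (f : G →ₗ[k] G') (f' : G' →ₗ[k] G'') :
    (symmetricMap f').comp (symmetricMap f) = symmetricMap (f' ∘ₗ f) := by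
  ext x
  simp [symmetricMap_ι]

theorem symmetricMap_id : symmetricMap (LinearMap.id : G →ₗ[k] G) = AlgHom.id k _ := by
  ext x
  simp [symmetricMap_ι]

variable (V : Type u) [AddCommGroup V] [Module k V]

/-- The functoriality of the Koszul complex `Sym G ⊗ V ⊗ Λ G`. -/
noncomputable def koszulMap (f : G →ₗ[k] G') :
    (SymmetricAlgebra k G ⊗[k] V) ⊗[k] ExteriorAlgebra k G →ₗ[k]
      (SymmetricAlgebra k G' ⊗[k] V) ⊗[k] ExteriorAlgebra k G' :=
  tensorExteriorMap (LinearMap.rTensor V (symmetricMap f).toLinearMap) f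

theorem koszulMap_koszulMap (f : G →ₗ[k] G') (f' : G' →ₗ[k] G'')
    (t : (SymmetricAlgebra k G ⊗[k] V) ⊗[k] ExteriorAlgebra k G) :
    koszulMap V f' (koszulMap V f t) = koszulMap V (f' ∘ₗ f) t := by
  rw [koszulMap, koszulMap, tensorExteriorMap_tensorExteriorMap, ← LinearMap.rTensor_comp,
    ← AlgHom.comp_toLinearMap, symmetricMap_comp]
  rfl

theorem koszulMap_id (t : (SymmetricAlgebra k G ⊗[k] V) ⊗[k] ExteriorAlgebra k G) :
    koszulMap V LinearMap.id t = t := by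
  have h : (AlgHom.id k (SymmetricAlgebra k G)).toLinearMap = LinearMap.id := rfl
  rw [koszulMap, symmetricMap_id, h, LinearMap.rTensor_id, tensorExteriorMap_id,
    LinearMap.id_apply]

theorem koszulMap_koszulD (f : G →ₗ[k] G')
    (t : (SymmetricAlgebra k G ⊗[k] V) ⊗[k] ExteriorAlgebra k G) :
    koszulMap V f (koszulD (tensorAct (symmetricAct k G) V) t) =
      koszulD (tensorAct (symmetricAct k G') V) (koszulMap V f t) := by
  refine tensorExteriorMap_koszulD (fun x m => ?_) t
  induction m with
  | zero => simp
  | tmul s v =>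
    simp [tensorAct_apply, symmetricAct_apply, symmetricMap_ι]
  | add a b ha hb => simp only [map_add, ha, hb]

end Symmetric

section Contraction

variable {k G M : Type u} [CommRing k] [AddCommGroup G] [Module k G] [AddCommGroup M] [Module k M]

/-- The map `(m ⊗ z) ⊗ ω ↦ m ⊗ z ∧ ω`. -/
noncomputable def wedgeIn :
    (M ⊗[k] G) ⊗[k] ExteriorAlgebra k G →ₗ[k] M ⊗[k] ExteriorAlgebra k G :=
  LinearMap.lTensor M (TensorProduct.lift (LinearMap.mul k _ ∘ₗ ExteriorAlgebra.ι k)) ∘ₗ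
    (TensorProduct.assoc k M G _).toLinearMap

theorem wedgeIn_tmul (m : M) (z : G) (ω : ExteriorAlgebra k G) :
    wedgeIn ((m ⊗ₜ[k] z) ⊗ₜ[k] ω) = wedge k M z (m ⊗ₜ[k] ω) := rfl

theorem wedgeIn_wedge (x : G) (t : (M ⊗[k] G) ⊗[k] ExteriorAlgebra k G) :
    wedgeIn (wedge k _ x t) = - wedge k M x (wedgeIn t) := by
  have : wedgeIn ∘ₗ wedge k (M ⊗[k] G) x = - (wedge k M x ∘ₗ wedgeIn) := by
    refine TensorProduct.ext_threefold fun m z ω => ?_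
    exact wedge_wedge z x (m ⊗ₜ[k] ω)
  exact LinearMap.congr_fun this t

theorem wedgeIn_rTensor (φ : M →ₗ[k] M) (t : (M ⊗[k] G) ⊗[k] ExteriorAlgebra k G) :
    wedgeIn (LinearMap.rTensor _ (LinearMap.rTensor G φ) t) =
      LinearMap.rTensor _ φ (wedgeIn t) := by
  have : wedgeIn ∘ₗ LinearMap.rTensor (ExteriorAlgebra k G) (LinearMap.rTensor G φ) =
      LinearMap.rTensor _ φ ∘ₗ wedgeIn := TensorProduct.ext_threefold fun m z ω => rfl
  exact LinearMap.congr_fun this t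

theorem koszulD_wedgeIn_one (ρ : G →ₗ[k] M →ₗ[k] M) (s : M ⊗[k] G) :
    koszulD ρ (wedgeIn (s ⊗ₜ[k] 1)) = TensorProduct.lift ρ.flip s ⊗ₜ[k] 1 := by
  induction s with
  | zero => simp
  | tmul m z => simp [wedgeIn_tmul, koszulD_wedge, koszulD_one]
  | add a b ha hb => simp only [map_add, TensorProduct.add_tmul, ha, hb]

/-- Data for contracting the Koszul complex of a module over commuting operators `ρ x` along an
endomorphism `q` of `G` of rank one. The map `P` is the effect on `M` of `1 - q`. If the image
of `q` is generated by `x₀`, then `m - P m` is a multiple `m' x₀`, and `η m` stands for `m' ⊗ x₀`: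
this element depends linearly on `m`, whereas `m'` need not be well defined, for instance if `x₀`
is a torsion element. -/
structure IsContraction (ρ : G →ₗ[k] M →ₗ[k] M) (q : G →ₗ[k] G) (P : M →ₗ[k] M)
    (η : M →ₗ[k] M ⊗[k] G) : Prop where
  comm : ∀ x y m, ρ x (ρ y m) = ρ y (ρ x m)
  map_ρ : ∀ x m, P (ρ x m) = ρ (x - q x) (P m)
  η_ρ : ∀ x m, η (ρ x m) = LinearMap.rTensor G (ρ (x - q x)) (η m) + m ⊗ₜ[k] q x
  lift_η : ∀ m, TensorProduct.lift ρ.flip (η m) = m - P m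
  swap : ∀ x m, LinearMap.rTensor G (ρ (q x)) (η m) = (m - P m) ⊗ₜ[k] q x
  wedge_image : ∀ x y (t : M ⊗[k] ExteriorAlgebra k G), wedge k M (q x) (wedge k M (q y) t) = 0

namespace IsContraction

variable {ρ : G →ₗ[k] M →ₗ[k] M} {q : G →ₗ[k] G} {P : M →ₗ[k] M} {η : M →ₗ[k] M ⊗[k] G}

/-- The contracting homotopy `m ⊗ ω ↦ η m ∧ ω`. -/
noncomputable def homotopy (_ : IsContraction ρ q P η) :
    M ⊗[k] ExteriorAlgebra k G →ₗ[k] M ⊗[k] ExteriorAlgebra k G :=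
  wedgeIn ∘ₗ LinearMap.rTensor _ η

variable (h : IsContraction ρ q P η)

theorem homotopy_wedge (x : G) (t : M ⊗[k] ExteriorAlgebra k G) :
    h.homotopy (wedge k M x t) = - wedge k M x (h.homotopy t) := by
  rw [homotopy, LinearMap.comp_apply, rTensor_wedge, wedgeIn_wedge]
  rfl

theorem homotopy_rTensor (x : G) (t : M ⊗[k] ExteriorAlgebra k G) :
    h.homotopy (LinearMap.rTensor _ (ρ x) t) =
      LinearMap.rTensor _ (ρ (x - q x)) (h.homotopy t) + wedge k M (q x) t := by
  induction t with
  | zero => simp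
  | tmul m ω =>
    simp only [homotopy, LinearMap.comp_apply, LinearMap.rTensor_tmul, h.η_ρ,
      TensorProduct.add_tmul, map_add, wedgeIn_tmul, ← wedgeIn_rTensor]
  | add a b ha hb => simp only [map_add, ha, hb]; abel

theorem rTensor_homotopy (x : G) (t : M ⊗[k] ExteriorAlgebra k G) :
    LinearMap.rTensor _ (ρ (q x)) (h.homotopy t) =
      wedge k M (q x) (t - tensorExteriorMap P (LinearMap.id - q) t) := by
  induction t using tensorExterior_induction with
  | zero => simp
  | add a b ha hb => simp only [map_add, ha, hb, map_sub]; abel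
  | one m =>
    rw [homotopy, LinearMap.comp_apply, LinearMap.rTensor_tmul, ← wedgeIn_rTensor,
      LinearMap.rTensor_tmul, h.swap, wedgeIn_tmul, tensorExteriorMap_tmul, map_one,
      TensorProduct.sub_tmul]
  | wedge y t ih =>
    rw [h.homotopy_wedge, map_neg, rTensor_wedge, ih, tensorExteriorMap_wedge]
    simp only [LinearMap.sub_apply, LinearMap.id_apply, wedge_sub, map_sub,
      wedge_wedge (q x) y, h.wedge_image]
    abel

/-- The map induced by `1 - q` is chain homotopic to the identity. -/
theorem koszulD_homotopy (t : M ⊗[k] ExteriorAlgebra k G) :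
    koszulD ρ (h.homotopy t) + h.homotopy (koszulD ρ t) =
      t - tensorExteriorMap P (LinearMap.id - q) t := by
  induction t using tensorExterior_induction with
  | zero => simp
  | add a b ha hb =>
    simp only [map_add]
    rw [add_add_add_comm, ha, hb]
    abel
  | one m =>
    rw [koszulD_one, map_zero, add_zero, homotopy, LinearMap.comp_apply, LinearMap.rTensor_tmul,
      koszulD_wedgeIn_one, h.lift_η, tensorExteriorMap_tmul, map_one, TensorProduct.sub_tmul]
  | wedge z t ih =>
    have hc : koszulD ρ (LinearMap.rTensor _ (ρ z) t) =
        LinearMap.rTensor _ (ρ z) (koszulD ρ t) := by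
      rw [rTensor_eq_tensorExteriorMap, tensorExteriorMap_koszulD]
      exact fun x m => h.comm z x m
    have h1 := h.rTensor_homotopy z t
    have h2 : LinearMap.rTensor (ExteriorAlgebra k G) (ρ (z - q z)) (h.homotopy t) =
        LinearMap.rTensor _ (ρ z) (h.homotopy t) -
          LinearMap.rTensor _ (ρ (q z)) (h.homotopy t) := by
      rw [map_sub, LinearMap.rTensor_sub, LinearMap.sub_apply]
    rw [h.homotopy_wedge, koszulD_wedge, map_neg, koszulD_wedge, map_sub, h.homotopy_rTensor,
      h.homotopy_wedge, tensorExteriorMap_wedge, LinearMap.sub_apply, LinearMap.id_apply, wedge_sub,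
      LinearMap.sub_apply, h2,
      h1, map_sub]
    have h4 := congrArg (wedge k M z) ih
    rw [map_add, map_sub] at h4
    rw [← sub_eq_zero] at h4 ⊢
    rw [← h4]
    abel

end IsContraction

end Contraction

/-! ### Acyclicity of the Koszul complex of a finite sum of cyclic modules -/

section Cyclic

variable {k G : Type u} [CommRing k] [AddCommGroup G] [Module k G]

/-- The image of `q` is contained in a cyclic submodule. -/
def IsRankOne (q : G →ₗ[k] G) : Prop := ∃ x₀, ∀ z, ∃ a : k, q z = a • x₀

theorem IsRankOne.swap {q : G →ₗ[k] G} (hq : IsRankOne q) (f : SymmetricAlgebra k G) (y z : G) :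
    (f * SymmetricAlgebra.ι k G (q y)) ⊗ₜ[k] q z =
      (f * SymmetricAlgebra.ι k G (q z)) ⊗ₜ[k] q y := by
  obtain ⟨x₀, hx⟩ := hq
  obtain ⟨a, ha⟩ := hx y
  obtain ⟨b, hb⟩ := hx z
  rw [ha, hb]
  simp only [map_smul, mul_smul_comm, TensorProduct.tmul_smul, TensorProduct.smul_tmul',
    smul_smul, mul_comm]

theorem IsRankOne.wedge_wedge {q : G →ₗ[k] G} (hq : IsRankOne q) {M : Type u} [AddCommGroup M]
    [Module k M] (x y : G) (t : M ⊗[k] ExteriorAlgebra k G) :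
    wedge k M (q x) (wedge k M (q y) t) = 0 := by
  obtain ⟨x₀, hx⟩ := hq
  obtain ⟨a, ha⟩ := hx x
  obtain ⟨b, hb⟩ := hx y
  rw [ha, hb, wedge_smul, wedge_smul]
  simp [wedge_wedge_self]

/-- If the image of `q` is generated by `x₀`, then `f - (1 - q) f` is divisible by `x₀`
for all `f` in the symmetric algebra. The quotient is in general well defined only as
an element `η f` of `Sym G ⊗ G`, where `η` is the skew derivation with `η x = 1 ⊗ q x`. -/
theorem IsRankOne.exists_quotient {q : G →ₗ[k] G} (hq : IsRankOne q) :
    ∃ η : SymmetricAlgebra k G →ₗ[k] SymmetricAlgebra k G ⊗[k] G, η 1 = 0 ∧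
      ∀ f x, η (f * SymmetricAlgebra.ι k G x) =
        LinearMap.rTensor G (symmetricAct k G (x - q x)) (η f) + f ⊗ₜ[k] q x := by
  -- The map `f ↦ (f, η f)` is the orbit of `(1, 0)` under an action of the symmetric algebra
  -- on the pairs `(f, m)` by `(f, m) x = (f x, m (x - q x) + f ⊗ q x)`.
  let ρ : G →ₗ[k] Module.End k (SymmetricAlgebra k G × (SymmetricAlgebra k G ⊗[k] G)) :=
    LinearMap.mk₂ k
      (fun x p => (symmetricAct k G x p.1,
        LinearMap.rTensor G (symmetricAct k G (x - q x)) p.2 + p.1 ⊗ₜ[k] q x))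
      (by
        intro x y p
        refine Prod.ext (by simp) ?_
        simp only [map_add, Prod.mk_add_mk, add_sub_add_comm, LinearMap.rTensor_add,
          LinearMap.add_apply, TensorProduct.tmul_add]
        abel)
      (by
        intro c x p
        refine Prod.ext (by simp) ?_
        simp only [map_smul, Prod.smul_mk, ← smul_sub, LinearMap.rTensor_smul,
          LinearMap.smul_apply, TensorProduct.tmul_smul, smul_add])
      (by
        intro x p p'
        refine Prod.ext (by simp) ?_
        simp only [Prod.fst_add, Prod.snd_add, map_add, TensorProduct.add_tmul, Prod.mk_add_mk]
        abel)
      (by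
        intro c x p
        refine Prod.ext (by simp) ?_
        simp only [Prod.smul_fst, Prod.smul_snd, map_smul, TensorProduct.smul_tmul', Prod.smul_mk,
          smul_add])
  have hρ (x : G) (p : SymmetricAlgebra k G × (SymmetricAlgebra k G ⊗[k] G)) :
      ρ x p = (symmetricAct k G x p.1,
        LinearMap.rTensor G (symmetricAct k G (x - q x)) p.2 + p.1 ⊗ₜ[k] q x) := rfl
  have hcomm (x y : G) (m : SymmetricAlgebra k G ⊗[k] G) :
      LinearMap.rTensor G (symmetricAct k G x) (LinearMap.rTensor G (symmetricAct k G y) m) =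
      LinearMap.rTensor G (symmetricAct k G y) (LinearMap.rTensor G (symmetricAct k G x) m) := by
    rw [← LinearMap.rTensor_comp_apply, ← LinearMap.rTensor_comp_apply]
    congr 2
    ext f
    simp only [LinearMap.comp_apply, symmetricAct_apply]
    rw [mul_right_comm]
  obtain ⟨Φ, h1, hΦ⟩ := exists_map_of_commuting ρ (fun x y p => by
    rw [hρ, hρ, hρ, hρ]
    refine Prod.ext ?_ ?_
    · exact mul_right_comm _ _ _
    · simp only [map_add, LinearMap.rTensor_tmul, hcomm (x - q x) (y - q y)]
      rw [add_assoc, add_assoc]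
      congr 1
      have h := hq.swap p.1 x y
      rw [symmetricAct_sub, symmetricAct_sub, symmetricAct_apply, symmetricAct_apply,
        TensorProduct.sub_tmul, TensorProduct.sub_tmul, h]
      abel) (1, 0)
  have hfst : LinearMap.fst k _ _ ∘ₗ Φ = LinearMap.id := by
    refine symmetricAlgebra_hom_ext (by simp [h1]) (fun a x ha => ?_)
    have ha' : (Φ a).1 = a := ha
    simp [hΦ, hρ, ha', symmetricAct_apply]
  have hfst' (f) : (Φ f).1 = f := LinearMap.congr_fun hfst f
  refine ⟨LinearMap.snd k _ _ ∘ₗ Φ, by simp [h1], fun f x => ?_⟩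
  simp only [LinearMap.comp_apply, hΦ, hρ, LinearMap.snd_apply, hfst']

/-- The identities for `η` follow by induction on the degree in `Sym G`: both sides of each satisfy
the same recursion along multiplication by the elements of `G`. -/
theorem IsRankOne.exists_isContraction_symmetricAlgebra {q : G →ₗ[k] G} (hq : IsRankOne q) :
    ∃ η, IsContraction (symmetricAct k G) q (symmetricMap (LinearMap.id - q)).toLinearMap η := by
  obtain ⟨η, h1, hη⟩ := hq.exists_quotient
  refine ⟨η, fun x y m => mul_right_comm _ _ _, fun x m => ?_, fun x f => hη f x, fun m => ?_,
    fun x m => ?_, fun x y t => hq.wedge_wedge x y t⟩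
  · simp [symmetricAct_apply, symmetricMap_ι, mul_sub]
  · have : TensorProduct.lift (symmetricAct k G).flip ∘ₗ η =
        LinearMap.id - (symmetricMap (LinearMap.id - q)).toLinearMap := by
      refine symmetricAlgebra_hom_ext (by simp [h1]) (fun a x ha => ?_)
      have key (s : SymmetricAlgebra k G ⊗[k] G) (z : G) :
          TensorProduct.lift (symmetricAct k G).flip (LinearMap.rTensor G (symmetricAct k G z) s) =
          TensorProduct.lift (symmetricAct k G).flip s * SymmetricAlgebra.ι k G z := by
        induction s with
        | zero => simp
        | tmul f y => simp [symmetricAct_apply, mul_right_comm]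
        | add a b ha hb => simp only [map_add, ha, hb, add_mul]
      simp only [LinearMap.comp_apply, LinearMap.sub_apply, LinearMap.id_apply,
        AlgHom.toLinearMap_apply] at ha
      simp only [LinearMap.comp_apply, LinearMap.sub_apply, LinearMap.id_apply,
        AlgHom.toLinearMap_apply, hη, map_add, key, ha, map_mul, symmetricMap_ι,
        TensorProduct.lift.tmul, LinearMap.flip_apply, symmetricAct_apply]
      simp only [map_sub]
      ring
    exact LinearMap.congr_fun this m
  · have : LinearMap.rTensor G (symmetricAct k G (q x)) ∘ₗ η =
        (TensorProduct.mk k _ G).flip (q x) ∘ₗ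
          (LinearMap.id - (symmetricMap (LinearMap.id - q)).toLinearMap) := by
      refine symmetricAlgebra_hom_ext (by simp [h1]) (fun a z ha => ?_)
      have hcomm (m : SymmetricAlgebra k G ⊗[k] G) :
          LinearMap.rTensor G (symmetricAct k G (q x))
            (LinearMap.rTensor G (symmetricAct k G (z - q z)) m) =
          LinearMap.rTensor G (symmetricAct k G (z - q z))
            (LinearMap.rTensor G (symmetricAct k G (q x)) m) := by
        rw [← LinearMap.rTensor_comp_apply, ← LinearMap.rTensor_comp_apply]
        congr 2
        ext f
        simp only [LinearMap.comp_apply, symmetricAct_apply]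
        rw [mul_right_comm]
      simp only [LinearMap.comp_apply, LinearMap.sub_apply, LinearMap.id_apply,
        AlgHom.toLinearMap_apply, LinearMap.flip_apply, TensorProduct.mk_apply] at ha
      simp only [LinearMap.comp_apply, LinearMap.sub_apply, LinearMap.id_apply,
        AlgHom.toLinearMap_apply, LinearMap.flip_apply, TensorProduct.mk_apply, hη, map_add,
        hcomm, ha, LinearMap.rTensor_tmul, symmetricAct_apply, hq.swap a x z, map_mul,
        symmetricMap_ι]
      simp only [map_sub, sub_mul, mul_sub, TensorProduct.sub_tmul]
      abel
    exact LinearMap.congr_fun this m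

variable (V : Type u) [AddCommGroup V] [Module k V]

theorem IsRankOne.exists_isContraction {q : G →ₗ[k] G} (hq : IsRankOne q) :
    ∃ η, IsContraction (tensorAct (symmetricAct k G) V) q
      (LinearMap.rTensor V (symmetricMap (LinearMap.id - q)).toLinearMap) η := by
  obtain ⟨η, h⟩ := hq.exists_isContraction_symmetricAlgebra
  have hr (φ : SymmetricAlgebra k G →ₗ[k] SymmetricAlgebra k G)
      (s : SymmetricAlgebra k G ⊗[k] G) (v : V) :
      TensorProduct.rightComm k _ G V (LinearMap.rTensor G φ s ⊗ₜ[k] v) =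
        LinearMap.rTensor G (LinearMap.rTensor V φ)
          (TensorProduct.rightComm k _ G V (s ⊗ₜ[k] v)) := by
    induction s with
    | zero => simp
    | tmul f y => simp
    | add a b ha hb => simp only [map_add, TensorProduct.add_tmul, ha, hb]
  refine ⟨(TensorProduct.rightComm k _ G V).toLinearMap ∘ₗ LinearMap.rTensor V η,
    fun x y m => ?_, fun x m => ?_, fun x m => ?_, fun m => ?_, fun x m => ?_,
    fun x y t => hq.wedge_wedge x y t⟩
  · induction m with
    | zero => simp
    | tmul f v => simp only [tensorAct_apply, LinearMap.rTensor_tmul, h.comm x y]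
    | add a b ha hb => simp only [map_add, ha, hb]
  · induction m with
    | zero => simp
    | tmul f v => simp only [tensorAct_apply, LinearMap.rTensor_tmul, h.map_ρ]
    | add a b ha hb => simp only [map_add, ha, hb]
  · induction m with
    | zero => simp
    | tmul f v =>
      simp only [tensorAct_apply, LinearMap.comp_apply, LinearMap.rTensor_tmul, h.η_ρ,
        TensorProduct.add_tmul, LinearEquiv.coe_coe, map_add, hr, TensorProduct.rightComm_tmul]
    | add a b ha hb =>
      simp only [map_add, ha, hb, TensorProduct.add_tmul]
      abel
  · induction m with
    | zero => simp
    | tmul f v =>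
      have key (s : SymmetricAlgebra k G ⊗[k] G) :
          TensorProduct.lift (tensorAct (symmetricAct k G) V).flip
            (TensorProduct.rightComm k _ G V (s ⊗ₜ[k] v)) =
          TensorProduct.lift (symmetricAct k G).flip s ⊗ₜ[k] v := by
        induction s with
        | zero => simp
        | tmul f y => simp [tensorAct_apply]
        | add a b ha hb => simp only [map_add, TensorProduct.add_tmul, ha, hb]
      simp only [LinearMap.comp_apply, LinearMap.rTensor_tmul, LinearEquiv.coe_coe, key, h.lift_η,
        TensorProduct.sub_tmul]
    | add a b ha hb =>
      simp only [map_add, ha, hb]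
      abel
  · induction m with
    | zero => simp
    | tmul f v =>
      simp only [tensorAct_apply, LinearMap.comp_apply, LinearMap.rTensor_tmul,
        LinearEquiv.coe_coe, ← hr, h.swap, TensorProduct.rightComm_tmul, TensorProduct.sub_tmul,
        map_sub]
    | add a b ha hb =>
      simp only [map_add, ha, hb, TensorProduct.sub_tmul, TensorProduct.add_tmul]
      abel

/-- The endomorphism `p` of `G` acts as the identity on the homology of the Koszul complexes
`Sym G ⊗ V ⊗ Λ G`, for all modules `V`. -/
def IsKoszulTrivial (p : G →ₗ[k] G) : Prop :=
  ∀ (V : Type u) [AddCommGroup V] [Module k V]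
    (c : (SymmetricAlgebra k G ⊗[k] V) ⊗[k] ExteriorAlgebra k G),
    koszulD (tensorAct (symmetricAct k G) V) c = 0 →
    ∃ z, c = koszulMap V p c + koszulD (tensorAct (symmetricAct k G) V) z

theorem isKoszulTrivial_id : IsKoszulTrivial (LinearMap.id : G →ₗ[k] G) :=
  fun V _ _ c _ => ⟨0, by rw [koszulMap_id, map_zero, add_zero]⟩

theorem IsKoszulTrivial.comp {p p' : G →ₗ[k] G} (hp : IsKoszulTrivial p)
    (hp' : IsKoszulTrivial p') : IsKoszulTrivial (p ∘ₗ p') := by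
  intro V _ _ c hc
  obtain ⟨z, hz⟩ := hp V c hc
  obtain ⟨z', hz'⟩ := hp' V c hc
  refine ⟨z + koszulMap V p z', ?_⟩
  nth_rewrite 1 [hz]
  nth_rewrite 1 [hz']
  rw [map_add, koszulMap_koszulMap, koszulMap_koszulD, map_add]
  abel

theorem IsRankOne.isKoszulTrivial {q : G →ₗ[k] G} (hq : IsRankOne q) :
    IsKoszulTrivial (LinearMap.id - q) := by
  intro V _ _ c hc
  obtain ⟨η, h⟩ := hq.exists_isContraction V
  refine ⟨h.homotopy c, ?_⟩
  have := h.koszulD_homotopy c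
  rw [hc, map_zero, add_zero] at this
  rw [this, koszulMap, add_sub_cancel]

variable (k G) in
/-- The Koszul complex of `G` is pure acyclic: the endomorphism zero of `G` acts as the identity
on homology. As it maps `Sym G ⊗ V ⊗ Λ G` to `1 ⊗ V ⊗ 1`, this means that `Sym G ⊗ V ⊗ Λ G` is
a resolution of `V`, for all modules `V`. -/
def IsKoszul : Prop := IsKoszulTrivial (0 : G →ₗ[k] G)

/-- If the identity of `G` is a sum of orthogonal endomorphisms `q i` of rank one, then zero is the
product of the `1 - q i`, each of which acts as the identity on homology. -/
theorem isKoszul_of_orthogonal {ι : Type*} [Fintype ι] (q : ι → G →ₗ[k] G)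
    (hq : ∀ i, IsRankOne (q i)) (horth : ∀ i j, i ≠ j → q i ∘ₗ q j = 0)
    (hsum : ∑ i, q i = LinearMap.id) : IsKoszul k G := by
  classical
  have key (s : Finset ι) : IsKoszulTrivial (LinearMap.id - ∑ i ∈ s, q i) := by
    induction s using Finset.induction_on with
    | empty => simpa using isKoszulTrivial_id
    | insert i s hi ih =>
      have : LinearMap.id - ∑ j ∈ insert i s, q j =
          (LinearMap.id - q i) ∘ₗ (LinearMap.id - ∑ j ∈ s, q j) := by
        have h0 : q i ∘ₗ ∑ j ∈ s, q j = 0 := by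
          ext z
          rw [LinearMap.comp_apply, LinearMap.sum_apply, map_sum]
          exact Finset.sum_eq_zero fun j hj =>
            LinearMap.congr_fun (horth i j (fun h => hi (h ▸ hj))) z
        rw [LinearMap.sub_comp, LinearMap.comp_sub _ _ (q i), h0,
          Finset.sum_insert hi, LinearMap.id_comp, LinearMap.comp_id]
        abel
      rw [this]
      exact (hq i).isKoszulTrivial.comp ih
  have := key Finset.univ
  rwa [hsum, sub_self] at this

theorem IsKoszul.of_equiv {G' : Type u} [AddCommGroup G'] [Module k G'] (e : G ≃ₗ[k] G')
    (h : IsKoszul k G') : IsKoszul k G := by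
  intro V _ _ c hc
  obtain ⟨z, hz⟩ := h V (koszulMap V e.toLinearMap c) (by rw [← koszulMap_koszulD, hc, map_zero])
  have h1 : (e.symm.toLinearMap ∘ₗ (0 : G' →ₗ[k] G')) ∘ₗ e.toLinearMap = 0 := by simp
  have h2 := congrArg (koszulMap V e.symm.toLinearMap) hz
  rw [map_add, koszulMap_koszulD, koszulMap_koszulMap, koszulMap_koszulMap, koszulMap_koszulMap,
    h1, e.symm_comp, koszulMap_id] at h2
  exact ⟨_, h2⟩

variable (k) in
theorem isKoszul_finsupp (n : ℕ) : IsKoszul k (Fin n →₀ k) := by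
  refine isKoszul_of_orthogonal (fun i => Finsupp.lsingle i ∘ₗ Finsupp.lapply i) (fun i => ?_)
    (fun i j hij => ?_) ?_
  · exact ⟨Finsupp.single i 1, fun z => ⟨z i, by simp⟩⟩
  · ext l
    simp [Finsupp.single_apply, hij]
  · refine LinearMap.ext fun z => ?_
    simp

/-- Over a principal ideal domain, a finitely generated module is a finite sum of cyclic modules. -/
theorem isKoszul_of_finite [IsDomain k] [IsPrincipalIdealRing k] [Module.Finite k G] :
    IsKoszul k G := by
  classical
  obtain ⟨n, ι, _, p, _, e, ⟨E⟩⟩ := Module.equiv_free_prod_directSum k G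
  refine IsKoszul.of_equiv E ?_
  let C := fun i : ι => k ⧸ (k ∙ p i ^ e i)
  change IsKoszul k ((Fin n →₀ k) × DirectSum ι C)
  let q : Fin n ⊕ ι → (Fin n →₀ k) × DirectSum ι C →ₗ[k] (Fin n →₀ k) × DirectSum ι C :=
    Sum.elim
      (fun i => LinearMap.inl k _ _ ∘ₗ Finsupp.lsingle i ∘ₗ Finsupp.lapply i ∘ₗ LinearMap.fst k _ _)
      (fun i => LinearMap.inr k _ _ ∘ₗ DirectSum.lof k ι C i ∘ₗ DirectSum.component k ι C i ∘ₗ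
        LinearMap.snd k _ _)
  refine isKoszul_of_orthogonal q (fun i => ?_) (fun i j hij => ?_) ?_
  · cases i with
    | inl i => exact ⟨(Finsupp.single i 1, 0), fun z => ⟨z.1 i, by simp [q]⟩⟩
    | inr i =>
      refine ⟨(0, DirectSum.lof k ι C i (Submodule.Quotient.mk 1)), fun z => ?_⟩
      obtain ⟨a, ha⟩ := Submodule.Quotient.mk_surjective _ (DirectSum.component k ι C i z.2)
      have ha' : a • (Submodule.Quotient.mk 1 : C i) = DirectSum.component k ι C i z.2 := by
        rw [← ha, ← Submodule.Quotient.mk_smul, smul_eq_mul, mul_one]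
      refine ⟨a, ?_⟩
      simp only [q, Sum.elim_inr, LinearMap.comp_apply, LinearMap.snd_apply,
        LinearMap.inr_apply, Prod.smul_mk, smul_zero, ← map_smul, ha']
  · refine LinearMap.ext fun z => ?_
    cases i with
    | inl i =>
      cases j with
      | inl j =>
        have : i ≠ j := fun h => hij (h ▸ rfl)
        simp [q, this.symm]
      | inr j => simp [q]
    | inr i =>
      cases j with
      | inl j => simp [q]
      | inr j =>
        have : j ≠ i := fun h => hij (h ▸ rfl)
        simp [q, DirectSum.component.of, this]
  · refine LinearMap.ext fun z => ?_
    have h2 : ∑ i, DirectSum.lof k ι C i (DirectSum.component k ι C i z.2) = z.2 :=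
      DirectSum.sum_univ_of z.2
    rw [LinearMap.sum_apply, Fintype.sum_sum_type]
    refine Prod.ext ?_ ?_
    · simp [q, Prod.fst_sum]
    · simp only [q, Sum.elim_inl, Sum.elim_inr, LinearMap.comp_apply, LinearMap.snd_apply,
        LinearMap.inl_apply, LinearMap.inr_apply, Prod.snd_add, Prod.snd_sum,
        Finset.sum_const_zero, zero_add, LinearMap.id_apply]
      exact h2

end Cyclic

/-! ### Koszul acyclicity by passage to finitely presented modules -/

section Finitary

variable {k L : Type u} [CommRing k] [AddCommGroup L] [Module k L]

/-- A family of submodules `K N` of `X`, indexed by the submodules `N` of `L`, that is determined by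
the finitely generated `N`. For the kernels of the maps `F L → F (L ⧸ N)` this says that
the functor `F` commutes with filtered unions of relations. -/
def IsFinitary {X : Type u} [AddCommGroup X] [Module k X]
    (K : Submodule k L → Submodule k X) : Prop :=
  Monotone K ∧ ∀ N x, x ∈ K N → ∃ N' ≤ N, N'.FG ∧ x ∈ K N'

/-- Let `B N` be the universal algebra under `A` in which the elements `i x`, for `x ∈ N`, vanish.
Then the kernel of `A → B N` is finitary, since the union of the kernels for the finitely
generated `N' ≤ N` is an ideal that contains the `i x`. -/
theorem isFinitary_ker_algHom {A : Type u} [Ring A] [Algebra k A] (i : L →ₗ[k] A)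
    {B : Submodule k L → Type u} [∀ N, Ring (B N)] [∀ N, Algebra k (B N)]
    (φ : ∀ N, A →ₐ[k] B N) (hφ : ∀ N, ∀ x ∈ N, φ N (i x) = 0)
    (huniv : ∀ N (I : Ideal A) [I.IsTwoSided], (∀ x ∈ N, i x ∈ I) → ∀ a, φ N a = 0 → a ∈ I) :
    IsFinitary fun N => LinearMap.ker (φ N).toLinearMap := by
  have hmono {N N' : Submodule k L} (h : N ≤ N') (a : A) (ha : φ N a = 0) : φ N' a = 0 :=
    huniv N (RingHom.ker (φ N')) (fun x hx => hφ N' x (h hx)) a ha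
  refine ⟨fun N N' h a ha => hmono h a ha, fun N a ha => ?_⟩
  let I : Ideal A :=
    { carrier := {a | ∃ N' ≤ N, N'.FG ∧ φ N' a = 0}
      zero_mem' := ⟨⊥, bot_le, Submodule.fg_bot, map_zero _⟩
      add_mem' := by
        rintro a b ⟨N₁, h₁, f₁, ha⟩ ⟨N₂, h₂, f₂, hb⟩
        refine ⟨N₁ ⊔ N₂, sup_le h₁ h₂, f₁.sup f₂, ?_⟩
        rw [map_add, hmono le_sup_left a ha, hmono le_sup_right b hb, add_zero]
      smul_mem' := by
        rintro c a ⟨N₁, h₁, f₁, ha⟩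
        exact ⟨N₁, h₁, f₁, by rw [smul_eq_mul, map_mul, ha, mul_zero]⟩ }
  have : I.IsTwoSided := ⟨by
    rintro a c ⟨N₁, h₁, f₁, ha⟩
    exact ⟨N₁, h₁, f₁, by rw [map_mul, ha, zero_mul]⟩⟩
  refine huniv N I (fun x hx => ?_) a ha
  exact ⟨k ∙ x, (Submodule.span_singleton_le_iff_mem x N).2 hx, Submodule.fg_span_singleton x,
    hφ _ x (Submodule.mem_span_singleton_self x)⟩

theorem isFinitary_symmetricMap :
    IsFinitary fun N : Submodule k L => LinearMap.ker (symmetricMap N.mkQ).toLinearMap := by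
  refine isFinitary_ker_algHom (SymmetricAlgebra.ι k L) (fun N => symmetricMap N.mkQ)
    (fun N x hx => ?_) (fun N I _ hI a ha => ?_)
  · rw [symmetricMap_ι, Submodule.mkQ_apply, (Submodule.Quotient.mk_eq_zero N).2 hx, map_zero]
  · let ψ : SymmetricAlgebra k (L ⧸ N) →ₐ[k] SymmetricAlgebra k L ⧸ I :=
      SymmetricAlgebra.lift (N.liftQ ((Ideal.Quotient.mkₐ k I).toLinearMap ∘ₗ
        SymmetricAlgebra.ι k L) (fun x hx => by
          simpa using Ideal.Quotient.eq_zero_iff_mem.2 (hI x hx)))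
    have h : ψ.comp (symmetricMap N.mkQ) = Ideal.Quotient.mkₐ k I := by
      ext x
      simp [ψ, symmetricMap_ι]
    have := DFunLike.congr_fun h a
    rw [AlgHom.comp_apply, ha, map_zero] at this
    exact Ideal.Quotient.eq_zero_iff_mem.1 this.symm

theorem isFinitary_exteriorMap :
    IsFinitary fun N : Submodule k L =>
      LinearMap.ker (ExteriorAlgebra.map (R := k) N.mkQ).toLinearMap := by
  refine isFinitary_ker_algHom (ExteriorAlgebra.ι k) (fun N => ExteriorAlgebra.map N.mkQ)
    (fun N x hx => ?_) (fun N I _ hI a ha => ?_)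
  · rw [ExteriorAlgebra.map_apply_ι, Submodule.mkQ_apply,
      (Submodule.Quotient.mk_eq_zero N).2 hx, map_zero]
  · let j : L ⧸ N →ₗ[k] ExteriorAlgebra k L ⧸ I :=
      N.liftQ ((Ideal.Quotient.mkₐ k I).toLinearMap ∘ₗ ExteriorAlgebra.ι k) (fun x hx => by
          simpa using Ideal.Quotient.eq_zero_iff_mem.2 (hI x hx))
    let ψ : ExteriorAlgebra k (L ⧸ N) →ₐ[k] ExteriorAlgebra k L ⧸ I :=
      ExteriorAlgebra.lift k ⟨j, fun m => by
        obtain ⟨x, rfl⟩ := N.mkQ_surjective m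
        change Ideal.Quotient.mkₐ k I (ExteriorAlgebra.ι k x) *
          Ideal.Quotient.mkₐ k I (ExteriorAlgebra.ι k x) = 0
        rw [← map_mul, ExteriorAlgebra.ι_sq_zero, map_zero]⟩
    have h : ψ.comp (ExteriorAlgebra.map N.mkQ) = Ideal.Quotient.mkₐ k I := by
      ext x
      simp [ψ, j]
    have := DFunLike.congr_fun h a
    rw [AlgHom.comp_apply, ha, map_zero] at this
    exact Ideal.Quotient.eq_zero_iff_mem.1 this.symm

/-- The kernel of a tensor product of surjections is generated by the kernels of its factors. -/
theorem IsFinitary.tensor {X Y : Type u} [AddCommGroup X] [Module k X] [AddCommGroup Y]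
    [Module k Y] {X' Y' : Submodule k L → Type u} [∀ N, AddCommGroup (X' N)]
    [∀ N, Module k (X' N)] [∀ N, AddCommGroup (Y' N)] [∀ N, Module k (Y' N)]
    {φ : ∀ N, X →ₗ[k] X' N} {ψ : ∀ N, Y →ₗ[k] Y' N}
    (hφs : ∀ N, Function.Surjective (φ N)) (hψs : ∀ N, Function.Surjective (ψ N))
    (hφ : IsFinitary fun N => LinearMap.ker (φ N)) (hψ : IsFinitary fun N => LinearMap.ker (ψ N)) :
    IsFinitary fun N => LinearMap.ker (TensorProduct.map (φ N) (ψ N)) := by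
  have hker (N : Submodule k L) : LinearMap.ker (TensorProduct.map (φ N) (ψ N)) =
      LinearMap.range (LinearMap.lTensor X (LinearMap.ker (ψ N)).subtype) ⊔
      LinearMap.range (LinearMap.rTensor Y (LinearMap.ker (φ N)).subtype) :=
    TensorProduct.map_ker (LinearMap.exact_subtype_ker_map (φ N)) (hφs N)
      (LinearMap.exact_subtype_ker_map (ψ N)) (hψs N)
  have hmono : Monotone fun N => LinearMap.ker (TensorProduct.map (φ N) (ψ N)) := by
    intro N N' h
    simp only [hker]
    refine sup_le_sup ?_ ?_
    · rintro _ ⟨t, rfl⟩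
      exact ⟨LinearMap.lTensor X (Submodule.inclusion (hψ.1 h)) t, by
        rw [← LinearMap.lTensor_comp_apply]; rfl⟩
    · rintro _ ⟨t, rfl⟩
      exact ⟨LinearMap.rTensor Y (Submodule.inclusion (hφ.1 h)) t, by
        rw [← LinearMap.rTensor_comp_apply]; rfl⟩
  refine ⟨hmono, fun N x hx => ?_⟩
  simp only [hker] at hx
  have hadd (a b : X ⊗[k] Y)
      (ha : ∃ N' ≤ N, N'.FG ∧ a ∈ LinearMap.ker (TensorProduct.map (φ N') (ψ N')))
      (hb : ∃ N' ≤ N, N'.FG ∧ b ∈ LinearMap.ker (TensorProduct.map (φ N') (ψ N'))) :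
      ∃ N' ≤ N, N'.FG ∧ a + b ∈ LinearMap.ker (TensorProduct.map (φ N') (ψ N')) := by
    obtain ⟨N₁, h₁, f₁, ha⟩ := ha
    obtain ⟨N₂, h₂, f₂, hb⟩ := hb
    exact ⟨N₁ ⊔ N₂, sup_le h₁ h₂, f₁.sup f₂,
      add_mem (hmono le_sup_left ha) (hmono le_sup_right hb)⟩
  have hzero : ∃ N' ≤ N, N'.FG ∧ (0 : X ⊗[k] Y) ∈ LinearMap.ker (TensorProduct.map (φ N') (ψ N')) :=
    ⟨⊥, bot_le, Submodule.fg_bot, zero_mem _⟩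
  obtain ⟨_, ⟨s, rfl⟩, _, ⟨t, rfl⟩, rfl⟩ := Submodule.mem_sup.1 hx
  clear hx
  refine hadd _ _ ?_ ?_
  · induction s with
    | zero => simpa using hzero
    | tmul x y =>
      obtain ⟨N', h, f, hy⟩ := hψ.2 N y y.2
      exact ⟨N', h, f, by simp [LinearMap.mem_ker.1 hy]⟩
    | add a b ha hb => rw [map_add]; exact hadd _ _ ha hb
  · induction t with
    | zero => simpa using hzero
    | tmul x y =>
      obtain ⟨N', h, f, hy⟩ := hφ.2 N x x.2
      exact ⟨N', h, f, by simp [LinearMap.mem_ker.1 hy]⟩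
    | add a b ha hb => rw [map_add]; exact hadd _ _ ha hb

variable {L' : Type u} [AddCommGroup L'] [Module k L']

theorem symmetricMap_surjective {f : L →ₗ[k] L'} (hf : Function.Surjective f) :
    Function.Surjective (symmetricMap f) := by
  intro a
  induction a using SymmetricAlgebra.induction with
  | algebraMap r => exact ⟨algebraMap k _ r, AlgHom.commutes _ r⟩
  | ι x =>
    obtain ⟨y, rfl⟩ := hf x
    exact ⟨_, symmetricMap_ι f y⟩
  | mul a b ha hb =>
    obtain ⟨⟨a, rfl⟩, ⟨b, rfl⟩⟩ := ha, hb
    exact ⟨a * b, map_mul _ _ _⟩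
  | add a b ha hb =>
    obtain ⟨⟨a, rfl⟩, ⟨b, rfl⟩⟩ := ha, hb
    exact ⟨a + b, map_add _ _ _⟩

theorem exteriorMap_surjective {f : L →ₗ[k] L'} (hf : Function.Surjective f) :
    Function.Surjective (ExteriorAlgebra.map f) := by
  intro a
  induction a using ExteriorAlgebra.induction with
  | algebraMap r => exact ⟨algebraMap k _ r, AlgHom.commutes _ r⟩
  | ι x =>
    obtain ⟨y, rfl⟩ := hf x
    exact ⟨_, ExteriorAlgebra.map_apply_ι f y⟩
  | mul a b ha hb =>
    obtain ⟨⟨a, rfl⟩, ⟨b, rfl⟩⟩ := ha, hb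
    exact ⟨a * b, map_mul _ _ _⟩
  | add a b ha hb =>
    obtain ⟨⟨a, rfl⟩, ⟨b, rfl⟩⟩ := ha, hb
    exact ⟨a + b, map_add _ _ _⟩

variable (V : Type u) [AddCommGroup V] [Module k V]

theorem koszulMap_surjective {f : L →ₗ[k] L'} (hf : Function.Surjective f) :
    Function.Surjective (koszulMap V f) :=
  TensorProduct.map_surjective (LinearMap.rTensor_surjective V (symmetricMap_surjective hf))
    (exteriorMap_surjective hf)

theorem isFinitary_koszulMap :
    IsFinitary (X := (SymmetricAlgebra k L ⊗[k] V) ⊗[k] ExteriorAlgebra k L)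
      fun N : Submodule k L => LinearMap.ker (koszulMap V N.mkQ) := by
  refine IsFinitary.tensor
    (fun N => LinearMap.rTensor_surjective V (symmetricMap_surjective N.mkQ_surjective))
    (fun N => exteriorMap_surjective N.mkQ_surjective) ?_ isFinitary_exteriorMap
  refine IsFinitary.tensor (ψ := fun _ => LinearMap.id)
    (fun N => symmetricMap_surjective N.mkQ_surjective) (fun _ => Function.surjective_id)
    isFinitary_symmetricMap ⟨fun _ _ _ => le_rfl, fun N x hx => ?_⟩
  exact ⟨⊥, bot_le, Submodule.fg_bot, hx⟩

end Finitary

section Restriction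

open Filter

variable (k : Type u) [CommRing k] {T : Type u}

/-- The restriction of finitely supported functions to a finite set. -/
noncomputable def finsuppRestrict (s : Finset T) : (T →₀ k) →ₗ[k] (s →₀ k) :=
  Finsupp.lcomapDomain Subtype.val Subtype.val_injective

/-- The extension by zero of functions on a finite set. -/
noncomputable def finsuppExtend (s : Finset T) : (s →₀ k) →ₗ[k] (T →₀ k) :=
  Finsupp.lmapDomain k k Subtype.val

/-- The endomorphism of the free module on `T` that forgets the values outside of `s`. -/
noncomputable def finsuppTrunc (s : Finset T) : (T →₀ k) →ₗ[k] (T →₀ k) :=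
  finsuppExtend k s ∘ₗ finsuppRestrict k s

theorem eventually_finsuppTrunc (x : T →₀ k) : ∀ᶠ s in atTop, finsuppTrunc k s x = x := by
  filter_upwards [eventually_ge_atTop x.support] with s hs
  exact Finsupp.mapDomain_comapDomain _ Subtype.val_injective x (by simpa using hs)

theorem eventually_symmetricMap_finsuppTrunc (a : SymmetricAlgebra k (T →₀ k)) :
    ∀ᶠ s in atTop, symmetricMap (finsuppTrunc k s) a = a := by
  induction a using SymmetricAlgebra.induction with
  | algebraMap r => exact .of_forall fun s => AlgHom.commutes _ r
  | ι x =>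
    filter_upwards [eventually_finsuppTrunc k x] with s hs
    rw [symmetricMap_ι, hs]
  | mul a b ha hb => filter_upwards [ha, hb] with s hs hs'; rw [map_mul, hs, hs']
  | add a b ha hb => filter_upwards [ha, hb] with s hs hs'; rw [map_add, hs, hs']

theorem eventually_exteriorMap_finsuppTrunc (a : ExteriorAlgebra k (T →₀ k)) :
    ∀ᶠ s in atTop, ExteriorAlgebra.map (finsuppTrunc k s) a = a := by
  induction a using ExteriorAlgebra.induction with
  | algebraMap r => exact .of_forall fun s => AlgHom.commutes _ r
  | ι x =>
    filter_upwards [eventually_finsuppTrunc k x] with s hs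
    rw [ExteriorAlgebra.map_apply_ι, hs]
  | mul a b ha hb => filter_upwards [ha, hb] with s hs hs'; rw [map_mul, hs, hs']
  | add a b ha hb => filter_upwards [ha, hb] with s hs hs'; rw [map_add, hs, hs']

theorem eventually_koszulMap_finsuppTrunc (V : Type u) [AddCommGroup V] [Module k V]
    (c : (SymmetricAlgebra k (T →₀ k) ⊗[k] V) ⊗[k] ExteriorAlgebra k (T →₀ k)) :
    ∀ᶠ s in atTop, koszulMap V (finsuppTrunc k s) c = c := by
  induction c with
  | zero => simp
  | tmul m ω =>
    have hm : ∀ᶠ s in atTop,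
        LinearMap.rTensor V (symmetricMap (finsuppTrunc k s)).toLinearMap m = m := by
      induction m with
      | zero => simp
      | tmul a v =>
        filter_upwards [eventually_symmetricMap_finsuppTrunc k a] with s hs
        rw [LinearMap.rTensor_tmul, AlgHom.toLinearMap_apply, hs]
      | add a b ha hb => filter_upwards [ha, hb] with s hs hs'; rw [map_add, hs, hs']
    filter_upwards [hm, eventually_exteriorMap_finsuppTrunc k ω] with s hs hs'
    rw [koszulMap, tensorExteriorMap_tmul, hs, hs']
  | add a b ha hb => filter_upwards [ha, hb] with s hs hs'; rw [map_add, hs, hs']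

theorem eventually_finsuppTrunc_of_fg {N : Submodule k (T →₀ k)} (hN : N.FG) :
    ∀ᶠ s in atTop, ∀ x ∈ N, finsuppTrunc k s x = x := by
  obtain ⟨X, rfl⟩ := hN
  filter_upwards [(eventually_all_finset X).2 fun x _ => eventually_finsuppTrunc k x] with s hs
  intro x hx
  induction hx using Submodule.span_induction with
  | mem x h => exact hs x h
  | zero => exact map_zero _
  | add x y _ _ hx hy => rw [map_add, hx, hy]
  | smul a x _ hx => rw [map_smul, hx]

variable {k} {G : Type u} [AddCommGroup G] [Module k G]

/-- Koszul acyclicity can be tested on the finitely presented modules over `G`: it suffices that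
every map from a finite free module to `G` that vanishes on a finitely generated submodule `N`
factors through a module `Q` with acyclic Koszul complex, such that the map to `Q` vanishes
on `N`. -/
theorem isKoszul_of_factorization
    (h : ∀ (T : Type u) [Finite T] (N : Submodule k (T →₀ k)) (ψ : (T →₀ k) →ₗ[k] G), N.FG →
      (∀ x ∈ N, ψ x = 0) → ∃ (Q : Type u) (_ : AddCommGroup Q) (_ : Module k Q)
        (a : (T →₀ k) →ₗ[k] Q) (y : Q →ₗ[k] G), IsKoszul k Q ∧ y ∘ₗ a = ψ ∧ ∀ x ∈ N, a x = 0) :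
    IsKoszul k G := by
  intro V _ _ c hc
  let φ : (G →₀ k) →ₗ[k] G := Finsupp.linearCombination k id
  have hφ : Function.Surjective φ := fun x => ⟨Finsupp.single x 1, by simp [φ]⟩
  let N := LinearMap.ker φ
  obtain ⟨c₁, rfl⟩ := koszulMap_surjective V hφ c
  -- The boundary of a lift `c₁` of `c` vanishes modulo finitely many relations.
  have hc₁ : koszulMap V N.mkQ (koszulD (tensorAct (symmetricAct k _) V) c₁) = 0 := by
    let e : ((G →₀ k) ⧸ N) ≃ₗ[k] G := φ.quotKerEquivOfSurjective hφ
    have he : N.mkQ = e.symm.toLinearMap ∘ₗ φ := by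
      refine LinearMap.ext fun x => ?_
      rw [LinearMap.comp_apply, LinearEquiv.coe_coe, LinearEquiv.eq_symm_apply]
      rfl
    rw [he, ← koszulMap_koszulMap, koszulMap_koszulD, hc, map_zero]
  obtain ⟨N₁, hN₁, hfg, hc₂⟩ := (isFinitary_koszulMap V).2 N _ hc₁
  -- The lift `c₁` and these relations are supported on a finite set `s` of generators.
  obtain ⟨s, hs, hs'⟩ := ((eventually_koszulMap_finsuppTrunc k V c₁).and
    (eventually_finsuppTrunc_of_fg k hfg)).exists
  let r := finsuppRestrict k s
  let j := finsuppExtend k s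
  obtain ⟨Q, _, _, a, y, hQ, hya, ha⟩ := h s (N₁.map r) (φ ∘ₗ j) (hfg.map r) (by
    rintro _ ⟨x, hx, rfl⟩
    have h1 : j (r x) = x := hs' x hx
    rw [LinearMap.comp_apply, h1]
    exact hN₁ hx)
  have hc₃ : koszulMap V j (koszulMap V r c₁) = c₁ := by
    rw [koszulMap_koszulMap]
    exact hs
  have hcycle :
      koszulD (tensorAct (symmetricAct k Q) V) (koszulMap V a (koszulMap V r c₁)) = 0 := by
    have h1 : a ∘ₗ r = N₁.liftQ (a ∘ₗ r) (fun x hx => ha _ ⟨x, hx, rfl⟩) ∘ₗ N₁.mkQ :=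
      (Submodule.liftQ_mkQ _ _ _).symm
    rw [koszulMap_koszulMap, ← koszulMap_koszulD, h1, ← koszulMap_koszulMap,
      LinearMap.mem_ker.1 hc₂, map_zero]
  obtain ⟨z, hz⟩ := hQ V _ hcycle
  refine ⟨koszulMap V y z, ?_⟩
  have h2 : koszulMap V φ c₁ = koszulMap V y (koszulMap V a (koszulMap V r c₁)) := by
    rw [koszulMap_koszulMap V a, hya, ← koszulMap_koszulMap V j, hc₃]
  rw [← koszulMap_koszulD, koszulMap_koszulMap, LinearMap.zero_comp]
  nth_rewrite 1 [h2]
  rw [hz, map_add]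
  congr 1
  simp only [koszulMap_koszulMap, LinearMap.comp_zero, LinearMap.zero_comp]

theorem isKoszul (h : (IsDomain k ∧ IsPrincipalIdealRing k) ∨ Module.Flat k G) : IsKoszul k G := by
  refine isKoszul_of_factorization fun T _ N ψ hN hψ => ?_
  rcases h with ⟨_, _⟩ | hflat
  -- Over a principal ideal domain every finitely generated module has an acyclic Koszul complex.
  · exact ⟨_ ⧸ N, inferInstance, inferInstance, N.mkQ, N.liftQ ψ hψ, isKoszul_of_finite,
      N.liftQ_mkQ ψ hψ, fun x hx => (Submodule.Quotient.mk_eq_zero N).2 hx⟩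
  -- A map from a finitely presented module to a flat module factors through a finite free module.
  · have : Module.Finite k N := Module.Finite.of_fg hN
    have h0 : ψ ∘ₗ N.subtype = 0 := LinearMap.ext fun x => hψ x x.2
    obtain ⟨n, a, y, rfl, ha⟩ := Module.Flat.exists_factorization_of_comp_eq_zero_of_free
      (R := k) (M := G) (K := N) (f := N.subtype) (x := ψ) h0
    exact ⟨Fin n →₀ k, inferInstance, inferInstance, a, y, isKoszul_finsupp k n, rfl,
      fun x hx => LinearMap.congr_fun ha ⟨x, hx⟩⟩

end Restriction

/-! ### Enveloping algebras -/

section Enveloping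

variable {k g : Type u} [CommRing k] [LieRing g] [LieAlgebra k g]

attribute [local instance 100] LieRing.ofAssociativeRing

/-- The enveloping algebra is generated by `1` as a module over the operators of right
multiplication by the elements of `g`. -/
theorem universalEnveloping_induction {p : UniversalEnvelopingAlgebra k g → Prop}
    (add : ∀ u v, p u → p v → p (u + v)) (smul : ∀ (c : k) u, p u → p (c • u)) (one : p 1)
    (mul : ∀ u x, p u → p (u * UniversalEnvelopingAlgebra.ι k x))
    (u : UniversalEnvelopingAlgebra k g) : p u := by
  obtain ⟨a, rfl⟩ : ∃ a, UniversalEnvelopingAlgebra.mkAlgHom k g a = u :=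
    RingCon.mk'_surjective _ u
  have key (a : TensorAlgebra k g) :
      ∀ v, p v → p (v * UniversalEnvelopingAlgebra.mkAlgHom k g a) := by
    induction a using TensorAlgebra.induction with
    | algebraMap r =>
      intro v hv
      rw [AlgHom.commutes, ← Algebra.commutes, ← Algebra.smul_def]
      exact smul r v hv
    | ι x => exact fun v hv => mul v x hv
    | mul a b ha hb => exact fun v hv => by rw [map_mul, ← mul_assoc]; exact hb _ (ha _ hv)
    | add a b ha hb => exact fun v hv => by rw [map_add, mul_add]; exact add _ _ (ha _ hv) (hb _ hv)
  simpa using key a 1 one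

/-- The enveloping algebra is the free twisted module on one generator for `τ = id`. -/
theorem exists_map_universalEnveloping {X : Type u} [AddCommGroup X] [Module k X]
    {ρ : g →ₗ[k] X →ₗ[k] X} (h : IsTwistedModule ρ LinearMap.id) (v : X) :
    ∃ Φ : UniversalEnvelopingAlgebra k g →ₗ[k] X, Φ 1 = v ∧
      ∀ u x, Φ (u * UniversalEnvelopingAlgebra.ι k x) = ρ x (Φ u) := by
  let ρ' : g →ₗ⁅k⁆ (Module.End k X)ᵐᵒᵖ :=
    { (MulOpposite.opLinearEquiv k).toLinearMap ∘ₗ ρ with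
      map_lie' := by
        intro x y
        rw [LieRing.of_associative_ring_bracket]
        refine MulOpposite.unop_injective (LinearMap.ext fun m => ?_)
        change ρ ⁅x, y⁆ m = ρ y (ρ x m) - ρ x (ρ y m)
        rw [h.lie x y, LinearMap.id_apply, sub_sub_cancel] }
  let Ψ := UniversalEnvelopingAlgebra.lift k ρ'
  have hΨ (x : g) : Ψ (UniversalEnvelopingAlgebra.ι k x) = op (ρ x) :=
    UniversalEnvelopingAlgebra.lift_ι_apply k ρ' x
  refine ⟨LinearMap.applyₗ v ∘ₗ (MulOpposite.opLinearEquiv k).symm.toLinearMap ∘ₗ Ψ.toLinearMap,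
    by simp, fun u x => ?_⟩
  simp only [LinearMap.comp_apply, AlgHom.toLinearMap_apply, map_mul, hΨ]
  rfl

end Enveloping

section Homogenized

variable (k g : Type u) [CommRing k] [LieRing g] [LieAlgebra k g]

/-- The relations of the homogenized enveloping algebra: the element `(1, 0)` of `k × g` is
the central variable `t`, and `x y = y x + t [x, y]` for `x, y` in `g`. -/
inductive HomogRel : TensorAlgebra k (k × g) → TensorAlgebra k (k × g) → Prop
  | comm (x : g) : HomogRel (TensorAlgebra.ι k (1, 0) * TensorAlgebra.ι k (0, x))
      (TensorAlgebra.ι k (0, x) * TensorAlgebra.ι k (1, 0))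
  | lie (x y : g) : HomogRel (TensorAlgebra.ι k (0, x) * TensorAlgebra.ι k (0, y))
      (TensorAlgebra.ι k (0, y) * TensorAlgebra.ι k (0, x) +
        TensorAlgebra.ι k (0, ⁅x, y⁆) * TensorAlgebra.ι k (1, 0))

/-- The homogenized enveloping algebra `A` of `g`, generated by `g` and a central variable `t` with
the relations `x y - y x = t [x, y]`. Its quotients by `t` and by `t - 1` are the symmetric
algebra and the enveloping algebra. Only its structure of a right module over itself is used, so
it is equipped with the instances of a module. -/
def HomogEnveloping : Type u := RingQuot (HomogRel k g)

variable {k g}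

namespace HomogEnveloping

noncomputable instance : AddCommGroup (HomogEnveloping k g) :=
  inferInstanceAs (AddCommGroup (RingQuot (HomogRel k g)))

noncomputable instance : Module k (HomogEnveloping k g) :=
  inferInstanceAs (Module k (RingQuot (HomogRel k g)))

noncomputable instance : One (HomogEnveloping k g) :=
  inferInstanceAs (One (RingQuot (HomogRel k g)))

/-- The generators of the homogenized enveloping algebra. -/
noncomputable def gen : k × g →ₗ[k] RingQuot (HomogRel k g) :=
  (RingQuot.mkAlgHom k (HomogRel k g)).toLinearMap ∘ₗ TensorAlgebra.ι k

theorem mul_gen_comm (x : g) (a : RingQuot (HomogRel k g)) :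
    a * gen (1, 0) * gen (0, x) = a * gen (0, x) * gen (1, 0) := by
  have h := RingQuot.mkAlgHom_rel k (HomogRel.comm (k := k) x)
  rw [map_mul, map_mul] at h
  rw [mul_assoc, mul_assoc]
  exact congrArg (a * ·) h

theorem mul_gen_lie (x y : g) (a : RingQuot (HomogRel k g)) :
    a * gen (0, y) * gen (0, x) = a * gen (0, x) * gen (0, y) -
      a * gen (0, ⁅x, y⁆) * gen (1, 0) := by
  have h := RingQuot.mkAlgHom_rel k (HomogRel.lie (k := k) x y)
  rw [map_add, map_mul, map_mul, map_mul] at h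
  simp only [mul_assoc, ← mul_sub]
  exact congrArg (a * ·) (eq_sub_of_add_eq h.symm)

variable (k g) in
/-- The operators of right multiplication by the elements of `g`. -/
noncomputable def act : g →ₗ[k] HomogEnveloping k g →ₗ[k] HomogEnveloping k g :=
  ((LinearMap.mul k (RingQuot (HomogRel k g))).flip ∘ₗ gen ∘ₗ LinearMap.inr k k g :)

variable (k g) in
/-- The operator of right multiplication by `t`. -/
noncomputable def mulT : HomogEnveloping k g →ₗ[k] HomogEnveloping k g :=
  ((LinearMap.mul k (RingQuot (HomogRel k g))).flip (gen (1, 0)) :)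

theorem isTwistedModule : IsTwistedModule (act k g) (mulT k g) where
  comm x a := mul_gen_comm x a
  lie x y a := mul_gen_lie x y a

theorem induction {p : HomogEnveloping k g → Prop} (add : ∀ a b, p a → p b → p (a + b))
    (smul : ∀ (c : k) a, p a → p (c • a)) (one : p 1) (act : ∀ x a, p a → p (act k g x a))
    (mulT : ∀ a, p a → p (mulT k g a)) (a : HomogEnveloping k g) : p a := by
  obtain ⟨a, rfl⟩ := RingQuot.mkAlgHom_surjective k (HomogRel k g) a
  have key (a : TensorAlgebra k (k × g)) : ∀ v : RingQuot (HomogRel k g),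
      p v → p (show RingQuot (HomogRel k g) from v * RingQuot.mkAlgHom k (HomogRel k g) a) := by
    induction a using TensorAlgebra.induction with
    | algebraMap r =>
      intro v hv
      rw [AlgHom.commutes, ← Algebra.commutes, ← Algebra.smul_def]
      exact smul r v hv
    | ι x =>
      intro v hv
      have h : x = x.1 • ((1 : k), (0 : g)) + (0, x.2) := by ext <;> simp
      rw [h, map_add, map_smul, map_add, map_smul, mul_add, mul_smul_comm]
      exact add _ _ (smul _ _ (mulT _ hv)) (act _ _ hv)
    | mul a b ha hb => exact fun v hv => by rw [map_mul, ← mul_assoc]; exact hb _ (ha _ hv)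
    | add a b ha hb => exact fun v hv => by rw [map_add, mul_add]; exact add _ _ (ha _ hv) (hb _ hv)
  have h := key a 1 one
  rwa [one_mul] at h

/-- The subalgebra generated by the central variable `t` is an image of `k[t]`. -/
theorem exists_const : ∃ cst : Polynomial k →ₗ[k] HomogEnveloping k g,
    cst 1 = 1 ∧ ∀ f, cst (f * Polynomial.X) = mulT k g (cst f) := by
  refine ⟨((Polynomial.aeval (R := k) (gen (1, 0) : RingQuot (HomogRel k g))).toLinearMap :),
    map_one (Polynomial.aeval (R := k) (gen (1, 0) : RingQuot (HomogRel k g))), fun f => ?_⟩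
  have h : Polynomial.aeval (R := k) (gen (1, 0) : RingQuot (HomogRel k g)) (f * Polynomial.X) =
      Polynomial.aeval (gen (1, 0)) f * gen (1, 0) := by rw [map_mul, Polynomial.aeval_X]
  exact h

theorem hom_ext {X : Type u} [AddCommGroup X] [Module k X] {f f' : HomogEnveloping k g →ₗ[k] X}
    (one : f 1 = f' 1) (act : ∀ x a, f a = f' a → f (act k g x a) = f' (act k g x a))
    (mulT : ∀ a, f a = f' a → f (mulT k g a) = f' (mulT k g a)) : f = f' := by
  refine LinearMap.ext fun a => ?_
  induction a using induction with
  | add a b ha hb => rw [map_add, map_add, ha, hb]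
  | smul c a ha => rw [map_smul, map_smul, ha]
  | one => exact one
  | act x a ha => exact act x a ha
  | mulT a ha => exact mulT a ha

/-- The homogenized enveloping algebra is the free twisted module on one generator. -/
theorem exists_map {X : Type u} [AddCommGroup X] [Module k X] {ρ : g →ₗ[k] X →ₗ[k] X}
    {τ : X →ₗ[k] X} (h : IsTwistedModule ρ τ) (v : X) :
    ∃ Φ : HomogEnveloping k g →ₗ[k] X, Φ 1 = v ∧ (∀ x a, Φ (act k g x a) = ρ x (Φ a)) ∧
      ∀ a, Φ (mulT k g a) = τ (Φ a) := by
  let j : k × g →ₗ[k] (Module.End k X)ᵐᵒᵖ :=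
    (MulOpposite.opLinearEquiv k).toLinearMap ∘ₗ
      LinearMap.coprod (LinearMap.toSpanSingleton k (Module.End k X) τ) ρ
  have j1 : j (1, 0) = op τ := by simp [j]
  have j2 (x : g) : j (0, x) = op (ρ x) := by simp [j]
  let Ψ : RingQuot (HomogRel k g) →ₐ[k] (Module.End k X)ᵐᵒᵖ :=
    RingQuot.liftAlgHom k ⟨TensorAlgebra.lift k j, by
      intro a b hab
      refine MulOpposite.unop_injective (LinearMap.ext fun m => ?_)
      cases hab with
      | comm x =>
        simp only [map_mul, TensorAlgebra.lift_ι_apply, j1, j2]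
        exact h.comm x m
      | lie x y =>
        simp only [map_mul, map_add, TensorAlgebra.lift_ι_apply, j1, j2]
        change ρ y (ρ x m) = ρ x (ρ y m) + τ (ρ ⁅x, y⁆ m)
        rw [h.lie x y, sub_add_cancel]⟩
  have hΨ (p : k × g) : Ψ (gen p) = j p := by
    simp only [Ψ, gen, LinearMap.comp_apply, AlgHom.toLinearMap_apply,
      RingQuot.liftAlgHom_mkAlgHom_apply, TensorAlgebra.lift_ι_apply]
  let Φ : RingQuot (HomogRel k g) →ₗ[k] X :=
    LinearMap.applyₗ v ∘ₗ (MulOpposite.opLinearEquiv k).symm.toLinearMap ∘ₗ Ψ.toLinearMap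
  have h1 : Φ 1 = v := by simp [Φ]
  have hΦ (a : RingQuot (HomogRel k g)) (p : k × g) :
      Φ (a * gen p) = (MulOpposite.unop (j p)) (Φ a) := by
    simp only [Φ, LinearMap.comp_apply, AlgHom.toLinearMap_apply, map_mul, hΨ]
    rfl
  refine ⟨Φ, h1, fun x a => (hΦ a (0, x)).trans ?_, fun a => (hΦ a (1, 0)).trans ?_⟩
  · rw [j2]
    rfl
  · rw [j1]
    rfl

/-- The shift `(u₀, u₁, …) ↦ (0, φ u₀, φ u₁, …)` of a sequence, followed by `φ`. -/
noncomputable def shift {X : Type u} [AddCommGroup X] [Module k X] :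
    (X →ₗ[k] X) →ₗ[k] (ℕ → X) →ₗ[k] (ℕ → X) where
  toFun φ := LinearMap.pi fun p => Nat.casesOn p 0 fun p => φ ∘ₗ LinearMap.proj p
  map_add' φ ψ := by
    refine LinearMap.ext fun u => funext fun p => ?_
    cases p <;> simp
  map_smul' c φ := by
    refine LinearMap.ext fun u => funext fun p => ?_
    cases p <;> simp

theorem shift_zero {X : Type u} [AddCommGroup X] [Module k X] (φ : X →ₗ[k] X) (u : ℕ → X) :
    shift φ u 0 = 0 := rfl

theorem shift_succ {X : Type u} [AddCommGroup X] [Module k X] (φ : X →ₗ[k] X) (u : ℕ → X) (p : ℕ) :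
    shift φ u (p + 1) = φ (u p) := rfl

open Filter in
/-- The truncations of the homogenized enveloping algebra to the weights less than `p`, where `t`
and the elements of `g` have weight one. The map `a ↦ (σ p a)ₚ` is obtained from the universal
property of `A`, applied to the sequences in `A` with the shifted operators. -/
theorem exists_truncation : ∃ σ : ℕ → HomogEnveloping k g →ₗ[k] HomogEnveloping k g,
    σ 0 = 0 ∧ (∀ p, σ (p + 1) 1 = 1) ∧ (∀ p x a, σ (p + 1) (act k g x a) = act k g x (σ p a)) ∧
      (∀ p a, σ (p + 1) (mulT k g a) = mulT k g (σ p a)) ∧ ∀ a, ∀ᶠ p in atTop, σ p a = a := by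
  have h : IsTwistedModule (M := ℕ → HomogEnveloping k g) (shift ∘ₗ act k g)
      (shift (mulT k g)) := by
    refine ⟨fun x u => funext fun p => ?_, fun x y u => funext fun p => ?_⟩
    · rcases p with _ | _ | p
      · rfl
      · simp [shift_succ, shift_zero]
      · exact isTwistedModule.comm x (u p)
    · rcases p with _ | _ | p
      · simp [shift_zero]
      · simp [shift_succ, shift_zero]
      · exact isTwistedModule.lie x y (u p)
  obtain ⟨Φ, h1, hρ, hτ⟩ := exists_map h (fun p => if p = 0 then 0 else 1)
  have hact (p x a) : Φ (act k g x a) (p + 1) = act k g x (Φ a p) := by rw [hρ]; rfl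
  have hmulT (p a) : Φ (mulT k g a) (p + 1) = mulT k g (Φ a p) := by rw [hτ]; rfl
  refine ⟨fun p => LinearMap.proj p ∘ₗ Φ, hom_ext ?_ (fun x a _ => ?_) (fun a _ => ?_),
    fun p => ?_, hact, hmulT, fun a => ?_⟩
  · simp [h1]
  · rw [LinearMap.comp_apply, hρ]; rfl
  · rw [LinearMap.comp_apply, hτ]; rfl
  · simp [h1]
  · induction a using induction with
    | add a b ha hb =>
      filter_upwards [ha, hb] with p ha hb
      rw [map_add, ha, hb]
    | smul c a ha =>
      filter_upwards [ha] with p ha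
      rw [map_smul, ha]
    | one =>
      filter_upwards [eventually_ne_atTop 0] with p hp
      simp [h1, hp]
    | act x a ha =>
      obtain ⟨n, hn⟩ := eventually_atTop.1 ha
      filter_upwards [eventually_ge_atTop (n + 1)] with p hp
      obtain ⟨p, rfl⟩ := Nat.exists_eq_add_of_le' (Nat.le_of_add_left_le hp)
      exact (hact p x a).trans (congrArg _ (hn p (by omega)))
    | mulT a ha =>
      obtain ⟨n, hn⟩ := eventually_atTop.1 ha
      filter_upwards [eventually_ge_atTop (n + 1)] with p hp
      obtain ⟨p, rfl⟩ := Nat.exists_eq_add_of_le' (Nat.le_of_add_left_le hp)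
      exact (hmulT p a).trans (congrArg _ (hn p (by omega)))

end HomogEnveloping

end Homogenized

/-! ### Presentations of the homogenized enveloping algebra -/

section Presentation

variable {k g : Type u} [CommRing k] [LieRing g] [LieAlgebra k g]

/-- If the projection to the cokernel of `r` factors through `p`, then `r` and `p` form an exact
sequence, which stays exact after tensoring with `V`, although `p` need not be surjective. -/
theorem rTensor_exact_of_comp_eq_mkQ {X Y Z : Type u} [AddCommGroup X] [Module k X]
    [AddCommGroup Y] [Module k Y] [AddCommGroup Z] [Module k Z] {r : X →ₗ[k] Y} {p : Y →ₗ[k] Z}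
    (hpr : p ∘ₗ r = 0) {j : Z →ₗ[k] Y ⧸ LinearMap.range r}
    (h : j ∘ₗ p = (LinearMap.range r).mkQ) (V : Type u) [AddCommGroup V] [Module k V] :
    Function.Exact (LinearMap.rTensor V r) (LinearMap.rTensor V p) := by
  have hex : Function.Exact r (LinearMap.range r).mkQ := LinearMap.exact_map_mkQ_range r
  intro y
  refine ⟨fun hy => ?_, ?_⟩
  · refine (rTensor_exact V hex (Submodule.mkQ_surjective _) y).1 ?_
    rw [← h, LinearMap.rTensor_comp_apply, hy, map_zero]
  · rintro ⟨x, rfl⟩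
    rw [← LinearMap.rTensor_comp_apply, hpr, LinearMap.rTensor_zero, LinearMap.zero_apply]

/-- The operators on the quotient of a module by an invariant submodule. -/
noncomputable def quotientAct {X : Type u} [AddCommGroup X] [Module k X] (ρ : g →ₗ[k] X →ₗ[k] X)
    (N : Submodule k X) (h : ∀ x, N ≤ N.comap (ρ x)) : g →ₗ[k] X ⧸ N →ₗ[k] X ⧸ N where
  toFun x := N.mapQ N (ρ x) (h x)
  map_add' x y := by
    refine Submodule.linearMap_qext _ (LinearMap.ext fun m => ?_)
    simp
  map_smul' c x := by
    refine Submodule.linearMap_qext _ (LinearMap.ext fun m => ?_)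
    simp

theorem quotientAct_mk {X : Type u} [AddCommGroup X] [Module k X] (ρ : g →ₗ[k] X →ₗ[k] X)
    (N : Submodule k X) (h : ∀ x, N ≤ N.comap (ρ x)) (x : g) (m : X) :
    quotientAct ρ N h x (N.mkQ m) = N.mkQ (ρ x m) := rfl

namespace HomogEnveloping

/-- The quotient of `A` by `t` is the symmetric algebra, since both have the same universal
property. -/
theorem exists_toSymmetric : ∃ π : HomogEnveloping k g →ₗ[k] SymmetricAlgebra k g, π 1 = 1 ∧
    (∀ x a, π (act k g x a) = symmetricAct k g x (π a)) ∧ (∀ a, π (mulT k g a) = 0) ∧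
    Function.Surjective π ∧ ∀ (V : Type u) [AddCommGroup V] [Module k V],
      Function.Exact (LinearMap.rTensor V (mulT k g)) (LinearMap.rTensor V π) := by
  obtain ⟨π, h1, hρ, hτ⟩ := exists_map (ρ := symmetricAct k g) (τ := 0)
    ⟨fun _ _ => by simp, fun x y m => by
      simp only [symmetricAct_apply, LinearMap.zero_apply, sub_zero]
      rw [mul_right_comm]⟩ 1
  refine ⟨π, h1, hρ, hτ, ?_, ?_⟩
  · have h : (LinearMap.range π).mkQ = 0 := by
      refine symmetricAlgebra_hom_ext ?_ (fun a x ha => ?_)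
      · exact (Submodule.Quotient.mk_eq_zero _).2 ⟨1, h1⟩
      · obtain ⟨b, rfl⟩ := (Submodule.Quotient.mk_eq_zero _).1 ha
        exact (Submodule.Quotient.mk_eq_zero _).2 ⟨_, hρ x b⟩
    rw [← LinearMap.range_eq_top, ← Submodule.ker_mkQ (LinearMap.range π), h, LinearMap.ker_zero]
  · have hN (x : g) :
        LinearMap.range (mulT k g) ≤ (LinearMap.range (mulT k g)).comap (act k g x) := by
      rintro _ ⟨a, rfl⟩
      exact ⟨act k g x a, (isTwistedModule.comm x a).symm⟩
    obtain ⟨j, j1, hj⟩ := exists_map_of_commuting (quotientAct (act k g) _ hN) (fun x y m => by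
      obtain ⟨a, rfl⟩ := Submodule.mkQ_surjective _ m
      simp only [quotientAct_mk, isTwistedModule.lie x y a, map_sub]
      rw [sub_eq_self]
      exact (Submodule.Quotient.mk_eq_zero _).2 ⟨_, rfl⟩) (Submodule.mkQ _ 1)
    have hj' (x : g) (s : SymmetricAlgebra k g) :
      j (symmetricAct k g x s) = quotientAct (act k g) _ hN x (j s) := hj s x
    refine rTensor_exact_of_comp_eq_mkQ (LinearMap.ext hτ) (j := j) (hom_ext ?_ ?_ ?_)
    · rw [LinearMap.comp_apply, h1, j1]
    · intro x a ha
      rw [LinearMap.comp_apply] at ha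
      rw [LinearMap.comp_apply, hρ, hj', ha, quotientAct_mk]
    · intro a _
      rw [LinearMap.comp_apply, hτ, LinearMap.zero_apply, map_zero]
      exact ((Submodule.Quotient.mk_eq_zero (LinearMap.range (mulT k g))).2 ⟨a, rfl⟩).symm

/-- The quotient of `A` by `t - 1` is the enveloping algebra, since both have the same universal
property. -/
theorem exists_toEnveloping : ∃ π : HomogEnveloping k g →ₗ[k] UniversalEnvelopingAlgebra k g,
    π 1 = 1 ∧ (∀ x a, π (act k g x a) = rAct k g _ x (π a)) ∧ (∀ a, π (mulT k g a) = π a) ∧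
    Function.Surjective π ∧ ∀ (V : Type u) [AddCommGroup V] [Module k V],
      Function.Exact (LinearMap.rTensor V (mulT k g - LinearMap.id)) (LinearMap.rTensor V π) := by
  obtain ⟨π, h1, hρ, hτ⟩ := exists_map (ρ := rAct k g (UniversalEnvelopingAlgebra k g))
    (τ := LinearMap.id) ⟨fun _ _ => rfl, fun x y m => rAct_rAct k g _ x y m⟩ 1
  refine ⟨π, h1, hρ, hτ, fun u => ?_, ?_⟩
  · induction u using universalEnveloping_induction with
    | add u v hu hv =>
      obtain ⟨⟨a, rfl⟩, ⟨b, rfl⟩⟩ := hu, hv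
      exact ⟨a + b, map_add _ _ _⟩
    | smul c u hu =>
      obtain ⟨a, rfl⟩ := hu
      exact ⟨c • a, map_smul _ _ _⟩
    | one => exact ⟨1, h1⟩
    | mul u x hu =>
      obtain ⟨a, rfl⟩ := hu
      exact ⟨_, hρ x a⟩
  · let N := LinearMap.range (mulT k g - LinearMap.id)
    have hN (x : g) : N ≤ N.comap (act k g x) := by
      rintro _ ⟨a, rfl⟩
      exact ⟨act k g x a, by simp [isTwistedModule.comm x a]⟩
    have hmk (a : HomogEnveloping k g) : N.mkQ (mulT k g a) = N.mkQ a := by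
      rw [← sub_eq_zero, ← map_sub]
      exact (Submodule.Quotient.mk_eq_zero _).2 ⟨_, rfl⟩
    obtain ⟨j, j1, hj⟩ := exists_map_universalEnveloping (ρ := quotientAct (act k g) _ hN)
      ⟨fun _ _ => rfl, fun x y m => by
        obtain ⟨a, rfl⟩ := Submodule.mkQ_surjective _ m
        simp only [quotientAct_mk, isTwistedModule.lie x y a, map_sub, hmk, LinearMap.id_apply]⟩
      (N.mkQ 1)
    have hj' (x : g) (s : UniversalEnvelopingAlgebra k g) :
      j (rAct k g _ x s) = quotientAct (act k g) _ hN x (j s) := hj s x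
    refine rTensor_exact_of_comp_eq_mkQ (LinearMap.ext fun a => ?_) (j := j) (hom_ext ?_ ?_ ?_)
    · rw [LinearMap.comp_apply, LinearMap.sub_apply, map_sub, hτ]
      exact sub_self (π a)
    · rw [LinearMap.comp_apply, h1, j1]
    · intro x a ha
      rw [LinearMap.comp_apply] at ha
      rw [LinearMap.comp_apply, hρ, hj', ha, quotientAct_mk]
    · intro a ha
      rw [LinearMap.comp_apply] at ha
      rw [LinearMap.comp_apply, hτ, LinearMap.id_apply, ha]
      exact (hmk a).symm

variable (k g) in
/-- The multiplication map `A ⊗ g → A`. -/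
noncomputable def mulMap : HomogEnveloping k g ⊗[k] g →ₗ[k] HomogEnveloping k g :=
  TensorProduct.lift (act k g).flip

theorem mulMap_tmul (a : HomogEnveloping k g) (x : g) : mulMap k g (a ⊗ₜ[k] x) = act k g x a := rfl

theorem mulMap_mulT (q : HomogEnveloping k g ⊗[k] g) :
    mulMap k g (LinearMap.rTensor g (mulT k g) q) = mulT k g (mulMap k g q) := by
  induction q with
  | zero => simp
  | tmul a x => simp only [LinearMap.rTensor_tmul, mulMap_tmul, isTwistedModule.comm]
  | add a b ha hb => simp only [map_add, ha, hb]

variable (k g) in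
/-- The relations `a x ⊗ y - a y ⊗ x - a t ⊗ [x, y]` between the generators `g` of
the augmentation ideal. -/
noncomputable def relMap :
    HomogEnveloping k g ⊗[k] (g ⊗[k] g) →ₗ[k] HomogEnveloping k g ⊗[k] g :=
  LinearMap.rTensor g (mulMap k g) ∘ₗ (TensorProduct.assoc k _ g g).symm.toLinearMap ∘ₗ
      (LinearMap.id - LinearMap.lTensor _ (TensorProduct.comm k g g).toLinearMap) -
    TensorProduct.map (mulT k g) (TensorProduct.lift (LinearMap.mk₂ k (fun x y : g => ⁅x, y⁆)
      add_lie smul_lie lie_add (fun c x y => lie_smul c x y)))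

theorem relMap_tmul (a : HomogEnveloping k g) (x y : g) :
    relMap k g (a ⊗ₜ[k] (x ⊗ₜ[k] y)) =
      act k g x a ⊗ₜ[k] y - act k g y a ⊗ₜ[k] x - mulT k g a ⊗ₜ[k] ⁅x, y⁆ := by
  simp [relMap, mulMap_tmul]

theorem mulMap_relMap : mulMap k g ∘ₗ relMap k g = 0 := by
  refine TensorProduct.ext (LinearMap.ext fun a => TensorProduct.ext' fun x y => ?_)
  change mulMap k g (relMap k g (a ⊗ₜ[k] (x ⊗ₜ[k] y))) = 0
  rw [relMap_tmul, map_sub, map_sub, mulMap_tmul, mulMap_tmul, mulMap_tmul,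
    isTwistedModule.lie y x a, isTwistedModule.comm, ← lie_skew x y, map_neg, LinearMap.neg_apply,
    map_neg]
  abel

/-- The augmentation ideal of the homogenized enveloping algebra is presented by the generators `g`
and the relations `x y - y x = t [x, y]`: the sequence `A ⊗ g ⊗ g → A ⊗ g → A → k[t]` is exact, and
remains so after tensoring with any module. Here `A` is the free twisted module on one generator,
and it is compared with an explicit twisted module built from the presentation. -/
theorem exists_augmentation : ∃ (aug : HomogEnveloping k g →ₗ[k] Polynomial k)
    (cst : Polynomial k →ₗ[k] HomogEnveloping k g),
    cst 1 = 1 ∧ (∀ f, cst (f * Polynomial.X) = mulT k g (cst f)) ∧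
    (∀ f, aug (cst f) = f) ∧
    (∀ x a, aug (act k g x a) = 0) ∧ (∀ a, aug (mulT k g a) = aug a * Polynomial.X) ∧
    ∀ (V : Type u) [AddCommGroup V] [Module k V],
      Function.Exact (LinearMap.rTensor V (relMap k g)) (LinearMap.rTensor V (mulMap k g)) ∧
      ∀ u, LinearMap.rTensor V aug u = 0 → ∃ w, LinearMap.rTensor V (mulMap k g) w = u := by
  obtain ⟨cst, cst1, hcst⟩ := exists_const (k := k) (g := g)
  let R := LinearMap.range (relMap k g)
  -- The module `X = k[t] × (A ⊗ g) / R` maps to `A` by `m`. The operators `ξ ↦ (0, m ξ ⊗ x)`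
  -- make it a twisted module, and the resulting map `A → X` is a section of `m`.
  let X := Polynomial k × ((HomogEnveloping k g ⊗[k] g) ⧸ R)
  let mQ : (HomogEnveloping k g ⊗[k] g) ⧸ R →ₗ[k] HomogEnveloping k g :=
    R.liftQ (mulMap k g) (by
      rintro _ ⟨s, rfl⟩
      exact LinearMap.congr_fun mulMap_relMap s)
  let m : X →ₗ[k] HomogEnveloping k g := LinearMap.coprod cst mQ
  have hm (p q) : m (p, R.mkQ q) = cst p + mulMap k g q := rfl
  let ρ : g →ₗ[k] X →ₗ[k] X :=
    ((TensorProduct.mk k _ g).flip.compr₂ (LinearMap.inr k (Polynomial k) _ ∘ₗ R.mkQ)).compl₂ m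
  have hρ (x ξ) : ρ x ξ = (0, R.mkQ (m ξ ⊗ₜ[k] x)) := rfl
  have hmρ (x ξ) : m (ρ x ξ) = act k g x (m ξ) := by
    rw [hρ, hm, map_zero, zero_add, mulMap_tmul]
  have hR : R ≤ R.comap (LinearMap.rTensor g (mulT k g)) := by
    rintro _ ⟨s, rfl⟩
    refine ⟨LinearMap.rTensor _ (mulT k g) s, ?_⟩
    have : relMap k g ∘ₗ LinearMap.rTensor _ (mulT k g) =
        LinearMap.rTensor g (mulT k g) ∘ₗ relMap k g := by
      refine TensorProduct.ext (LinearMap.ext fun a => TensorProduct.ext' fun x y => ?_)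
      change relMap k g (mulT k g a ⊗ₜ[k] (x ⊗ₜ[k] y)) =
        LinearMap.rTensor g (mulT k g) (relMap k g (a ⊗ₜ[k] (x ⊗ₜ[k] y)))
      simp only [relMap_tmul, map_sub, LinearMap.rTensor_tmul, isTwistedModule.comm]
    exact LinearMap.congr_fun this s
  let τ : X →ₗ[k] X := LinearMap.prodMap ((LinearMap.mul k _).flip Polynomial.X)
    (R.mapQ R (LinearMap.rTensor g (mulT k g)) hR)
  have hτ (p q) : τ (p, R.mkQ q) = (p * Polynomial.X, R.mkQ (LinearMap.rTensor g (mulT k g) q)) :=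
    rfl
  have hmτ (ξ : X) : m (τ ξ) = mulT k g (m ξ) := by
    obtain ⟨p, q⟩ := ξ
    obtain ⟨q, rfl⟩ := R.mkQ_surjective q
    rw [hτ, hm, hm, hcst, mulMap_mulT, map_add]
  have hX : IsTwistedModule ρ τ := by
    refine ⟨fun x ξ => ?_, fun x y ξ => ?_⟩
    · rw [hρ, hρ, hτ, hmτ, LinearMap.rTensor_tmul, zero_mul]
    · rw [hρ x, hρ y (ρ x ξ), hmρ, hmρ, hρ ⁅x, y⁆, hτ, LinearMap.rTensor_tmul, zero_mul]
      refine Prod.ext (sub_zero (0 : Polynomial k)).symm ?_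
      change R.mkQ _ = R.mkQ _ - R.mkQ _
      rw [← map_sub, ← sub_eq_zero, ← map_sub]
      refine (Submodule.Quotient.mk_eq_zero _).2 ⟨- (m ξ ⊗ₜ[k] (x ⊗ₜ[k] y)), ?_⟩
      rw [map_neg, relMap_tmul]
      abel
  obtain ⟨Φ, h1, hΦρ, hΦτ⟩ := exists_map hX (1, 0)
  have hmΦ : m ∘ₗ Φ = LinearMap.id := by
    refine hom_ext ?_ (fun x a ha => ?_) (fun a ha => ?_)
    · rw [LinearMap.comp_apply, h1]
      have h2 : m (1, R.mkQ 0) = cst 1 + mulMap k g 0 := hm 1 0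
      rw [map_zero, map_zero, add_zero] at h2
      exact h2.trans cst1
    · rw [LinearMap.comp_apply, LinearMap.id_apply] at *
      rw [hΦρ, hmρ, ha]
    · rw [LinearMap.comp_apply, LinearMap.id_apply] at *
      rw [hΦτ, hmτ, ha]
  have haug (a : HomogEnveloping k g) : (Φ (mulT k g a)).1 = (Φ a).1 * Polynomial.X := by
    rw [hΦτ]; rfl
  refine ⟨LinearMap.fst k _ _ ∘ₗ Φ, cst, cst1, hcst, fun f => ?_, fun x a => ?_, haug, ?_⟩
  · induction f using Polynomial.induction_on with
    | C a =>
      have : Polynomial.C a = a • (1 : Polynomial k) := by rw [Polynomial.smul_eq_C_mul, mul_one]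
      rw [this, map_smul, map_smul, cst1, LinearMap.comp_apply, h1]
      rfl
    | add p q hp hq => rw [map_add, map_add, hp, hq]
    | monomial n a h =>
      rw [pow_succ, ← mul_assoc, hcst]
      exact (haug _).trans (congrArg (· * Polynomial.X) h)
  · rw [LinearMap.comp_apply, hΦρ, hρ]
    rfl
  · intro V _ _
    have hj : (LinearMap.snd k _ _ ∘ₗ Φ) ∘ₗ mulMap k g = R.mkQ := by
      refine TensorProduct.ext' fun a x => ?_
      rw [LinearMap.comp_apply, mulMap_tmul, LinearMap.comp_apply, hΦρ, hρ,
        show m (Φ a) = a from LinearMap.congr_fun hmΦ a]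
      rfl
    refine ⟨rTensor_exact_of_comp_eq_mkQ mulMap_relMap hj V, fun u hu => ?_⟩
    have hsum : cst ∘ₗ LinearMap.fst k _ _ ∘ₗ Φ + mQ ∘ₗ LinearMap.snd k _ _ ∘ₗ Φ =
        LinearMap.id := by
      rw [← hmΦ]
      rfl
    obtain ⟨w, hw⟩ := LinearMap.rTensor_surjective V R.mkQ_surjective
      (LinearMap.rTensor V (LinearMap.snd k _ _ ∘ₗ Φ) u)
    refine ⟨w, ?_⟩
    have h2 : mulMap k g = mQ ∘ₗ R.mkQ := (R.liftQ_mkQ _ _).symm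
    rw [h2, LinearMap.rTensor_comp_apply, hw, ← LinearMap.rTensor_comp_apply]
    have h3 := congrArg (fun φ => LinearMap.rTensor V φ u) hsum
    simp only [LinearMap.rTensor_add, LinearMap.add_apply, LinearMap.rTensor_id,
      LinearMap.id_apply] at h3
    rw [LinearMap.rTensor_comp_apply V cst, hu, map_zero, zero_add] at h3
    exact h3

end HomogEnveloping

end Presentation

/-! ### The Chevalley-Eilenberg complex of the homogenized enveloping algebra -/

section Homogenized

variable {k g : Type u} [CommRing k] [LieRing g] [LieAlgebra k g]

theorem IsTwistedModule.tensor {A : Type u} [AddCommGroup A] [Module k A]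
    {ρ : g →ₗ[k] A →ₗ[k] A} {τ : A →ₗ[k] A} (h : IsTwistedModule ρ τ) (V : Type u)
    [AddCommGroup V] [Module k V] : IsTwistedModule (tensorAct ρ V) (LinearMap.rTensor V τ) where
  comm x m := by
    simp only [tensorAct_apply]
    induction m with
    | zero => simp
    | tmul a v => simp only [LinearMap.rTensor_tmul, h.comm]
    | add a b ha hb => simp only [map_add, ha, hb]
  lie x y m := by
    simp only [tensorAct_apply]
    induction m with
    | zero => simp
    | tmul a v => simp only [LinearMap.rTensor_tmul, h.lie x y, TensorProduct.sub_tmul]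
    | add a b ha hb => simp only [map_add, ha, hb]; abel

theorem rTensor_tensorAct {A B : Type u} [AddCommGroup A] [Module k A] [AddCommGroup B] [Module k B]
    {ρ : g →ₗ[k] A →ₗ[k] A} {ρ' : g →ₗ[k] B →ₗ[k] B} {φ φ' : A →ₗ[k] B}
    (h : ∀ x a, φ' (ρ x a) = ρ' x (φ a)) (V : Type u) [AddCommGroup V] [Module k V] (x : g)
    (m : A ⊗[k] V) :
    LinearMap.rTensor V φ' (tensorAct ρ V x m) = tensorAct ρ' V x (LinearMap.rTensor V φ m) := by
  simp only [tensorAct_apply]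
  induction m with
  | zero => simp
  | tmul a v => simp only [LinearMap.rTensor_tmul, h]
  | add a b ha hb => simp only [map_add, ha, hb]

theorem rTensor_rTensor_eq_zero_iff {A B : Type u} [AddCommGroup A] [Module k A] [AddCommGroup B]
    [Module k B] (f : A →ₗ[k] B) (V W : Type u) [AddCommGroup V] [Module k V] [AddCommGroup W]
    [Module k W] (t : (A ⊗[k] V) ⊗[k] W) :
    LinearMap.rTensor W (LinearMap.rTensor V f) t = 0 ↔
      LinearMap.rTensor (V ⊗[k] W) f (TensorProduct.assoc k A V W t) = 0 := by
  rw [LinearMap.rTensor_tensor]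
  simp

theorem exact_rTensor_rTensor {A B C : Type u} [AddCommGroup A] [Module k A] [AddCommGroup B]
    [Module k B] [AddCommGroup C] [Module k C] {f : A →ₗ[k] B} {f' : B →ₗ[k] C}
    (h : ∀ (V : Type u) [AddCommGroup V] [Module k V],
      Function.Exact (LinearMap.rTensor V f) (LinearMap.rTensor V f')) (V W : Type u)
    [AddCommGroup V] [Module k V] [AddCommGroup W] [Module k W] :
    Function.Exact (LinearMap.rTensor W (LinearMap.rTensor V f))
      (LinearMap.rTensor W (LinearMap.rTensor V f')) := by
  intro t
  rw [rTensor_rTensor_eq_zero_iff, h (V ⊗[k] W)]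
  rw [LinearMap.rTensor_tensor]
  constructor
  · rintro ⟨s, hs⟩
    exact ⟨(TensorProduct.assoc k A V W).symm s, (TensorProduct.assoc k B V W).injective hs⟩
  · rintro ⟨s, rfl⟩
    exact ⟨TensorProduct.assoc k A V W s, by simp⟩

/-- The endomorphism zero of `g` maps the Koszul complex to `1 ⊗ V ⊗ 1`. -/
theorem koszulMap_zero_eq (V : Type u) [AddCommGroup V] [Module k V]
    (t : (SymmetricAlgebra k g ⊗[k] V) ⊗[k] ExteriorAlgebra k g) :
    ∃ v : V, koszulMap V (0 : g →ₗ[k] g) t = ((1 : SymmetricAlgebra k g) ⊗ₜ[k] v) ⊗ₜ[k] 1 := by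
  induction t using tensorExterior_induction with
  | zero => exact ⟨0, by simp⟩
  | add a b ha hb =>
    obtain ⟨⟨v, hv⟩, ⟨w, hw⟩⟩ := ha, hb
    exact ⟨v + w, by rw [map_add, hv, hw, TensorProduct.tmul_add, TensorProduct.add_tmul]⟩
  | one m =>
    induction m with
    | zero => exact ⟨0, by simp⟩
    | tmul s v =>
      have hs : ∃ c : k, symmetricMap (0 : g →ₗ[k] g) s = algebraMap k _ c := by
        induction s using SymmetricAlgebra.induction with
        | algebraMap r => exact ⟨r, AlgHom.commutes _ _⟩
        | ι x => exact ⟨0, by simp [symmetricMap_ι]⟩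
        | mul a b ha hb =>
          obtain ⟨⟨c, hc⟩, ⟨d, hd⟩⟩ := ha, hb
          exact ⟨c * d, by rw [map_mul, map_mul, hc, hd]⟩
        | add a b ha hb =>
          obtain ⟨⟨c, hc⟩, ⟨d, hd⟩⟩ := ha, hb
          exact ⟨c + d, by rw [map_add, map_add, hc, hd]⟩
      obtain ⟨c, hc⟩ := hs
      refine ⟨c • v, ?_⟩
      rw [koszulMap, tensorExteriorMap_tmul, map_one, LinearMap.rTensor_tmul,
        AlgHom.toLinearMap_apply, hc, Algebra.algebraMap_eq_smul_one, TensorProduct.smul_tmul]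
    | add a b ha hb =>
      obtain ⟨⟨v, hv⟩, ⟨w, hw⟩⟩ := ha, hb
      exact ⟨v + w, by
        rw [TensorProduct.add_tmul, map_add, hv, hw, TensorProduct.tmul_add,
          TensorProduct.add_tmul]⟩
  | wedge x t _ =>
    refine ⟨0, ?_⟩
    rw [koszulMap, tensorExteriorMap_wedge, LinearMap.zero_apply, wedge_zero]
    simp

namespace HomogEnveloping

open Filter

variable (k g) in
/-- The projection of the homogenized enveloping algebra to the symmetric algebra. -/
noncomputable def toSymmetric : HomogEnveloping k g →ₗ[k] SymmetricAlgebra k g :=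
  exists_toSymmetric.choose

theorem toSymmetric_one : toSymmetric k g 1 = 1 := exists_toSymmetric.choose_spec.1

theorem toSymmetric_act (x : g) (a : HomogEnveloping k g) :
    toSymmetric k g (act k g x a) = symmetricAct k g x (toSymmetric k g a) :=
  exists_toSymmetric.choose_spec.2.1 x a

theorem toSymmetric_surjective : Function.Surjective (toSymmetric k g) :=
  exists_toSymmetric.choose_spec.2.2.2.1

theorem exact_toSymmetric (V : Type u) [AddCommGroup V] [Module k V] :
    Function.Exact (LinearMap.rTensor V (mulT k g)) (LinearMap.rTensor V (toSymmetric k g)) :=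
  exists_toSymmetric.choose_spec.2.2.2.2 V

variable (k g) in
/-- The truncations of the homogenized enveloping algebra to the weights less than `p`. -/
noncomputable def trunc : ℕ → HomogEnveloping k g →ₗ[k] HomogEnveloping k g :=
  exists_truncation.choose

theorem trunc_zero : trunc k g 0 = 0 := exists_truncation.choose_spec.1

theorem trunc_succ_one (p : ℕ) : trunc k g (p + 1) 1 = 1 := exists_truncation.choose_spec.2.1 p

theorem trunc_succ_act (p : ℕ) (x : g) (a : HomogEnveloping k g) :
    trunc k g (p + 1) (act k g x a) = act k g x (trunc k g p a) :=
  exists_truncation.choose_spec.2.2.1 p x a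

theorem trunc_succ_mulT (p : ℕ) (a : HomogEnveloping k g) :
    trunc k g (p + 1) (mulT k g a) = mulT k g (trunc k g p a) :=
  exists_truncation.choose_spec.2.2.2.1 p a

theorem eventually_trunc (a : HomogEnveloping k g) : ∀ᶠ p in atTop, trunc k g p a = a :=
  exists_truncation.choose_spec.2.2.2.2 a

variable (k g) in
/-- The augmentation `A → k[t]`. -/
noncomputable def aug : HomogEnveloping k g →ₗ[k] Polynomial k := exists_augmentation.choose

variable (k g) in
/-- The inclusion `k[t] → A`. -/
noncomputable def cst : Polynomial k →ₗ[k] HomogEnveloping k g :=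
  exists_augmentation.choose_spec.choose

theorem cst_one : cst k g 1 = 1 := exists_augmentation.choose_spec.choose_spec.1

theorem cst_mul_X (f : Polynomial k) : cst k g (f * Polynomial.X) = mulT k g (cst k g f) :=
  exists_augmentation.choose_spec.choose_spec.2.1 f

theorem aug_act (x : g) (a : HomogEnveloping k g) : aug k g (act k g x a) = 0 :=
  exists_augmentation.choose_spec.choose_spec.2.2.2.1 x a

theorem aug_cst (f : Polynomial k) : aug k g (cst k g f) = f :=
  exists_augmentation.choose_spec.choose_spec.2.2.1 f

theorem aug_mulT (a : HomogEnveloping k g) : aug k g (mulT k g a) = aug k g a * Polynomial.X :=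
  exists_augmentation.choose_spec.choose_spec.2.2.2.2.1 a

variable (V : Type u) [AddCommGroup V] [Module k V]

theorem exact_relMap :
    Function.Exact (LinearMap.rTensor V (relMap k g)) (LinearMap.rTensor V (mulMap k g)) :=
  (exists_augmentation.choose_spec.choose_spec.2.2.2.2.2 V).1

theorem exists_mulMap_of_aug_eq_zero {u : HomogEnveloping k g ⊗[k] V}
    (hu : LinearMap.rTensor V (aug k g) u = 0) :
    ∃ w, LinearMap.rTensor V (mulMap k g) w = u :=
  (exists_augmentation.choose_spec.choose_spec.2.2.2.2.2 V).2 u hu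

/-- The Chevalley-Eilenberg complex of `A ⊗ V`. -/
abbrev Cx (k g V : Type u) [CommRing k] [LieRing g] [LieAlgebra k g] [AddCommGroup V]
    [Module k V] : Type u := (HomogEnveloping k g ⊗[k] V) ⊗[k] ExteriorAlgebra k g

variable (k g) in
/-- The Chevalley-Eilenberg differential of `A ⊗ V`. -/
noncomputable def diff : Cx k g V →ₗ[k] Cx k g V :=
  twistedD (tensorAct (act k g) V) (LinearMap.rTensor V (mulT k g))

variable (k g) in
/-- Multiplication by `t` on the Chevalley-Eilenberg complex of `A ⊗ V`. -/
noncomputable def mulTCx : Cx k g V →ₗ[k] Cx k g V :=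
  LinearMap.rTensor _ (LinearMap.rTensor V (mulT k g))

variable (k g) in
/-- The truncation of the Chevalley-Eilenberg complex of `A ⊗ V`. -/
noncomputable def truncCx (p : ℕ) : Cx k g V →ₗ[k] Cx k g V :=
  LinearMap.rTensor _ (LinearMap.rTensor V (trunc k g p))

variable (k g) in
/-- The map from the Chevalley-Eilenberg complex of `A ⊗ V` to the Koszul complex. -/
noncomputable def toKoszul :
    Cx k g V →ₗ[k] (SymmetricAlgebra k g ⊗[k] V) ⊗[k] ExteriorAlgebra k g :=
  LinearMap.rTensor _ (LinearMap.rTensor V (toSymmetric k g))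

variable {V}

theorem diff_diff (t : Cx k g V) : diff k g V (diff k g V t) = 0 :=
  (isTwistedModule.tensor V).twistedD_twistedD t

theorem diff_mulTCx (t : Cx k g V) :
    diff k g V (mulTCx k g V t) = mulTCx k g V (diff k g V t) :=
  (isTwistedModule.tensor V).twistedD_rTensor t

theorem truncCx_diff (p : ℕ) (t : Cx k g V) :
    truncCx k g V (p + 1) (diff k g V t) = diff k g V (truncCx k g V p t) := by
  refine rTensor_twistedD (rTensor_tensorAct (fun x a => trunc_succ_act p x a) V)
    (fun m => ?_) t
  rw [← LinearMap.rTensor_comp_apply, ← LinearMap.rTensor_comp_apply]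
  congr 2
  exact LinearMap.ext fun a => trunc_succ_mulT p a

theorem truncCx_mulTCx (p : ℕ) (t : Cx k g V) :
    truncCx k g V (p + 1) (mulTCx k g V t) = mulTCx k g V (truncCx k g V p t) := by
  rw [truncCx, mulTCx, truncCx, ← LinearMap.rTensor_comp_apply, ← LinearMap.rTensor_comp_apply,
    ← LinearMap.rTensor_comp, ← LinearMap.rTensor_comp]
  congr 3
  exact LinearMap.ext fun a => trunc_succ_mulT p a

theorem toKoszul_mulTCx (t : Cx k g V) : toKoszul k g V (mulTCx k g V t) = 0 :=
  (exact_rTensor_rTensor exact_toSymmetric V _ _).2 ⟨t, rfl⟩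

theorem exists_mulTCx_of_toKoszul_eq_zero {t : Cx k g V} (h : toKoszul k g V t = 0) :
    ∃ s, mulTCx k g V s = t :=
  (exact_rTensor_rTensor exact_toSymmetric V _ _).1 h

theorem toKoszul_diff (t : Cx k g V) :
    toKoszul k g V (diff k g V t) =
      koszulD (tensorAct (symmetricAct k g) V) (toKoszul k g V t) := by
  rw [← twistedD_zero]
  refine rTensor_twistedD (rTensor_tensorAct (fun x a => toSymmetric_act x a) V)
    (fun m => ?_) t
  rw [LinearMap.zero_apply]
  exact (exact_toSymmetric V _).2 ⟨m, rfl⟩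

theorem toKoszul_surjective : Function.Surjective (toKoszul k g V) :=
  LinearMap.rTensor_surjective _ (LinearMap.rTensor_surjective _ toSymmetric_surjective)

theorem eventually_trunc_tensor (m : HomogEnveloping k g ⊗[k] V) :
    ∀ᶠ p in atTop, LinearMap.rTensor V (trunc k g p) m = m := by
  induction m with
  | zero => simp
  | tmul a v => filter_upwards [eventually_trunc a] with p hp; rw [LinearMap.rTensor_tmul, hp]
  | add a b ha hb => filter_upwards [ha, hb] with p h h'; rw [map_add, h, h']

theorem eventually_truncCx (t : (HomogEnveloping k g ⊗[k] V) ⊗[k] ExteriorAlgebra k g) :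
    ∀ᶠ p in atTop, truncCx k g V p t = t := by
  induction t with
  | zero => simp
  | tmul a v =>
    filter_upwards [eventually_trunc_tensor a] with p hp
    rw [truncCx, LinearMap.rTensor_tmul, hp]
  | add a b ha hb => filter_upwards [ha, hb] with p h h'; rw [map_add, h, h']

variable (V) in
/-- The map `a ⊗ x ⊗ v ↦ (a ⊗ v) ⊗ x` to the elements of exterior degree one. -/
noncomputable def degOne : (HomogEnveloping k g ⊗[k] g) ⊗[k] V →ₗ[k] Cx k g V :=
  LinearMap.lTensor _ (ExteriorAlgebra.ι k) ∘ₗ (TensorProduct.rightComm k _ g V).toLinearMap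

theorem degOne_tmul (a : HomogEnveloping k g) (x : g) (v : V) :
    degOne V ((a ⊗ₜ[k] x) ⊗ₜ[k] v) = wedge k _ x ((a ⊗ₜ[k] v) ⊗ₜ[k] 1) := by
  simp [degOne, wedge_tmul]

theorem diff_degOne (w : (HomogEnveloping k g ⊗[k] g) ⊗[k] V) :
    diff k g V (degOne V w) = LinearMap.rTensor V (mulMap k g) w ⊗ₜ[k] 1 := by
  induction w with
  | zero => simp
  | tmul q v =>
    induction q with
    | zero => simp
    | tmul a x =>
      rw [degOne_tmul, diff, twistedD_wedge, twistedD_one, twistedAct_tmul, lieDer_one]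
      simp [tensorAct_apply, mulMap_tmul]
    | add a b ha hb => simp only [TensorProduct.add_tmul, map_add, ha, hb]
  | add a b ha hb => simp only [TensorProduct.add_tmul, map_add, ha, hb]

theorem degOne_mulT (w : (HomogEnveloping k g ⊗[k] g) ⊗[k] V) :
    degOne V (LinearMap.rTensor V (LinearMap.rTensor g (mulT k g)) w) =
      mulTCx k g V (degOne V w) := by
  have : degOne V ∘ₗ LinearMap.rTensor V (LinearMap.rTensor g (mulT k g)) =
      mulTCx k g V ∘ₗ degOne V := by
    refine TensorProduct.ext_threefold fun a x v => ?_
    rfl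
  exact LinearMap.congr_fun this w

/-- The relations between the generators of the augmentation ideal are boundaries of elements
of exterior degree two. -/
theorem exists_degTwo (s : (HomogEnveloping k g ⊗[k] (g ⊗[k] g)) ⊗[k] V) :
    ∃ t : Cx k g V, diff k g V t = degOne V (LinearMap.rTensor V (relMap k g) s) ∧
      koszulMap V (0 : g →ₗ[k] g) (toKoszul k g V t) = 0 := by
  induction s with
  | zero => exact ⟨0, by simp⟩
  | tmul q v =>
    induction q with
    | zero => exact ⟨0, by simp⟩
    | tmul a r =>
      induction r with
      | zero => exact ⟨0, by simp⟩
      | tmul x y =>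
        refine ⟨wedge k _ x (wedge k _ y ((a ⊗ₜ[k] v) ⊗ₜ[k] 1)), ?_, ?_⟩
        · rw [LinearMap.rTensor_tmul, relMap_tmul, TensorProduct.sub_tmul, TensorProduct.sub_tmul,
            map_sub, map_sub, degOne_tmul, degOne_tmul, degOne_tmul, diff, twistedD_wedge,
            twistedD_wedge, twistedAct_wedge, twistedD_one, map_zero, sub_zero, twistedAct_tmul,
            twistedAct_tmul, lieDer_one, lieDer_one, TensorProduct.tmul_zero, sub_zero, sub_zero]
          exact sub_right_comm _ _ _
        · rw [toKoszul, rTensor_wedge, koszulMap, tensorExteriorMap_wedge, LinearMap.zero_apply,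
            wedge_zero, LinearMap.zero_apply]
      | add a b ha hb =>
        obtain ⟨⟨t, h1, h2⟩, ⟨t', h1', h2'⟩⟩ := ha, hb
        refine ⟨t + t', ?_, by rw [map_add, map_add, h2, h2', add_zero]⟩
        simp only [TensorProduct.add_tmul, TensorProduct.tmul_add, map_add, h1, h1']
    | add a b ha hb =>
      obtain ⟨⟨t, h1, h2⟩, ⟨t', h1', h2'⟩⟩ := ha, hb
      refine ⟨t + t', ?_, by rw [map_add, map_add, h2, h2', add_zero]⟩
      simp only [TensorProduct.add_tmul, map_add, h1, h1']
  | add a b ha hb =>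
    obtain ⟨⟨t, h1, h2⟩, ⟨t', h1', h2'⟩⟩ := ha, hb
    refine ⟨t + t', ?_, by rw [map_add, map_add, h2, h2', add_zero]⟩
    simp only [map_add, h1, h1']

theorem rTensor_mul_X_injective {f : Polynomial k ⊗[k] V}
    (h : LinearMap.rTensor V ((LinearMap.mul k (Polynomial k)).flip Polynomial.X) f = 0) :
    f = 0 := by
  let d : Polynomial k →ₗ[k] Polynomial k :=
    { toFun := Polynomial.divX
      map_add' := fun p q => Polynomial.divX_add
      map_smul' := fun c p => by
        rw [Polynomial.smul_eq_C_mul, Polynomial.divX_C_mul, RingHom.id_apply,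
          Polynomial.smul_eq_C_mul] }
  have hd' (p : Polynomial k) : d p = p.divX := rfl
  have hd : d ∘ₗ (LinearMap.mul k (Polynomial k)).flip Polynomial.X = LinearMap.id := by
    refine LinearMap.ext fun p => Polynomial.ext fun n => ?_
    rw [LinearMap.comp_apply, LinearMap.flip_apply, LinearMap.mul_apply', hd', LinearMap.id_apply,
      Polynomial.coeff_divX, Polynomial.coeff_mul_X]
  have h2 := congrArg (LinearMap.rTensor V d) h
  rwa [← LinearMap.rTensor_comp_apply, hd, LinearMap.rTensor_id, LinearMap.id_apply,
    map_zero] at h2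

/-- An element of `A ⊗ V` annihilated by `t` vanishes in every weight. The induction on the weight
uses the exactness of the Koszul complex in exterior degree two and passes from `V` to
`V ⊗ Λ g`. That `A` has no `t`-torsion substitutes for the Poincaré-Birkhoff-Witt theorem. -/
theorem trunc_eq_zero_of_mulT_eq_zero (hK : IsKoszul k g) (p : ℕ) :
    ∀ (V : Type u) [AddCommGroup V] [Module k V] (u : HomogEnveloping k g ⊗[k] V),
      LinearMap.rTensor V (mulT k g) u = 0 → LinearMap.rTensor V (trunc k g p) u = 0 := by
  induction p with
  | zero => intro V _ _ u _; rw [trunc_zero, LinearMap.rTensor_zero, LinearMap.zero_apply]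
  | succ p ih =>
    intro V _ _ u hu
    have ihCx (t : Cx k g V) (ht : mulTCx k g V t = 0) : truncCx k g V p t = 0 := by
      rw [mulTCx, rTensor_rTensor_eq_zero_iff] at ht
      rw [truncCx, rTensor_rTensor_eq_zero_iff]
      exact ih _ _ ht
    -- As `t` is injective on `k[t] ⊗ V`, the element `u` is in the augmentation ideal.
    have haug : LinearMap.rTensor V (aug k g) u = 0 := by
      refine rTensor_mul_X_injective ?_
      have h : (LinearMap.mul k (Polynomial k)).flip Polynomial.X ∘ₗ aug k g =
          aug k g ∘ₗ mulT k g := LinearMap.ext fun a => (aug_mulT a).symm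
      rw [← LinearMap.rTensor_comp_apply, h, LinearMap.rTensor_comp_apply, hu, map_zero]
    obtain ⟨w, rfl⟩ := exists_mulMap_of_aug_eq_zero V haug
    have hw : LinearMap.rTensor V (mulMap k g)
        (LinearMap.rTensor V (LinearMap.rTensor g (mulT k g)) w) = 0 := by
      have h : mulMap k g ∘ₗ LinearMap.rTensor g (mulT k g) = mulT k g ∘ₗ mulMap k g :=
        LinearMap.ext mulMap_mulT
      rw [← LinearMap.rTensor_comp_apply, h, LinearMap.rTensor_comp_apply, hu]
    -- Write `u` as the boundary of `w`. The equation `t u = 0` is a consequence of the relations,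
    -- so `t w` is the boundary of some `T` of exterior degree two.
    obtain ⟨s, hs⟩ := (exact_relMap V _).1 hw
    obtain ⟨T, hT, hT0⟩ := exists_degTwo s
    rw [hs, degOne_mulT] at hT
    -- The image of `T` in the Koszul complex is a cycle, hence a boundary, so that `T` is
    -- the sum of a boundary and of a multiple `t e`.
    obtain ⟨z', hz'⟩ := hK V (toKoszul k g V T) (by rw [← toKoszul_diff, hT, toKoszul_mulTCx])
    obtain ⟨z, rfl⟩ := toKoszul_surjective z'
    rw [hT0, zero_add, ← toKoszul_diff] at hz'
    obtain ⟨e, he⟩ := exists_mulTCx_of_toKoszul_eq_zero (t := T - diff k g V z)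
      (by rw [map_sub, hz', sub_self])
    -- Then `t` annihilates `w - ∂ e`, to which the induction hypothesis applies, and `∂ w = u`.
    have hkill : mulTCx k g V (degOne V w - diff k g V e) = 0 := by
      rw [map_sub, ← diff_mulTCx, he, map_sub, diff_diff, sub_zero, hT, sub_self]
    have h0 := ihCx _ hkill
    rw [map_sub, sub_eq_zero] at h0
    refine tmul_one_injective (k := k) (G := g) ?_
    have h1 : truncCx k g V (p + 1) (diff k g V (degOne V w)) = 0 := by
      rw [truncCx_diff, h0, ← truncCx_diff, diff_diff, map_zero]
    rw [diff_degOne] at h1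
    exact h1.trans (TensorProduct.zero_tmul _ _).symm

theorem eq_zero_of_mulTCx_eq_zero (hK : IsKoszul k g) {t : Cx k g V}
    (ht : mulTCx k g V t = 0) : t = 0 := by
  obtain ⟨p, hp⟩ := (eventually_truncCx t).exists
  rw [← hp, truncCx, rTensor_rTensor_eq_zero_iff]
  rw [mulTCx, rTensor_rTensor_eq_zero_iff] at ht
  exact trunc_eq_zero_of_mulT_eq_zero hK p _ _ ht

/-- Multiplication by `t` raises the weight, so it has no fixed points. -/
theorem eq_zero_of_mulTCx_eq_self {t : Cx k g V} (ht : mulTCx k g V t = t) : t = 0 := by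
  have h (p : ℕ) : truncCx k g V p t = 0 := by
    induction p with
    | zero => rw [truncCx, trunc_zero, LinearMap.rTensor_zero, LinearMap.rTensor_zero,
        LinearMap.zero_apply]
    | succ p ih => rw [← ht, truncCx_mulTCx, ih, map_zero]
  obtain ⟨p, hp⟩ := (eventually_truncCx t).exists
  rw [← hp, h]

/-- A cycle maps to a cycle of the Koszul complex, so it is, up to boundaries and elements `1 ⊗ v`,
a multiple `t e` of a cycle `e`. Iterating this reduces a cycle to an element of `k[t] ⊗ V`, in
any finite range of weights. -/
theorem exists_truncCx_eq_diff (hK : IsKoszul k g) (p : ℕ) :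
    ∀ c : Cx k g V, diff k g V c = 0 → ∃ (z : Cx k g V) (f : Polynomial k ⊗[k] V),
      truncCx k g V p c = diff k g V z + LinearMap.rTensor V (cst k g) f ⊗ₜ[k] 1 := by
  induction p with
  | zero =>
    intro c _
    refine ⟨0, 0, ?_⟩
    rw [truncCx, trunc_zero, LinearMap.rTensor_zero, LinearMap.rTensor_zero]
    simp
  | succ p ih =>
    intro c hc
    obtain ⟨z', hz'⟩ := hK V (toKoszul k g V c) (by rw [← toKoszul_diff, hc, map_zero])
    obtain ⟨z, rfl⟩ := toKoszul_surjective z'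
    obtain ⟨v, hv⟩ := koszulMap_zero_eq V (toKoszul k g V c)
    have hv' : ((1 : SymmetricAlgebra k g) ⊗ₜ[k] v) ⊗ₜ[k] 1 =
        toKoszul k g V (((1 : HomogEnveloping k g) ⊗ₜ[k] v) ⊗ₜ[k] 1) := by
      rw [toKoszul, LinearMap.rTensor_tmul, LinearMap.rTensor_tmul, toSymmetric_one]
    rw [hv, hv', ← toKoszul_diff, ← map_add] at hz'
    obtain ⟨e, he⟩ := exists_mulTCx_of_toKoszul_eq_zero
      ((map_sub (toKoszul k g V) _ _).trans (sub_eq_zero.2 hz'))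
    have hDe : diff k g V e = 0 := by
      refine eq_zero_of_mulTCx_eq_zero hK ?_
      rw [← diff_mulTCx, he, map_sub, map_add, hc, diff_diff, diff, twistedD_one, add_zero,
        sub_zero]
    obtain ⟨z₁, f, hf⟩ := ih e hDe
    refine ⟨truncCx k g V p z + mulTCx k g V z₁,
      1 ⊗ₜ[k] v + LinearMap.rTensor V ((LinearMap.mul k (Polynomial k)).flip Polynomial.X) f, ?_⟩
    have hX : cst k g ∘ₗ (LinearMap.mul k (Polynomial k)).flip Polynomial.X =
        mulT k g ∘ₗ cst k g := LinearMap.ext cst_mul_X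
    have h1 : truncCx k g V (p + 1) (((1 : HomogEnveloping k g) ⊗ₜ[k] v) ⊗ₜ[k] 1) =
        LinearMap.rTensor V (cst k g) (1 ⊗ₜ[k] v) ⊗ₜ[k] 1 := by
      rw [truncCx, LinearMap.rTensor_tmul, LinearMap.rTensor_tmul, trunc_succ_one,
        LinearMap.rTensor_tmul, cst_one]
    have h2 : mulTCx k g V (LinearMap.rTensor V (cst k g) f ⊗ₜ[k] 1) =
        LinearMap.rTensor V (cst k g) (LinearMap.rTensor V
          ((LinearMap.mul k (Polynomial k)).flip Polynomial.X) f) ⊗ₜ[k] 1 := by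
      rw [← LinearMap.rTensor_comp_apply, hX, LinearMap.rTensor_comp_apply]
      rfl
    rw [sub_eq_iff_eq_add.1 he.symm, map_add, map_add, truncCx_mulTCx, truncCx_diff, hf, map_add,
      ← diff_mulTCx, h1, h2, map_add (diff k g V), map_add (LinearMap.rTensor V (cst k g)),
      TensorProduct.add_tmul]
    abel

/-- The homology of the Chevalley-Eilenberg complex of `A ⊗ V` is represented by `k[t] ⊗ V`. -/
theorem exists_eq_diff (hK : IsKoszul k g) {c : Cx k g V} (hc : diff k g V c = 0) :
    ∃ (z : Cx k g V) (f : Polynomial k ⊗[k] V),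
      c = diff k g V z + LinearMap.rTensor V (cst k g) f ⊗ₜ[k] 1 := by
  obtain ⟨p, hp⟩ := (eventually_truncCx c).exists
  rw [← hp]
  exact exists_truncCx_eq_diff hK p c hc

theorem algebraMapInv_lieDer (ω : ExteriorAlgebra k g) (x : g) :
    ExteriorAlgebra.algebraMapInv (lieDer k g ω x) = 0 := by
  induction ω using CliffordAlgebra.left_induction with
  | algebraMap r =>
    have : algebraMap k (ExteriorAlgebra k g) r = r • 1 := Algebra.algebraMap_eq_smul_one r
    erw [this]
    rw [map_smul, LinearMap.smul_apply, lieDer_one, smul_zero, map_zero]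
  | add a b ha hb => rw [map_add, LinearMap.add_apply, map_add, ha, hb, add_zero]
  | ι_mul ω y h =>
    erw [lieDer_ι_mul]
    rw [map_add, map_mul, map_mul, h]
    simp [ExteriorAlgebra.algebraMapInv]

variable (k g V) in
/-- The augmentation `A ⊗ V ⊗ Λ g → k[t] ⊗ V`. -/
noncomputable def augCx : Cx k g V →ₗ[k] Polynomial k ⊗[k] V :=
  (TensorProduct.rid k _).toLinearMap ∘ₗ TensorProduct.map (LinearMap.rTensor V (aug k g))
    (ExteriorAlgebra.algebraMapInv (R := k) (M := g)).toLinearMap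

theorem augCx_tmul (m : HomogEnveloping k g ⊗[k] V) (ω : ExteriorAlgebra k g) :
    augCx k g V (m ⊗ₜ[k] ω) =
      ExteriorAlgebra.algebraMapInv ω • LinearMap.rTensor V (aug k g) m := by
  simp [augCx]

theorem augCx_wedge (x : g) (t : (HomogEnveloping k g ⊗[k] V) ⊗[k] ExteriorAlgebra k g) :
    augCx k g V (wedge k _ x t) = 0 := by
  induction t with
  | zero => simp
  | tmul m ω => simp [wedge_tmul, augCx_tmul, ExteriorAlgebra.algebraMapInv]
  | add a b ha hb => simp only [map_add, ha, hb, add_zero]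

theorem augCx_diff (t : Cx k g V) : augCx k g V (diff k g V t) = 0 := by
  have haug (x : g) (m : HomogEnveloping k g ⊗[k] V) :
      LinearMap.rTensor V (aug k g) (tensorAct (act k g) V x m) = 0 := by
    have h : aug k g ∘ₗ act k g x = 0 := LinearMap.ext fun a => aug_act x a
    rw [tensorAct_apply, ← LinearMap.rTensor_comp_apply, h, LinearMap.rTensor_zero,
      LinearMap.zero_apply]
  induction t using tensorExterior_induction with
  | zero => simp
  | add a b ha hb => simp only [map_add, ha, hb, add_zero]
  | one m => rw [diff, twistedD_one, map_zero]
  | wedge x t h =>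
    clear h
    rw [diff, twistedD_wedge, map_sub, augCx_wedge, sub_zero]
    induction t with
    | zero => simp
    | tmul m ω =>
      rw [twistedAct_tmul, map_sub, augCx_tmul, augCx_tmul, haug, algebraMapInv_lieDer]
      simp
    | add a b ha hb => simp only [map_add, ha, hb, add_zero]

end HomogEnveloping

open HomogEnveloping in
/-- The Chevalley-Eilenberg complex of `U ⊗ V` is a resolution of `V`. A cycle is lifted along
`A → U`; its boundary is a multiple of `t - 1`, and can be corrected because the homology
of `A ⊗ V ⊗ Λ g` is `k[t] ⊗ V`, on which `t - 1` is injective. -/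
theorem exists_eq_twistedD (hK : IsKoszul k g) {V : Type u} [AddCommGroup V] [Module k V]
    {c : (UniversalEnvelopingAlgebra k g ⊗[k] V) ⊗[k] ExteriorAlgebra k g}
    (hc : twistedD (tensorAct (rAct k g (UniversalEnvelopingAlgebra k g)) V) LinearMap.id c = 0) :
    ∃ z v, c = twistedD (tensorAct (rAct k g (UniversalEnvelopingAlgebra k g)) V) LinearMap.id z +
      ((1 : UniversalEnvelopingAlgebra k g) ⊗ₜ[k] v) ⊗ₜ[k] 1 := by
  obtain ⟨π, π1, πρ, πτ, πs, hex⟩ := exists_toEnveloping (k := k) (g := g)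
  let pr : Cx k g V →ₗ[k] _ :=
    LinearMap.rTensor (ExteriorAlgebra k g) (LinearMap.rTensor V π)
  have hpr : Function.Surjective pr :=
    LinearMap.rTensor_surjective _ (LinearMap.rTensor_surjective _ πs)
  have hprD (t : Cx k g V) : pr (diff k g V t) =
      twistedD (tensorAct (rAct k g (UniversalEnvelopingAlgebra k g)) V) LinearMap.id (pr t) := by
    refine rTensor_twistedD (rTensor_tensorAct πρ V) (fun m => ?_) t
    have h : π ∘ₗ mulT k g = π := LinearMap.ext πτ
    rw [← LinearMap.rTensor_comp_apply, h, LinearMap.id_apply]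
  have hsub (t : Cx k g V) : LinearMap.rTensor (ExteriorAlgebra k g)
      (LinearMap.rTensor V (mulT k g - LinearMap.id)) t = mulTCx k g V t - t := by
    rw [LinearMap.rTensor_sub, LinearMap.rTensor_sub, LinearMap.rTensor_id, LinearMap.rTensor_id]
    rfl
  have hexpr {t : Cx k g V} (ht : pr t = 0) : ∃ s, t = mulTCx k g V s - s := by
    obtain ⟨s, hs⟩ := (exact_rTensor_rTensor hex V (ExteriorAlgebra k g) _).1 ht
    exact ⟨s, by rw [← hs, hsub]⟩
  have hpr0 (s : Cx k g V) : pr (mulTCx k g V s - s) = 0 := by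
    rw [← hsub]
    exact (exact_rTensor_rTensor hex V (ExteriorAlgebra k g) _).2 ⟨s, rfl⟩
  obtain ⟨c, rfl⟩ := hpr c
  rw [← hprD] at hc
  obtain ⟨e, he⟩ := hexpr hc
  have hDe : diff k g V e = 0 := by
    refine eq_zero_of_mulTCx_eq_self ?_
    rw [← sub_eq_zero, ← diff_mulTCx, ← map_sub, ← he, diff_diff]
  obtain ⟨z, f, hf⟩ := exists_eq_diff hK hDe
  -- The corrected lift has the boundary `(t - 1) f`, and the augmentation of a boundary vanishes.
  have hcyc : diff k g V (c - (mulTCx k g V z - z)) = 0 := by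
    let X := (LinearMap.mul k (Polynomial k)).flip Polynomial.X
    have h1 : diff k g V (c - (mulTCx k g V z - z)) =
        LinearMap.rTensor V (cst k g) (LinearMap.rTensor V X f - f) ⊗ₜ[k] 1 := by
      have hX : cst k g ∘ₗ X = mulT k g ∘ₗ cst k g := LinearMap.ext cst_mul_X
      rw [map_sub, map_sub (diff k g V) (mulTCx k g V z), diff_mulTCx, he, hf, map_add,
        map_sub (LinearMap.rTensor V (cst k g)), ← LinearMap.rTensor_comp_apply, hX,
        LinearMap.rTensor_comp_apply, TensorProduct.sub_tmul,
        show mulTCx k g V (LinearMap.rTensor V (cst k g) f ⊗ₜ[k] 1) =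
          LinearMap.rTensor V (mulT k g) (LinearMap.rTensor V (cst k g) f) ⊗ₜ[k] 1 from rfl]
      abel
    have h2 := augCx_diff (c - (mulTCx k g V z - z))
    have h3 : aug k g ∘ₗ cst k g = LinearMap.id := LinearMap.ext aug_cst
    rw [h1, augCx_tmul, map_one, one_smul, ← LinearMap.rTensor_comp_apply, h3,
      LinearMap.rTensor_id, LinearMap.id_apply] at h2
    rw [h1, h2, map_zero, TensorProduct.zero_tmul]
  obtain ⟨z', f, hz'⟩ := exists_eq_diff hK hcyc
  have hcst (f : Polynomial k ⊗[k] V) : ∃ v : V,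
      LinearMap.rTensor V π (LinearMap.rTensor V (cst k g) f) =
        (1 : UniversalEnvelopingAlgebra k g) ⊗ₜ[k] v := by
    induction f with
    | zero => exact ⟨0, by simp⟩
    | tmul p v =>
      have hp : ∃ r : k, π (cst k g p) = r • 1 := by
        induction p using Polynomial.induction_on with
        | C a =>
          refine ⟨a, ?_⟩
          rw [← mul_one (Polynomial.C a), ← Polynomial.smul_eq_C_mul, map_smul, map_smul, cst_one,
            π1]
        | add p q hp hq =>
          obtain ⟨⟨r, hr⟩, ⟨s, hs⟩⟩ := hp, hq
          exact ⟨r + s, by rw [map_add, map_add, hr, hs, add_smul]⟩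
        | monomial n a h =>
          obtain ⟨r, hr⟩ := h
          refine ⟨r, ?_⟩
          rw [pow_succ, ← mul_assoc, cst_mul_X, πτ]
          exact hr
      obtain ⟨r, hr⟩ := hp
      exact ⟨r • v, by
        rw [LinearMap.rTensor_tmul, LinearMap.rTensor_tmul, hr, TensorProduct.smul_tmul]⟩
    | add a b ha hb =>
      obtain ⟨⟨v, hv⟩, ⟨w, hw⟩⟩ := ha, hb
      exact ⟨v + w, by rw [map_add, map_add, hv, hw, TensorProduct.tmul_add]⟩
  obtain ⟨v, hv⟩ := hcst f
  refine ⟨pr z', v, ?_⟩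
  rw [← hv, ← hprD]
  have h1 := congrArg pr hz'
  rw [map_sub, hpr0, map_add] at h1
  exact (sub_zero (pr c)).symm.trans h1

end Homogenized

/-! ### Exactness in each exterior degree -/

section Graded

variable {k g M N : Type u} [CommRing k] [LieRing g] [LieAlgebra k g]
  [AddCommGroup M] [Module k M] [AddCommGroup N] [Module k N]

variable (k g M) in
/-- The inclusion of the component of degree `n` of `M ⊗ Λ g`. -/
noncomputable def tensorIncl (n : ℕ) : M ⊗[k] (⋀[k]^n g) →ₗ[k] M ⊗[k] ExteriorAlgebra k g :=
  LinearMap.lTensor M (⋀[k]^n g).subtype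

variable (k g M) in
/-- The projection to the component of degree `n` of `M ⊗ Λ g`. -/
noncomputable def tensorProj (n : ℕ) : M ⊗[k] ExteriorAlgebra k g →ₗ[k] M ⊗[k] (⋀[k]^n g) :=
  LinearMap.lTensor M (extProj k g n)

theorem extProj_coe_of_ne {n j : ℕ} (h : j ≠ n) (ω : ⋀[k]^j g) :
    extProj k g n (ω : ExteriorAlgebra k g) = 0 := by
  simp only [extProj, LinearMap.comp_apply, LinearEquiv.coe_coe,
    DirectSum.decomposeLinearEquiv_apply, DirectSum.decompose_coe]
  exact DirectSum.of_eq_of_ne _ _ _ h.symm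

theorem tensorProj_tensorIncl (n : ℕ) (t : M ⊗[k] (⋀[k]^n g)) :
    tensorProj k g M n (tensorIncl k g M n t) = t := by
  induction t with
  | zero => simp
  | tmul m ω => simp [tensorProj, tensorIncl, extProj_coe]
  | add a b ha hb => rw [map_add, map_add, ha, hb]

theorem tensorProj_tensorIncl_of_ne {n j : ℕ} (h : j ≠ n) (t : M ⊗[k] (⋀[k]^j g)) :
    tensorProj k g M n (tensorIncl k g M j t) = 0 := by
  induction t with
  | zero => simp
  | tmul m ω => simp [tensorProj, tensorIncl, extProj_coe_of_ne h]
  | add a b ha hb => rw [map_add, map_add, ha, hb, add_zero]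

theorem tensorProj_succ_tmul_one (n : ℕ) (m : M) : tensorProj k g M (n + 1) (m ⊗ₜ[k] 1) = 0 := by
  have h : (1 : ExteriorAlgebra k g) = exteriorPower.ιMulti k 0 (fun i => i.elim0 : Fin 0 → g) :=
    (ExteriorAlgebra.ιMulti_zero_apply _).symm
  rw [h]
  exact tensorProj_tensorIncl_of_ne (Nat.succ_ne_zero n).symm (m ⊗ₜ[k] exteriorPower.ιMulti k 0 _)

theorem exists_tensorIncl_zero (t : M ⊗[k] (⋀[k]^0 g)) :
    ∃ m : M, tensorIncl k g M 0 t = m ⊗ₜ[k] 1 := by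
  induction t with
  | zero => exact ⟨0, by simp⟩
  | tmul m ω =>
    obtain ⟨c, rfl⟩ := (exteriorPower.zeroEquiv k g).symm.surjective ω
    refine ⟨c • m, ?_⟩
    rw [exteriorPower.zeroEquiv_symm_apply, TensorProduct.tmul_smul, map_smul,
      ← TensorProduct.smul_tmul']
    congr 1
  | add a b ha hb =>
    obtain ⟨⟨m, hm⟩, ⟨m', hm'⟩⟩ := ha, hb
    exact ⟨m + m', by rw [map_add, hm, hm', TensorProduct.add_tmul]⟩

theorem tensor_graded_hom_ext {f f' : M ⊗[k] ExteriorAlgebra k g →ₗ[k] N}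
    (h : ∀ n t, f (tensorIncl k g M n t) = f' (tensorIncl k g M n t)) : f = f' := by
  refine TensorProduct.ext' fun m ω => ?_
  induction ω using DirectSum.Decomposition.inductionOn (fun i : ℕ => ⋀[k]^i g) with
  | zero => simp
  | homogeneous ω => exact h _ (m ⊗ₜ[k] ω)
  | add a b ha hb => rw [TensorProduct.tmul_add, map_add, map_add, ha, hb]

variable [Module (UniversalEnvelopingAlgebra k g)ᵐᵒᵖ M]
  [IsScalarTower k (UniversalEnvelopingAlgebra k g)ᵐᵒᵖ M]
  [Module (UniversalEnvelopingAlgebra k g)ᵐᵒᵖ N]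
  [IsScalarTower k (UniversalEnvelopingAlgebra k g)ᵐᵒᵖ N]

theorem totalD_tensorIncl (n : ℕ) (t : M ⊗[k] (⋀[k]^(n + 1) g)) :
    totalD k g M (tensorIncl k g M (n + 1) t) = tensorIncl k g M n (ceD k g M n t) :=
  (LinearMap.congr_fun (incl_ceD k g M n) t).symm

theorem tensorProj_totalD (n : ℕ) (t : M ⊗[k] ExteriorAlgebra k g) :
    tensorProj k g M n (totalD k g M t) = ceD k g M n (tensorProj k g M (n + 1) t) := by
  have : tensorProj k g M n ∘ₗ totalD k g M = ceD k g M n ∘ₗ tensorProj k g M (n + 1) := by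
    refine tensor_graded_hom_ext fun j t => ?_
    rw [LinearMap.comp_apply, LinearMap.comp_apply]
    cases j with
    | zero =>
      obtain ⟨m, hm⟩ := exists_tensorIncl_zero t
      rw [hm, totalD_one, tensorProj_succ_tmul_one, map_zero, map_zero]
    | succ j =>
      rw [totalD_tensorIncl]
      by_cases h : j = n
      · subst h
        rw [tensorProj_tensorIncl, tensorProj_tensorIncl]
      · rw [tensorProj_tensorIncl_of_ne h, tensorProj_tensorIncl_of_ne (by omega), map_zero]
  exact LinearMap.congr_fun this t

theorem rTensor_totalD {φ : M →ₗ[k] N} (hφ : ∀ x m, φ (rAct k g M x m) = rAct k g N x (φ m))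
    (t : M ⊗[k] ExteriorAlgebra k g) :
    LinearMap.rTensor _ φ (totalD k g M t) = totalD k g N (LinearMap.rTensor _ φ t) := by
  rw [← twistedD_rAct, ← twistedD_rAct]
  exact rTensor_twistedD hφ (fun _ => rfl) t

theorem rTensor_ceD {φ : M →ₗ[k] N} (hφ : ∀ x m, φ (rAct k g M x m) = rAct k g N x (φ m))
    (n : ℕ) (t : M ⊗[k] (⋀[k]^(n + 1) g)) :
    LinearMap.rTensor _ φ (ceD k g M n t) = ceD k g N n (LinearMap.rTensor _ φ t) := by
  have h1 (j : ℕ) (s : M ⊗[k] (⋀[k]^j g)) : tensorIncl k g N j (LinearMap.rTensor _ φ s) =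
      LinearMap.rTensor _ φ (tensorIncl k g M j s) := by
    rw [tensorIncl, tensorIncl, ← LinearMap.comp_apply, ← LinearMap.comp_apply,
      LinearMap.lTensor_comp_rTensor, LinearMap.rTensor_comp_lTensor]
  rw [← tensorProj_tensorIncl n (LinearMap.rTensor _ φ (ceD k g M n t)), h1,
    ← totalD_tensorIncl, rTensor_totalD hφ, ← h1, totalD_tensorIncl, tensorProj_tensorIncl]

variable (k g M) in
/-- The Chevalley-Eilenberg complex of `M` is exact in positive degrees. -/
def IsCEAcyclic : Prop :=
  ∀ n (t : M ⊗[k] (⋀[k]^(n + 1) g)), ceD k g M n t = 0 → ∃ z, ceD k g M (n + 1) z = t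

theorem IsCEAcyclic.of_retract (h : IsCEAcyclic k g N) {i : M →ₗ[k] N} {r : N →ₗ[k] M}
    (hi : ∀ x m, i (rAct k g M x m) = rAct k g N x (i m))
    (hr : ∀ x m, r (rAct k g N x m) = rAct k g M x (r m)) (hri : r ∘ₗ i = LinearMap.id) :
    IsCEAcyclic k g M := by
  intro n t ht
  obtain ⟨z, hz⟩ := h n (LinearMap.rTensor _ i t) (by rw [← rTensor_ceD hi, ht, map_zero])
  refine ⟨LinearMap.rTensor _ r z, ?_⟩
  rw [← rTensor_ceD hr, hz, ← LinearMap.rTensor_comp_apply, hri, LinearMap.rTensor_id,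
    LinearMap.id_apply]

theorem rAct_tensor (V : Type u) [AddCommGroup V] [Module k V] :
    rAct k g (UniversalEnvelopingAlgebra k g ⊗[k] V) =
      tensorAct (rAct k g (UniversalEnvelopingAlgebra k g)) V := by
  refine LinearMap.ext fun x => TensorProduct.ext' fun u v => ?_
  rfl

theorem isCEAcyclic_tensor (hK : IsKoszul k g) (V : Type u) [AddCommGroup V] [Module k V] :
    IsCEAcyclic k g (UniversalEnvelopingAlgebra k g ⊗[k] V) := by
  intro n t ht
  have hD : twistedD (tensorAct (rAct k g (UniversalEnvelopingAlgebra k g)) V) LinearMap.id =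
      totalD k g (UniversalEnvelopingAlgebra k g ⊗[k] V) := by
    rw [← rAct_tensor, twistedD_rAct]
  obtain ⟨z, v, hz⟩ := exists_eq_twistedD hK (c := tensorIncl k g _ (n + 1) t)
    (by rw [hD, totalD_tensorIncl, ht, map_zero])
  refine ⟨tensorProj k g _ (n + 2) z, ?_⟩
  rw [hD] at hz
  rw [← tensorProj_totalD, ← tensorProj_tensorIncl (n + 1) t, hz, map_add,
    tensorProj_succ_tmul_one, add_zero]

/-- A relatively projective module `M` is a direct summand of `U ⊗ M`, because the multiplication
`U ⊗ M → M` has the `k`-linear section `m ↦ 1 ⊗ m`. -/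
theorem isCEAcyclic_of_isRelProjective (hK : IsKoszul k g)
    (hM : IsRelProjective k (UniversalEnvelopingAlgebra k g)ᵐᵒᵖ M) : IsCEAcyclic k g M := by
  let a : UniversalEnvelopingAlgebra k g ⊗[k] M →ₗ[k] M := TensorProduct.lift
    ((Algebra.lsmul k k M).toLinearMap ∘ₗ (MulOpposite.opLinearEquiv k).toLinearMap)
  have ha (u : UniversalEnvelopingAlgebra k g) (m : M) : a (u ⊗ₜ[k] m) = op u • m := rfl
  let π : UniversalEnvelopingAlgebra k g ⊗[k] M →ₗ[(UniversalEnvelopingAlgebra k g)ᵐᵒᵖ] M :=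
    { a with
      map_smul' := fun r t => by
        change a (r • t) = r • a t
        induction t with
        | zero => simp
        | tmul u m =>
          rw [TensorProduct.smul_tmul', ha, ha, smul_smul]
          rfl
        | add b c hb hc => rw [smul_add, map_add, map_add, hb, hc, smul_add] }
  obtain ⟨i, hi⟩ := hM _ _ π (TensorProduct.mk k _ M 1)
    (fun m => (ha 1 m).trans (one_smul _ m)) LinearMap.id
  refine (isCEAcyclic_tensor hK M).of_retract (i := i.restrictScalars k) (r := a)
    (fun x m => map_smul i _ m) (fun x m => map_smul π _ m) ?_
  exact LinearMap.ext fun m => LinearMap.congr_fun hi m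

end Graded

section Coinvariants

variable {k g M : Type u} [CommRing k] [LieRing g] [LieAlgebra k g]
  [AddCommGroup M] [Module k M]

variable (k g) in
/-- The generator of `Λ^0 g`. -/
noncomputable def extOne : ⋀[k]^0 g := exteriorPower.ιMulti k 0 (fun i => i.elim0)

theorem zeroEquiv_extOne : exteriorPower.zeroEquiv k g (extOne k g) = 1 :=
  exteriorPower.zeroEquiv_ιMulti _

variable (k g) in
/-- The identification of `Λ^0 g` with the trivial module. -/
noncomputable def extZeroEquiv : ⋀[k]^0 g ≃ₗ[k] TrivialModule k g := exteriorPower.zeroEquiv k g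

theorem extZeroEquiv_extOne : extZeroEquiv k g (extOne k g) = trivialOne k g :=
  zeroEquiv_extOne (k := k) (g := g)

theorem exists_eq_smul_trivialOne {k g : Type u} [CommRing k] (c : TrivialModule k g) :
    ∃ a : k, c = a • trivialOne k g :=
  ⟨c, (mul_one (M := k) c).symm⟩

theorem exists_eq_tmul_extOne (t : M ⊗[k] (⋀[k]^0 g)) : ∃ m : M, t = m ⊗ₜ[k] extOne k g := by
  induction t with
  | zero => exact ⟨0, by simp⟩
  | tmul m ω =>
    refine ⟨exteriorPower.zeroEquiv k g ω • m, ?_⟩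
    rw [TensorProduct.smul_tmul]
    congr 1
    refine (exteriorPower.zeroEquiv k g).injective ?_
    rw [map_smul, zeroEquiv_extOne, smul_eq_mul, mul_one]
  | add a b ha hb =>
    obtain ⟨⟨m, rfl⟩, ⟨m', rfl⟩⟩ := ha, hb
    exact ⟨m + m', (TensorProduct.add_tmul _ _ _).symm⟩

variable [Module (UniversalEnvelopingAlgebra k g)ᵐᵒᵖ M]

variable (k g M) in
/-- The augmentation `M ⊗ Λ^0 g → M ⊗_U k`. -/
noncomputable def toCoinvariants : M ⊗[k] (⋀[k]^0 g) →ₗ[k]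
    RTensor k (UniversalEnvelopingAlgebra k g) M (TrivialModule k g) :=
  Submodule.mkQ _ ∘ₗ LinearMap.lTensor M (extZeroEquiv k g).toLinearMap

theorem toCoinvariants_surjective : Function.Surjective (toCoinvariants k g M) := by
  refine (Submodule.mkQ_surjective _).comp (LinearMap.lTensor_surjective M ?_)
  exact (extZeroEquiv k g).surjective

theorem toCoinvariants_tmul (m : M) (ω : ⋀[k]^0 g) : toCoinvariants k g M (m ⊗ₜ[k] ω) =
    Submodule.Quotient.mk (m ⊗ₜ[k] extZeroEquiv k g ω) := rfl

variable [IsScalarTower k (UniversalEnvelopingAlgebra k g)ᵐᵒᵖ M]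

/-- Modulo boundaries, an element `r` of `U g` acts on `M = M ⊗ Λ^0 g` by its augmentation. -/
theorem exists_ceD_eq (r : UniversalEnvelopingAlgebra k g) : ∀ m : M,
    ∃ s, ceD k g M 0 s = (op r • m - augmentation k g r • m) ⊗ₜ[k] extOne k g := by
  induction r using universalEnveloping_induction with
  | add u v hu hv =>
    intro m
    obtain ⟨⟨s, hs⟩, ⟨t, ht⟩⟩ := hu m, hv m
    refine ⟨s + t, ?_⟩
    rw [map_add, hs, ht, map_add, MulOpposite.op_add, add_smul, add_smul,
      ← TensorProduct.add_tmul]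
    congr 1
    abel
  | smul c u hu =>
    intro m
    obtain ⟨s, hs⟩ := hu m
    exact ⟨c • s, by
      rw [map_smul, hs, TensorProduct.smul_tmul', map_smul, MulOpposite.op_smul, smul_sub,
        smul_assoc, smul_assoc]⟩
  | one => exact fun m => ⟨0, by simp⟩
  | mul u x _ =>
    intro m
    refine ⟨(op u • m) ⊗ₜ[k] exteriorPower.ιMulti k 1 (fun _ => x), ?_⟩
    rw [ceD_tmul_one, map_mul, augmentation_ι, mul_zero, zero_smul, sub_zero, MulOpposite.op_mul,
      mul_smul]
    rfl

/-- The cokernel of `M ⊗ g → M` is `M ⊗_U k`. -/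
theorem exact_toCoinvariants : Function.Exact (ceD k g M 0) (toCoinvariants k g M) := by
  intro t
  constructor
  · intro ht
    have hle : balancedRel k (UniversalEnvelopingAlgebra k g) M (TrivialModule k g) ≤
        (LinearMap.range (ceD k g M 0)).map
          (LinearMap.lTensor M (extZeroEquiv k g).toLinearMap) := by
      refine Submodule.span_le.2 ?_
      rintro _ ⟨m, r, c, rfl⟩
      obtain ⟨a, rfl⟩ := exists_eq_smul_trivialOne c
      obtain ⟨s, hs⟩ := exists_ceD_eq r m
      refine ⟨a • ceD k g M 0 s, ⟨a • s, map_smul _ _ _⟩, ?_⟩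
      rw [hs, map_smul, LinearMap.lTensor_tmul, LinearEquiv.coe_coe, extZeroEquiv_extOne,
        TensorProduct.sub_tmul, trivial_smul_def, smul_comm _ a, TensorProduct.tmul_smul,
        TensorProduct.tmul_smul, smul_sub,
        TensorProduct.smul_tmul (augmentation k g r) m]
    obtain ⟨s, hs, hst⟩ := hle ((Submodule.Quotient.mk_eq_zero _).1 ht)
    rwa [(LinearEquiv.lTensor M (extZeroEquiv k g)).injective hst] at hs
  · rintro ⟨s, rfl⟩
    have : toCoinvariants k g M ∘ₗ ceD k g M 0 = 0 := by
      refine tmul_ext k g M fun m x => ?_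
      have h1 := congrArg (toCoinvariants k g M) (ceD_tmul_one k g M m x)
      refine h1.trans ?_
      rw [toCoinvariants_tmul, LinearMap.zero_apply, Submodule.Quotient.mk_eq_zero]
      refine Submodule.subset_span ⟨m, UniversalEnvelopingAlgebra.ι k (x 0),
        extZeroEquiv k g (extOne k g), ?_⟩
      rw [trivial_smul_def, augmentation_ι, zero_smul, TensorProduct.tmul_zero, sub_zero]
      rfl
    exact LinearMap.congr_fun this s

end Coinvariants

section Pure

variable (k g : Type u) [CommRing k] [LieRing g] [LieAlgebra k g]

theorem isRelProjective_ceResolution : (ceResolution k g).IsRelProjective :=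
  fun _ => isRelProjective_tensor _

theorem ceAugmentation_surjective : Function.Surjective (ceAugmentation k g) := by
  intro c
  refine ⟨(id c : k) • (1 ⊗ₜ[k] extOne k g), ?_⟩
  rw [LinearMap.map_smul_of_tower, ceAugmentation_tmul, zeroEquiv_extOne, one_smul, one_smul]
  exact mul_one (M := k) c

theorem exact_ceAugmentation :
    Function.Exact (ceD k g (UniversalEnvelopingAlgebra k g) 0) (ceAugmentation k g) := by
  intro t
  constructor
  · intro ht
    obtain ⟨u, rfl⟩ := exists_eq_tmul_extOne t
    rw [ceAugmentation_tmul, zeroEquiv_extOne, one_smul, trivial_smul_def] at ht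
    have hu : augmentation k g u = 0 := (mul_one (augmentation k g u)).symm.trans ht
    obtain ⟨s, hs⟩ := exists_ceD_eq u (1 : UniversalEnvelopingAlgebra k g)
    refine ⟨s, ?_⟩
    rw [hs, hu, zero_smul, sub_zero, op_smul_eq_mul, one_mul]
  · rintro ⟨s, rfl⟩
    exact LinearMap.congr_fun (ceAugmentation_ceD k g) s

variable {k g}

theorem rightComm_rTensor_ceD (V : Type u) [AddCommGroup V] [Module k V] (n : ℕ)
    (y : (UniversalEnvelopingAlgebra k g ⊗[k] (⋀[k]^(n + 1) g)) ⊗[k] V) :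
    TensorProduct.rightComm k _ _ V
        (LinearMap.rTensor V (ceD k g (UniversalEnvelopingAlgebra k g) n) y) =
      ceD k g (UniversalEnvelopingAlgebra k g ⊗[k] V) n (TensorProduct.rightComm k _ _ V y) := by
  have key (j : ℕ) (t : UniversalEnvelopingAlgebra k g ⊗[k] (⋀[k]^j g)) (v : V) :
      TensorProduct.rightComm k _ _ V (t ⊗ₜ[k] v) =
        LinearMap.rTensor _ ((TensorProduct.mk k (UniversalEnvelopingAlgebra k g) V).flip v) t := by
    induction t with
    | zero => simp
    | tmul u ω => simp
    | add a b ha hb => rw [TensorProduct.add_tmul, map_add, map_add, ha, hb]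
  induction y with
  | zero => simp
  | tmul t v => rw [LinearMap.rTensor_tmul, key, key, rTensor_ceD fun x m => rfl]
  | add a b ha hb => simp only [map_add, ha, hb]

theorem exact_rTensor_ceD (hK : IsKoszul k g) (V : Type u) [AddCommGroup V] [Module k V] (n : ℕ) :
    Function.Exact (LinearMap.rTensor V (ceD k g (UniversalEnvelopingAlgebra k g) (n + 1)))
      (LinearMap.rTensor V (ceD k g (UniversalEnvelopingAlgebra k g) n)) := by
  intro y
  constructor
  · intro hy
    obtain ⟨z, hz⟩ := isCEAcyclic_tensor hK V n (TensorProduct.rightComm k _ _ V y)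
      (by rw [← rightComm_rTensor_ceD, hy, map_zero])
    obtain ⟨z, rfl⟩ := (TensorProduct.rightComm k _ _ V).surjective z
    rw [← rightComm_rTensor_ceD] at hz
    exact ⟨z, (TensorProduct.rightComm k _ _ V).injective hz⟩
  · rintro ⟨z, rfl⟩
    rw [← LinearMap.rTensor_comp_apply, ceD_comp_ceD, LinearMap.rTensor_zero,
      LinearMap.zero_apply]

theorem isPure_ceResolution (hK : IsKoszul k g) : (ceResolution k g).IsPure := fun V _ _ =>
  ⟨LinearMap.rTensor_surjective V (ceAugmentation_surjective k g),
    rTensor_exact V (exact_ceAugmentation k g) (ceAugmentation_surjective k g),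
    exact_rTensor_ceD hK V⟩

end Pure

/-! ### Double complexes -/

section Homology

variable {k : Type u} [CommRing k]

theorem exists_iCycles_eq (K : ChainComplex (ModuleCat.{u} k) ℕ) (n : ℕ) (x : K.X n)
    (hx : ∀ m, K.d n m x = 0) : ∃ c : K.cycles n, K.iCycles n c = x := by
  let s : ModuleCat.of k k ⟶ K.X n := ModuleCat.ofHom (LinearMap.toSpanSingleton k (K.X n) x)
  have hs : s ≫ K.d n ((ComplexShape.down ℕ).next n) = 0 := by
    refine ModuleCat.hom_ext (LinearMap.ext_ring ?_)
    change K.d n _ ((1 : k) • x) = 0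
    rw [one_smul, hx]
  refine ⟨K.liftCycles s _ rfl hs (1 : k), ?_⟩
  have h := congrArg (fun φ : ModuleCat.of k k ⟶ K.X n => φ (1 : k)) (K.liftCycles_i s _ rfl hs)
  exact h.trans (one_smul k x)

theorem homologyπ_eq_zero_iff (K : ChainComplex (ModuleCat.{u} k) ℕ) (n : ℕ) (c : K.cycles n) :
    K.homologyπ n c = 0 ↔ ∃ y : K.X (n + 1), K.d (n + 1) n y = K.iCycles n c := by
  let S : ShortComplex (ModuleCat.{u} k) :=
    ShortComplex.mk (K.toCycles (n + 1) n) (K.homologyπ n) (K.toCycles_comp_homologyπ _ _)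
  have hS : S.Exact := S.exact_of_g_is_cokernel
    (K.homologyIsCokernel (n + 1) n (ChainComplex.prev ℕ n))
  have hi : Function.Injective (K.iCycles n) := (ModuleCat.mono_iff_injective _).1 inferInstance
  have h (y : K.X (n + 1)) : K.iCycles n (K.toCycles (n + 1) n y) = K.d (n + 1) n y := by
    rw [← ConcreteCategory.comp_apply, K.toCycles_i]
  constructor
  · intro hc
    obtain ⟨y, hy⟩ := (ShortComplex.moduleCat_exact_iff S).1 hS c hc
    exact ⟨y, by rw [← h]; exact congrArg _ hy⟩
  · rintro ⟨y, hy⟩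
    rw [← h] at hy
    rw [← hi hy, ← ConcreteCategory.comp_apply, K.toCycles_comp_homologyπ]
    rfl

/-- A map `φ` of complexes induces isomorphisms in homology if, for each cycle `x`, every `y` with
`∂ y = φ x` lifts to a primitive of `x`. -/
theorem isIso_homologyMap {K L : ChainComplex (ModuleCat.{u} k) ℕ} (φ : K ⟶ L)
    (h0 : Function.Surjective (φ.f 0))
    (h : ∀ n (x : K.X n) (y : L.X (n + 1)), (∀ m, K.d n m x = 0) → L.d (n + 1) n y = φ.f n x →
      ∃ x' : K.X (n + 1), K.d (n + 1) n x' = x ∧ φ.f (n + 1) x' = y) (n : ℕ) :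
    IsIso (HomologicalComplex.homologyMap φ n) := by
  have hπ (K : ChainComplex (ModuleCat.{u} k) ℕ) : Function.Surjective (K.homologyπ n) :=
    (ModuleCat.epi_iff_surjective _).1 inferInstance
  have hnat (c : K.cycles n) : HomologicalComplex.homologyMap φ n (K.homologyπ n c) =
      L.homologyπ n (HomologicalComplex.cyclesMap φ n c) := by
    rw [← ConcreteCategory.comp_apply, ← ConcreteCategory.comp_apply,
      HomologicalComplex.homologyπ_naturality]
  have hcyc (c : K.cycles n) :
      L.iCycles n (HomologicalComplex.cyclesMap φ n c) = φ.f n (K.iCycles n c) := by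
    rw [← ConcreteCategory.comp_apply, ← ConcreteCategory.comp_apply,
      HomologicalComplex.cyclesMap_i]
  have hd (K : ChainComplex (ModuleCat.{u} k) ℕ) (c : K.cycles n) (m : ℕ) :
      K.d n m (K.iCycles n c) = 0 := by
    rw [← ConcreteCategory.comp_apply, K.iCycles_d]
    rfl
  refine (ConcreteCategory.isIso_iff_bijective _).2 ⟨?_, ?_⟩
  · refine (injective_iff_map_eq_zero (HomologicalComplex.homologyMap φ n).hom).2 fun z hz => ?_
    obtain ⟨c, rfl⟩ := hπ K z
    have hz' := (hnat c).symm.trans hz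
    rw [homologyπ_eq_zero_iff, hcyc] at hz'
    obtain ⟨y, hy⟩ := hz'
    obtain ⟨x', hx', -⟩ := h n (K.iCycles n c) y (hd K c) hy
    exact (homologyπ_eq_zero_iff K n c).2 ⟨x', hx'⟩
  · intro z
    obtain ⟨c, rfl⟩ := hπ L z
    obtain ⟨x, hx, hxc⟩ : ∃ x : K.X n, (∀ m, K.d n m x = 0) ∧ φ.f n x = L.iCycles n c := by
      cases n with
      | zero =>
        obtain ⟨x, hx⟩ := h0 (L.iCycles 0 c)
        refine ⟨x, fun m => ?_, hx⟩
        rw [K.shape 0 m (by simp)]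
        rfl
      | succ n =>
        obtain ⟨x, hx, hxc⟩ := h n 0 (L.iCycles (n + 1) c) (fun m => map_zero _)
          (by rw [hd, map_zero])
        refine ⟨x, fun m => ?_, hxc⟩
        by_cases hm : m = n
        · subst hm
          exact hx
        · rw [K.shape (n + 1) m (by simpa using fun h => hm (by omega))]
          rfl
    obtain ⟨b, rfl⟩ := exists_iCycles_eq K n x hx
    refine ⟨K.homologyπ n b, ?_⟩
    rw [hnat]
    congr 1
    refine (ModuleCat.mono_iff_injective (L.iCycles n)).1 inferInstance ?_
    rw [hcyc, hxc]

end Homology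

section Double

variable (k : Type u) [CommRing k]

/-- A first quadrant double complex with anticommuting differentials: `h` lowers the first index and
`v` lowers the second one. -/
structure DoubleComplex where
  X : ℕ → ℕ → Type u
  [addCommGroup : ∀ i j, AddCommGroup (X i j)]
  [module : ∀ i j, Module k (X i j)]
  h : ∀ i j, X (i + 1) j →ₗ[k] X i j
  v : ∀ i j, X i (j + 1) →ₗ[k] X i j
  h_h : ∀ i j x, h i j (h (i + 1) j x) = 0
  v_v : ∀ i j x, v i j (v i (j + 1) x) = 0
  h_v : ∀ i j x, h i j (v (i + 1) j x) = - v i j (h i (j + 1) x)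

attribute [instance] DoubleComplex.addCommGroup DoubleComplex.module

namespace DoubleComplex

variable {k} (A : DoubleComplex k)

/-- Interchanging the two differentials. -/
def flip : DoubleComplex k where
  X i j := A.X j i
  h i j := A.v j i
  v i j := A.h j i
  h_h i j := A.v_v j i
  v_v i j := A.h_h j i
  h_v i j x := by rw [A.h_v, neg_neg]

/-- The total differential, on the product of all entries. -/
def D : (∀ i j, A.X i j) →ₗ[k] (∀ i j, A.X i j) where
  toFun x i j := A.h i j (x (i + 1) j) + A.v i j (x i (j + 1))
  map_add' x y := by
    funext i j
    simp only [Pi.add_apply, map_add]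
    abel
  map_smul' c x := by
    funext i j
    simp only [Pi.smul_apply, map_smul, smul_add, RingHom.id_apply]

theorem D_apply (x : ∀ i j, A.X i j) (i j : ℕ) :
    A.D x i j = A.h i j (x (i + 1) j) + A.v i j (x i (j + 1)) := rfl

theorem D_D (x : ∀ i j, A.X i j) : A.D (A.D x) = 0 := by
  funext i j
  simp only [D_apply, map_add, A.h_h, A.v_v, A.h_v]
  simp

/-- The entries of total degree `n`. -/
def tot (n : ℕ) : Submodule k (∀ i j, A.X i j) where
  carrier := {x | ∀ i j, i + j ≠ n → x i j = 0}
  add_mem' hx hy i j hij := by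
    rw [Pi.add_apply, Pi.add_apply, hx i j hij, hy i j hij, add_zero]
  zero_mem' _ _ _ := rfl
  smul_mem' c x hx i j hij := by rw [Pi.smul_apply, Pi.smul_apply, hx i j hij, smul_zero]

theorem D_mem {n : ℕ} {x : ∀ i j, A.X i j} (hx : x ∈ A.tot (n + 1)) : A.D x ∈ A.tot n := by
  intro i j hij
  rw [D_apply, hx _ _ (by omega), hx _ _ (by omega), map_zero, map_zero, add_zero]

theorem D_eq_zero_of_mem_tot_zero {x : ∀ i j, A.X i j} (hx : x ∈ A.tot 0) : A.D x = 0 := by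
  funext i j
  rw [D_apply, hx _ _ (by omega), hx _ _ (by omega), map_zero, map_zero, add_zero]
  rfl

/-- The element with the only entry `w`. -/
def single (i j : ℕ) (w : A.X i j) : ∀ i j, A.X i j := Pi.single i (Pi.single j w)

theorem single_same (i j : ℕ) (w : A.X i j) : A.single i j w i j = w := by
  rw [single, Pi.single_eq_same, Pi.single_eq_same]

theorem single_of_ne {i j i' j' : ℕ} (w : A.X i j) (h : i' ≠ i ∨ j' ≠ j) :
    A.single i j w i' j' = 0 := by
  by_cases hi : i' = i
  · subst hi
    rw [single, Pi.single_eq_same, Pi.single_eq_of_ne (h.resolve_left (not_not.2 rfl))]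
  · rw [single, Pi.single_eq_of_ne hi]
    rfl

theorem single_mem {i j n : ℕ} (w : A.X i j) (h : i + j = n) : A.single i j w ∈ A.tot n :=
  fun i' j' hij => A.single_of_ne w (by omega)

/-- A complex `Y` that is resolved by the rows of a double complex: for each `j`, the sequence
`⋯ → X 1 j → X 0 j → Y j → 0` is exact. -/
structure RowAugmentation where
  Y : ℕ → Type u
  [addCommGroup : ∀ j, AddCommGroup (Y j)]
  [module : ∀ j, Module k (Y j)]
  d : ∀ j, Y (j + 1) →ₗ[k] Y j
  a : ∀ j, A.X 0 j →ₗ[k] Y j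
  d_d : ∀ j, d j ∘ₗ d (j + 1) = 0
  a_v : ∀ j x, a j (A.v 0 j x) = d j (a (j + 1) x)
  surjective : ∀ j, Function.Surjective (a j)
  exact_zero : ∀ j, Function.Exact (A.h 0 j) (a j)
  exact_succ : ∀ i j, Function.Exact (A.h (i + 1) j) (A.h i j)

attribute [instance] RowAugmentation.addCommGroup RowAugmentation.module

variable {A}

/-- The total complex of a double complex with exact augmented rows is quasi-isomorphic to the
augmentation: a primitive `x'` of a cycle `x` with the given augmentation is constructed one entry
at a time, in the order of the first index. -/
theorem RowAugmentation.exists_D_eq (B : A.RowAugmentation) {n : ℕ} {x : ∀ i j, A.X i j}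
    (hx : x ∈ A.tot n) (hDx : A.D x = 0) {y : B.Y (n + 1)} (hy : B.d n y = B.a n (x 0 n)) :
    ∃ x' ∈ A.tot (n + 1), A.D x' = x ∧ B.a (n + 1) (x' 0 (n + 1)) = y := by
  have key (m : ℕ) (hm : m ≤ n + 1) : ∃ x' ∈ A.tot (n + 1), (∀ i < m, ∀ j, A.D x' i j = x i j) ∧
      B.a (n + 1) (x' 0 (n + 1)) = y := by
    induction m with
    | zero =>
      obtain ⟨w, hw⟩ := B.surjective (n + 1) y
      exact ⟨A.single 0 (n + 1) w, A.single_mem w (zero_add _),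
        fun i hi => absurd hi (Nat.not_lt_zero i), by rw [A.single_same, hw]⟩
    | succ m ih =>
      obtain ⟨x', hx', hD, ha⟩ := ih (by omega)
      obtain ⟨j, hj⟩ : ∃ j, n = m + j := ⟨n - m, by omega⟩
      -- The error of `D x'` in bidegree `(m, j)` is a cycle of its row.
      obtain ⟨w, hw⟩ : ∃ w, A.h m j w = x m j - A.D x' m j := by
        cases m with
        | zero =>
          refine (B.exact_zero j _).1 ?_
          obtain rfl : n = j := by omega
          rw [map_sub, A.D_apply, map_add, (B.exact_zero n).apply_apply_eq_zero, zero_add, B.a_v,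
            ha, hy, sub_self]
        | succ m =>
          refine (B.exact_succ m j _).1 ?_
          have h1 : A.D (x - A.D x') m j = 0 := by
            rw [map_sub, hDx, A.D_D, sub_zero]
            rfl
          rw [A.D_apply, Pi.sub_apply, Pi.sub_apply, Pi.sub_apply, Pi.sub_apply,
            hD m (Nat.lt_succ_self m) (j + 1), sub_self, map_zero, add_zero] at h1
          exact h1
      refine ⟨x' + A.single (m + 1) j w, Submodule.add_mem _ hx' (A.single_mem w (by omega)),
        fun i hi j' => ?_, ?_⟩
      · rw [map_add, Pi.add_apply, Pi.add_apply, A.D_apply (A.single (m + 1) j w),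
          A.single_of_ne (i' := i) w (Or.inl (by omega)), map_zero, add_zero]
        by_cases him : i = m
        · subst him
          by_cases hj : j' = j
          · subst hj
            rw [A.single_same, hw, add_sub_cancel]
          · rw [A.single_of_ne w (Or.inr hj), map_zero, add_zero, hx _ _ (by omega),
              A.D_mem hx' _ _ (by omega)]
        · rw [A.single_of_ne w (Or.inl (by omega)), map_zero, add_zero, hD i (by omega)]
      · rw [Pi.add_apply, Pi.add_apply, A.single_of_ne w (Or.inl (by omega)), add_zero, ha]
  obtain ⟨x', hx', hD, ha⟩ := key (n + 1) le_rfl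
  refine ⟨x', hx', ?_, ha⟩
  funext i j
  by_cases hi : i < n + 1
  · exact hD i hi j
  · rw [hx _ _ (by omega), A.D_mem hx' _ _ (by omega)]

variable (A) in
/-- The differential of the total complex. -/
def totD (n : ℕ) : A.tot (n + 1) →ₗ[k] A.tot n := A.D.restrict fun _ => A.D_mem

theorem totD_coe (n : ℕ) (x : A.tot (n + 1)) : (A.totD n x : ∀ i j, A.X i j) = A.D x := rfl

variable (A) in
/-- The total complex. -/
def totComplex : ChainComplex (ModuleCat.{u} k) ℕ :=
  ChainComplex.of (fun n => ModuleCat.of k (A.tot n)) (fun n => ModuleCat.ofHom (A.totD n))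
    (fun n => by
      have h : A.totD n ∘ₗ A.totD (n + 1) = 0 :=
        LinearMap.ext fun x => Subtype.ext (A.D_D x)
      rw [← ModuleCat.ofHom_comp, h]
      rfl)

theorem totComplex_d (n : ℕ) : A.totComplex.d (n + 1) n = ModuleCat.ofHom (A.totD n) :=
  ChainComplex.of_d (fun n => ModuleCat.of k (A.tot n)) (fun n => ModuleCat.ofHom (A.totD n)) n

theorem D_eq_zero_of_d_eq_zero {n : ℕ} (x : A.tot n)
    (hx : ∀ m, A.totComplex.d n m x = 0) : A.D x = 0 := by
  cases n with
  | zero => exact A.D_eq_zero_of_mem_tot_zero x.2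
  | succ n =>
    have h := hx n
    rw [totComplex_d] at h
    exact congrArg Subtype.val (show A.totD n x = 0 from h)

namespace RowAugmentation

/-- The augmentation as a complex. -/
def complex (B : A.RowAugmentation) : ChainComplex (ModuleCat.{u} k) ℕ :=
  ChainComplex.of (fun n => ModuleCat.of k (B.Y n)) (fun n => ModuleCat.ofHom (B.d n))
    (fun n => by rw [← ModuleCat.ofHom_comp, B.d_d]; rfl)

theorem complex_d (B : A.RowAugmentation) (n : ℕ) :
    B.complex.d (n + 1) n = ModuleCat.ofHom (B.d n) :=
  ChainComplex.of_d (fun n => ModuleCat.of k (B.Y n)) (fun n => ModuleCat.ofHom (B.d n)) n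

/-- The augmentation of the entry of bidegree `(0, n)`. -/
def projMap (B : A.RowAugmentation) (n : ℕ) : A.tot n →ₗ[k] B.Y n :=
  B.a n ∘ₗ LinearMap.proj n ∘ₗ LinearMap.proj 0 ∘ₗ (A.tot n).subtype

theorem projMap_apply (B : A.RowAugmentation) (n : ℕ) (x : A.tot n) :
    B.projMap n x = B.a n (x.1 0 n) := rfl

theorem d_projMap (B : A.RowAugmentation) (n : ℕ) (x : A.tot (n + 1)) :
    B.d n (B.projMap (n + 1) x) = B.projMap n (A.totD n x) := by
  rw [projMap_apply, projMap_apply, totD_coe, A.D_apply, map_add,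
    (B.exact_zero n).apply_apply_eq_zero, zero_add, B.a_v]

/-- The map from the total complex to the augmentation of the rows. -/
def proj (B : A.RowAugmentation) : A.totComplex ⟶ B.complex :=
  ChainComplex.ofHom (fun n => ModuleCat.ofHom (B.projMap n)) (fun n => by
    rw [totComplex_d, complex_d]
    exact congrArg ModuleCat.ofHom (LinearMap.ext fun x => B.d_projMap n x))

theorem isIso_proj (B : A.RowAugmentation) (n : ℕ) :
    IsIso (HomologicalComplex.homologyMap B.proj n) := by
  have h0 (y : B.Y 0) : ∃ x : A.tot 0, B.projMap 0 x = y := by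
    obtain ⟨w, hw⟩ := B.surjective 0 y
    refine ⟨⟨A.single 0 0 w, A.single_mem w rfl⟩, ?_⟩
    rw [projMap_apply]
    exact (congrArg (B.a 0) (A.single_same 0 0 w)).trans hw
  have h1 (n : ℕ) (x : A.tot n) (y : B.Y (n + 1)) (hx : ∀ m, A.totComplex.d n m x = 0)
      (hy : B.d n y = B.projMap n x) :
      ∃ x' : A.tot (n + 1), A.totD n x' = x ∧ B.projMap (n + 1) x' = y := by
    obtain ⟨x', hx', hD, ha⟩ := B.exists_D_eq x.2 (D_eq_zero_of_d_eq_zero x hx) hy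
    exact ⟨⟨x', hx'⟩, Subtype.ext hD, ha⟩
  refine isIso_homologyMap B.proj h0 (fun n x y hx hy => ?_) n
  rw [complex_d] at hy
  rw [totComplex_d]
  exact h1 n x y hx hy

end RowAugmentation

variable (A) in
/-- The total complex does not change if the two differentials are interchanged. -/
def flipMap : A.totComplex ⟶ A.flip.totComplex :=
  ChainComplex.ofHom
    (fun n => ModuleCat.ofHom
      { toFun := fun x => (⟨fun i j => x.1 j i, fun i j hij => x.2 j i (by omega)⟩ : A.flip.tot n)
        map_add' := fun _ _ => rfl
        map_smul' := fun _ _ => rfl })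
    (fun n => by
      rw [totComplex_d, totComplex_d]
      refine congrArg ModuleCat.ofHom (LinearMap.ext fun x => Subtype.ext ?_)
      funext i j
      exact add_comm _ _)

theorem isIso_flipMap : IsIso A.flipMap :=
  ⟨A.flip.flipMap, by
    constructor
    all_goals
      ext n x
      rfl⟩

/-- A map of double complexes. -/
structure Hom (A A' : DoubleComplex k) where
  f : ∀ i j, A.X i j →ₗ[k] A'.X i j
  h : ∀ i j x, f i j (A.h i j x) = A'.h i j (f (i + 1) j x)
  v : ∀ i j x, f i j (A.v i j x) = A'.v i j (f i (j + 1) x)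

/-- The map of total complexes induced by a map of double complexes. -/
def totMap {A' : DoubleComplex k} (φ : Hom A A') : A.totComplex ⟶ A'.totComplex :=
  ChainComplex.ofHom
    (fun n => ModuleCat.ofHom
      { toFun := fun x => (⟨fun i j => φ.f i j (x.1 i j), fun i j hij => by
          change φ.f i j (x.1 i j) = 0
          rw [x.2 i j hij, map_zero]⟩ : A'.tot n)
        map_add' := fun x y => Subtype.ext (by funext i j; exact map_add _ _ _)
        map_smul' := fun c x => Subtype.ext (by funext i j; exact map_smul _ _ _) })
    (fun n => by
      rw [totComplex_d, totComplex_d]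
      refine congrArg ModuleCat.ofHom (LinearMap.ext fun x => Subtype.ext ?_)
      funext i j
      change A'.h i j (φ.f _ _ _) + A'.v i j (φ.f _ _ _) = φ.f i j (_ + _)
      rw [map_add, φ.h, φ.v]
      rfl)

end DoubleComplex

end Double

/-! ### The comparison of Chevalley-Eilenberg homology with relative torsion products -/

section Comparison

variable {k : Type u} [CommRing k]

theorem exact_rTensor_of_split {X Y Z : Type u} [AddCommGroup X] [Module k X] [AddCommGroup Y]
    [Module k Y] [AddCommGroup Z] [Module k Z] {f : X →ₗ[k] Y} {p : Y →ₗ[k] Z} (hpf : p ∘ₗ f = 0)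
    {s : Z →ₗ[k] Y} {h : Y →ₗ[k] X} (hs : ∀ y, s (p y) + f (h y) = y) (W : Type u) [AddCommGroup W]
    [Module k W] : Function.Exact (LinearMap.rTensor W f) (LinearMap.rTensor W p) := by
  intro y
  constructor
  · intro hy
    refine ⟨LinearMap.rTensor W h y, ?_⟩
    have h1 : s ∘ₗ p + f ∘ₗ h = LinearMap.id := LinearMap.ext hs
    have h2 := congrArg (fun φ => LinearMap.rTensor W φ y) h1
    simp only [LinearMap.rTensor_add, LinearMap.add_apply, LinearMap.rTensor_comp_apply, hy,
      map_zero, zero_add, LinearMap.rTensor_id, LinearMap.id_apply] at h2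
    exact h2
  · rintro ⟨x, rfl⟩
    rw [← LinearMap.rTensor_comp_apply, hpf, LinearMap.rTensor_zero, LinearMap.zero_apply]

theorem exact_neg_one_pow_smul {X Y Z : Type u} [AddCommGroup X] [Module k X] [AddCommGroup Y]
    [Module k Y] [AddCommGroup Z] [Module k Z] {f : X →ₗ[k] Y} {p : Y →ₗ[k] Z}
    (h : Function.Exact f p) (m : ℕ) : Function.Exact ((-1 : k) ^ m • f) p := by
  have hm : (-1 : k) ^ m * (-1) ^ m = 1 := by rw [← mul_pow]; simp
  intro y
  rw [h y]
  constructor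
  · rintro ⟨x, rfl⟩
    exact ⟨(-1 : k) ^ m • x, by rw [LinearMap.smul_apply, map_smul, smul_smul, hm, one_smul]⟩
  · rintro ⟨x, rfl⟩
    exact ⟨(-1 : k) ^ m • x, map_smul _ _ _⟩

variable {g : Type u} [LieRing g] [LieAlgebra k g] {M : Type u} [AddCommGroup M] [Module k M]
  [Module (UniversalEnvelopingAlgebra k g)ᵐᵒᵖ M]
  [IsScalarTower k (UniversalEnvelopingAlgebra k g)ᵐᵒᵖ M]

/-- The double complex of the Chevalley-Eilenberg complexes of the terms of a resolution. The signs
make the differentials anticommute. -/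
noncomputable def ceDouble (P : AugComplex k (UniversalEnvelopingAlgebra k g)ᵐᵒᵖ M) :
    DoubleComplex k where
  X i j := P.X i ⊗[k] (⋀[k]^j g)
  h i j := LinearMap.rTensor _ ((P.d i).restrictScalars k)
  v i j := (-1 : k) ^ i • ceD k g (P.X i) j
  h_h i j x := by
    have h : (P.d i).restrictScalars k ∘ₗ (P.d (i + 1)).restrictScalars k = 0 :=
      LinearMap.ext fun x => LinearMap.congr_fun (P.d_comp_d i) x
    rw [← LinearMap.rTensor_comp_apply, h, LinearMap.rTensor_zero, LinearMap.zero_apply]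
  v_v i j x := by
    have h : ceD k g (P.X i) j (ceD k g (P.X i) (j + 1) x) = 0 :=
      LinearMap.congr_fun (ceD_comp_ceD k g (P.X i) j) x
    rw [LinearMap.smul_apply, LinearMap.smul_apply, map_smul, h, smul_zero, smul_zero]
  h_v i j x := by
    rw [LinearMap.smul_apply, LinearMap.smul_apply, map_smul,
      rTensor_ceD (fun x m => map_smul (P.d i) _ m), pow_succ, mul_neg_one, neg_smul]

theorem rAct_restrictScalars {N : Type u} [AddCommGroup N] [Module k N]
    [Module (UniversalEnvelopingAlgebra k g)ᵐᵒᵖ N]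
    [IsScalarTower k (UniversalEnvelopingAlgebra k g)ᵐᵒᵖ N]
    (φ : M →ₗ[(UniversalEnvelopingAlgebra k g)ᵐᵒᵖ] N) (x : g) (m : M) :
    φ.restrictScalars k (rAct k g M x m) = rAct k g N x (φ.restrictScalars k m) :=
  map_smul φ _ m

variable {P : AugComplex k (UniversalEnvelopingAlgebra k g)ᵐᵒᵖ M}

/-- The rows of the double complex resolve the Chevalley-Eilenberg complex of `M`, because the
resolution is split. -/
noncomputable def ceRows (hP : P.IsSplit) : (ceDouble P).RowAugmentation where
  Y j := M ⊗[k] (⋀[k]^j g)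
  d j := ceD k g M j
  a j := LinearMap.rTensor _ (P.ε.restrictScalars k)
  d_d j := ceD_comp_ceD k g M j
  a_v j x := by
    have h (x : P.X 0 ⊗[k] (⋀[k]^(j + 1) g)) :
        LinearMap.rTensor _ (P.ε.restrictScalars k) ((-1 : k) ^ 0 • ceD k g (P.X 0) j x) =
          ceD k g M j (LinearMap.rTensor _ (P.ε.restrictScalars k) x) := by
      rw [pow_zero, one_smul, rTensor_ceD (rAct_restrictScalars P.ε)]
    exact h x
  surjective j := by
    obtain ⟨s, h, hs, -⟩ := hP
    exact LinearMap.rTensor_surjective _ fun m => ⟨s m, hs m⟩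
  exact_zero j := by
    obtain ⟨s, h, -, h0, -⟩ := hP
    exact exact_rTensor_of_split (LinearMap.ext fun x => LinearMap.congr_fun P.ε_comp_d x)
      (s := s) (h := h 0) h0 _
  exact_succ i j := by
    obtain ⟨s, h, -, -, h1⟩ := hP
    exact exact_rTensor_of_split (LinearMap.ext fun x => LinearMap.congr_fun (P.d_comp_d i) x)
      (s := h i) (h := h (i + 1)) (h1 i) _

/-- The columns of the double complex resolve `P ⊗_U k`, because the Chevalley-Eilenberg complex
of a relatively projective module is exact in positive degrees. -/
noncomputable def ceColumns (hK : IsKoszul k g) (hP : P.IsRelProjective) :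
    (ceDouble P).flip.RowAugmentation where
  Y j := RTensor k (UniversalEnvelopingAlgebra k g) (P.X j) (TrivialModule k g)
  d j := P.tensorD (TrivialModule k g) j
  a j := toCoinvariants k g (P.X j)
  d_d j := rTensor_ext fun m x => by
    have h := LinearMap.congr_fun (P.d_comp_d j) m
    change Submodule.Quotient.mk (P.d j (P.d (j + 1) m) ⊗ₜ[k] x) = 0
    rw [LinearMap.comp_apply] at h
    rw [h, LinearMap.zero_apply, TensorProduct.zero_tmul, Submodule.Quotient.mk_zero]
  a_v j x := by
    have h : toCoinvariants k g (P.X j) ∘ₗ LinearMap.rTensor _ ((P.d j).restrictScalars k) =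
        P.tensorD (TrivialModule k g) j ∘ₗ toCoinvariants k g (P.X (j + 1)) :=
      TensorProduct.ext' fun m ω => rfl
    exact LinearMap.congr_fun h x
  surjective j := toCoinvariants_surjective
  exact_zero j := exact_neg_one_pow_smul exact_toCoinvariants j
  exact_succ i j := by
    refine exact_neg_one_pow_smul (fun y => ?_) j
    change (-1 : k) ^ j • ceD k g (P.X j) i y = 0 ↔ _
    rw [(isUnit_one.neg.pow j).smul_eq_zero]
    constructor
    · exact fun hy => isCEAcyclic_of_isRelProjective hK (hP j) i y hy
    · rintro ⟨z, rfl⟩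
      exact LinearMap.congr_fun (ceD_comp_ceD k g (P.X j) i) z

/-- The projection of the double complex to the Chevalley-Eilenberg complex. -/
noncomputable def toCE (hP : P.IsSplit) : (ceDouble P).totComplex ⟶ ceComplex k g M :=
  (ceRows hP).proj

/-- The projection of the double complex to `P ⊗_U k`. -/
noncomputable def toTensor (hK : IsKoszul k g) (hP : P.IsRelProjective) :
    (ceDouble P).totComplex ⟶ P.tensorComplex (TrivialModule k g) :=
  (ceDouble P).flipMap ≫ (ceColumns hK hP).proj

theorem isIso_toCE (hP : P.IsSplit) (n : ℕ) :
    IsIso (HomologicalComplex.homologyMap (toCE hP) n) :=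
  (ceRows hP).isIso_proj n

theorem isIso_toTensor (hK : IsKoszul k g) (hP : P.IsRelProjective) (n : ℕ) :
    IsIso (HomologicalComplex.homologyMap (toTensor hK hP) n) := by
  have h1 := (ceColumns hK hP).isIso_proj n
  have h2 := DoubleComplex.isIso_flipMap (A := ceDouble P)
  have h3 : IsIso (HomologicalComplex.homologyMap (ceDouble P).flipMap n) := inferInstance
  have h4 : HomologicalComplex.homologyMap (toTensor hK hP) n =
      HomologicalComplex.homologyMap (ceDouble P).flipMap n ≫
        HomologicalComplex.homologyMap (ceColumns hK hP).proj n :=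
    HomologicalComplex.homologyMap_comp _ _ _
  rw [h4]
  exact IsIso.comp_isIso' h3 h1

/-- The isomorphism between Chevalley-Eilenberg homology and the relative torsion product, through
the homology of the double complex. -/
noncomputable def ceHomologyIso (hK : IsKoszul k g) (hP : P.IsRelProjective) (hP' : P.IsSplit)
    (n : ℕ) : ceHomology k g M n ≅ P.relTor (TrivialModule k g) n :=
  have := isIso_toCE hP' n
  have := isIso_toTensor hK hP n
  (asIso (HomologicalComplex.homologyMap (toCE hP') n)).symm ≪≫
    asIso (HomologicalComplex.homologyMap (toTensor hK hP) n)

theorem homologyMap_toCE_comp (hK : IsKoszul k g) (hP : P.IsRelProjective) (hP' : P.IsSplit)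
    (n : ℕ) : HomologicalComplex.homologyMap (toCE hP') n ≫ (ceHomologyIso hK hP hP' n).hom =
      HomologicalComplex.homologyMap (toTensor hK hP) n := by
  have := isIso_toCE hP' n
  simp [ceHomologyIso]

section Naturality

variable {h : Type u} [LieRing h] [LieAlgebra k h] {N : Type u} [AddCommGroup N] [Module k N]
  [Module (UniversalEnvelopingAlgebra k h)ᵐᵒᵖ N]
  [IsScalarTower k (UniversalEnvelopingAlgebra k h)ᵐᵒᵖ N] {f : g →ₗ⁅k⁆ h}
  {φ : M →ₛₗ[(envMapOp k f : (UniversalEnvelopingAlgebra k g)ᵐᵒᵖ →+*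
    (UniversalEnvelopingAlgebra k h)ᵐᵒᵖ)] N}
  {Q : AugComplex k (UniversalEnvelopingAlgebra k h)ᵐᵒᵖ N}

/-- The map of double complexes induced by a map of resolutions. -/
noncomputable def ceDoubleMap (F : AugComplex.Hom (envMapOp k f) φ P Q) :
    DoubleComplex.Hom (ceDouble P) (ceDouble Q) where
  f i j := ceMapX k f (F.f i) j
  h i j x := by
    have h1 : ceMapX k f (F.f i) j ∘ₗ LinearMap.rTensor _ ((P.d i).restrictScalars k) =
        LinearMap.rTensor _ ((Q.d i).restrictScalars k) ∘ₗ ceMapX k f (F.f (i + 1)) j :=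
      TensorProduct.ext' fun m ω => congrArg (· ⊗ₜ[k] exteriorPower.map j (f : g →ₗ[k] h) ω)
        (F.comm i m)
    exact LinearMap.congr_fun h1 x
  v i j x := by
    have h1 : ceMapX k f (F.f i) j (ceD k g (P.X i) j x) =
        ceD k h (Q.X i) j (ceMapX k f (F.f i) (j + 1) x) :=
      (LinearMap.congr_fun (ceMapX_comp_ceD k f (F.f i) j) x).symm
    change ceMapX k f (F.f i) j ((-1 : k) ^ i • ceD k g (P.X i) j x) =
      (-1 : k) ^ i • ceD k h (Q.X i) j (ceMapX k f (F.f i) (j + 1) x)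
    rw [map_smul, h1]

theorem toCE_naturality (F : AugComplex.Hom (envMapOp k f) φ P Q) (hP : P.IsSplit)
    (hQ : Q.IsSplit) :
    toCE hP ≫ ceMap k f φ = DoubleComplex.totMap (ceDoubleMap F) ≫ toCE hQ := by
  have h1 (n : ℕ) : ceMapX k f φ n ∘ₗ LinearMap.rTensor _ (P.ε.restrictScalars k) =
      LinearMap.rTensor _ (Q.ε.restrictScalars k) ∘ₗ ceMapX k f (F.f 0) n :=
    TensorProduct.ext' fun m ω => congrArg (· ⊗ₜ[k] exteriorPower.map n (f : g →ₗ[k] h) ω)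
      (F.comm_ε m)
  refine HomologicalComplex.hom_ext _ _ fun n => ModuleCat.hom_ext (LinearMap.ext fun x => ?_)
  exact LinearMap.congr_fun (h1 n) (x.1 0 n)

theorem zeroEquiv_map (f : g →ₗ[k] h) (ω : ⋀[k]^0 g) :
    exteriorPower.zeroEquiv k h (exteriorPower.map 0 f ω) = exteriorPower.zeroEquiv k g ω := by
  obtain ⟨c, rfl⟩ := (exteriorPower.zeroEquiv k g).symm.surjective ω
  simp [exteriorPower.zeroEquiv_symm_apply]

theorem toTensor_naturality (F : AugComplex.Hom (envMapOp k f) φ P Q) (hK : IsKoszul k g)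
    (hP : P.IsRelProjective) (hK' : IsKoszul k h) (hQ : Q.IsRelProjective) :
    toTensor hK hP ≫ AugComplex.tensorMap F (trivialMap k f) =
      DoubleComplex.totMap (ceDoubleMap F) ≫ toTensor hK' hQ := by
  have h1 (n : ℕ) (m : P.X n) (ω : ⋀[k]^0 g) :
      (AugComplex.tensorMap F (trivialMap k f)).f n (toCoinvariants k g (P.X n) (m ⊗ₜ[k] ω)) =
        toCoinvariants k h (Q.X n) (ceMapX k f (F.f n) 0 (m ⊗ₜ[k] ω)) :=
    congrArg (fun c : TrivialModule k h => (balancedRel k (UniversalEnvelopingAlgebra k h) (Q.X n)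
      (TrivialModule k h)).mkQ (F.f n m ⊗ₜ[k] c)) (zeroEquiv_map (f : g →ₗ[k] h) ω).symm
  have h2 (n : ℕ) : ((AugComplex.tensorMap F (trivialMap k f)).f n).hom ∘ₗ
      toCoinvariants k g (P.X n) = toCoinvariants k h (Q.X n) ∘ₗ ceMapX k f (F.f n) 0 :=
    TensorProduct.ext' (h1 n)
  refine HomologicalComplex.hom_ext _ _ fun n => ModuleCat.hom_ext (LinearMap.ext fun x => ?_)
  exact LinearMap.congr_fun (h2 n) (x.1 n 0)

theorem ceHomologyIso_naturality (F : AugComplex.Hom (envMapOp k f) φ P Q) (hK : IsKoszul k g)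
    (hP : P.IsRelProjective) (hP' : P.IsSplit) (hK' : IsKoszul k h) (hQ : Q.IsRelProjective)
    (hQ' : Q.IsSplit) (n : ℕ) :
    ceHomologyMap k f φ n ≫ (ceHomologyIso hK' hQ hQ' n).hom =
      (ceHomologyIso hK hP hP' n).hom ≫ AugComplex.relTorMap F (trivialMap k f) n := by
  have := isIso_toCE hP' n
  rw [← cancel_epi (HomologicalComplex.homologyMap (toCE hP') n), ← Category.assoc,
    ← Category.assoc, homologyMap_toCE_comp, ← HomologicalComplex.homologyMap_comp,
    ← HomologicalComplex.homologyMap_comp, toCE_naturality F hP' hQ',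
    toTensor_naturality F hK hP hK' hQ, HomologicalComplex.homologyMap_comp,
    HomologicalComplex.homologyMap_comp, Category.assoc, homologyMap_toCE_comp]

end Naturality

end Comparison

end CEHom

theorem mainTheorem3 (k : Type u) [CommRing k] :
    (∃ θ : ∀ (g : Type u) [LieRing g] [LieAlgebra k g]
        (_ : (IsDomain k ∧ IsPrincipalIdealRing k) ∨ Module.Flat k g)
        (M : Type u) [AddCommGroup M] [Module k M] [Module (UniversalEnvelopingAlgebra k g)ᵐᵒᵖ M]
        [IsScalarTower k (UniversalEnvelopingAlgebra k g)ᵐᵒᵖ M]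
        (P : CEHom.AugComplex k (UniversalEnvelopingAlgebra k g)ᵐᵒᵖ M)
        (_ : P.IsRelProjective) (_ : P.IsSplit) (n : ℕ),
        CEHom.ceHomology k g M n ≅ P.relTor (CEHom.TrivialModule k g) n,
      ∀ (g h : Type u) [LieRing g] [LieAlgebra k g] [LieRing h] [LieAlgebra k h]
        (hg : (IsDomain k ∧ IsPrincipalIdealRing k) ∨ Module.Flat k g)
        (hh : (IsDomain k ∧ IsPrincipalIdealRing k) ∨ Module.Flat k h)
        (f : g →ₗ⁅k⁆ h)
        (M N : Type u) [AddCommGroup M] [Module k M]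
        [Module (UniversalEnvelopingAlgebra k g)ᵐᵒᵖ M]
        [IsScalarTower k (UniversalEnvelopingAlgebra k g)ᵐᵒᵖ M]
        [AddCommGroup N] [Module k N] [Module (UniversalEnvelopingAlgebra k h)ᵐᵒᵖ N]
        [IsScalarTower k (UniversalEnvelopingAlgebra k h)ᵐᵒᵖ N]
        (φ : M →ₛₗ[(CEHom.envMapOp k f : (UniversalEnvelopingAlgebra k g)ᵐᵒᵖ →+*
          (UniversalEnvelopingAlgebra k h)ᵐᵒᵖ)] N)
        (P : CEHom.AugComplex k (UniversalEnvelopingAlgebra k g)ᵐᵒᵖ M)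
        (hP : P.IsRelProjective) (hP' : P.IsSplit)
        (Q : CEHom.AugComplex k (UniversalEnvelopingAlgebra k h)ᵐᵒᵖ N)
        (hQ : Q.IsRelProjective) (hQ' : Q.IsSplit)
        (F : CEHom.AugComplex.Hom (CEHom.envMapOp k f) φ P Q) (n : ℕ),
        CEHom.ceHomologyMap k f φ n ≫ (θ h hh N Q hQ hQ' n).hom =
          (θ g hg M P hP hP' n).hom ≫
            CEHom.AugComplex.relTorMap F (CEHom.trivialMap k f) n) ∧
    ∀ (g : Type u) [LieRing g] [LieAlgebra k g],
      (IsDomain k ∧ IsPrincipalIdealRing k) ∨ Module.Flat k g →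
      (CEHom.ceResolution k g).IsRelProjective ∧ (CEHom.ceResolution k g).IsPure := by
  exact ⟨⟨fun g _ _ hg M _ _ _ _ P hP hP' n =>
      CEHom.ceHomologyIso (CEHom.isKoszul hg) hP hP' n,
    fun g h _ _ _ _ hg hh f M N _ _ _ _ _ _ _ _ φ P hP hP' Q hQ hQ' F n =>
      CEHom.ceHomologyIso_naturality F (CEHom.isKoszul hg) hP hP' (CEHom.isKoszul hh) hQ hQ' n⟩,
    fun g _ _ hg => ⟨CEHom.isRelProjective_ceResolution k g,
      CEHom.isPure_ceResolution (CEHom.isKoszul hg)⟩⟩
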